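/- There is an algorithm on the word RAM and a constant $C$ such that the following holds. Let $T_1, T_2$ be two finite ordered rooted trees whose nodes are labeled with symbols from some alphabet, each with at most $n$ nodes, where $n \ge 2$. Allow two unit-cost operations on an ordered labeled forest: changing the label of one node to another symbol, and deleting one node, whereby its children take its place, in the same order, among the children of its parent (or among the roots, if the deleted node is a root). The unweighted tree edit distance $\mathrm{ed}(T_1,T_2)$ is the minimum total number of operations that must be performed on $T_1$ and $T_2$ in order to obtain two identical forests. If $k \ge 1$ is an integer with $\mathrm{ed}(T_1,T_2) \le k$, then, given $k$, $T_1$ and $T_2$, the algorithm computes $\mathrm{ed}(T_1,T_2)$ exactly in at most $C\, n k^2 \log n$ steps. Here the word RAM has words of $w$ bits, where $w \ge c \log_2 n$ for a suitable constant $c$; loading a constant, addition, subtraction and multiplication modulo $2^w$, conditional jumps on comparisons of words, and indirect loads and stores take one step each. Registers and all memory cells outside the input are initially $0$. Every number in the input, including $k$, fits into one word; each node label is stored as one word, and a tree is given by listing, in preorder, the label and the number of children of every node. The program and the constants $C$ and $c$ depend neither on the trees nor on the alphabet, $n$, $k$ or $w$. -/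

import Mathlib

/-! ### Ordered labeled forests and the tree edit distance -/

/-- Finite ordered forests whose nodes carry labels from `A`: a forest is either empty, or consists
of a leftmost tree, given by the label of its root and the forest of the (ordered) subtrees below
that root, followed by the forest of the remaining trees. -/
inductive OrdForest (A : Type*) where
  | nil : OrdForest A
  | cons (label : A) (children : OrdForest A) (rest : OrdForest A) : OrdForest A

namespace OrdForest

variable {A : Type*}

/-- Number of nodes. -/
def size : OrdForest A → ℕ
  | nil => 0
  | cons _ children rest => 1 + children.size + rest.size

/-- Number of trees. -/
def numTrees : OrdForest A → ℕ
  | nil => 0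
  | cons _ _ rest => 1 + rest.numTrees

/-- `F.append G` is the forest formed by the trees of `F` followed by the trees of `G`. -/
def append : OrdForest A → OrdForest A → OrdForest A
  | nil, G => G
  | cons a children rest, G => cons a children (rest.append G)

/-- `Edit F G`: the forest `G` arises from `F` by one elementary operation, which is either the
relabeling or the deletion of a single node. When a node is deleted, its children take its place
in the list of children of its parent (or in the list of trees of the forest, if it is a root). -/
inductive Edit : OrdForest A → OrdForest A → Prop
  | relabel (a b : A) (children rest : OrdForest A) (h : a ≠ b) :
      Edit (cons a children rest) (cons b children rest)
  | delete (a : A) (children rest : OrdForest A) :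
      Edit (cons a children rest) (children.append rest)
  | inner (a : A) (children children' rest : OrdForest A) (h : Edit children children') :
      Edit (cons a children rest) (cons a children' rest)
  | right (a : A) (children rest rest' : OrdForest A) (h : Edit rest rest') :
      Edit (cons a children rest) (cons a children rest')

/-- `EditSeq m F G`: the forest `G` arises from `F` by a sequence of exactly `m` elementary
operations. -/
inductive EditSeq : ℕ → OrdForest A → OrdForest A → Prop
  | refl (F : OrdForest A) : EditSeq 0 F F
  | step {m : ℕ} {F G H : OrdForest A} (h : Edit F G) (t : EditSeq m G H) : EditSeq (m + 1) F H

/-- Some numbers of operations on `F` and on `F'` that lead to identical forests add up to `m`. -/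
def EditableIn (F F' : OrdForest A) (m : ℕ) : Prop :=
  ∃ (i j : ℕ) (G : OrdForest A), i + j = m ∧ EditSeq i F G ∧ EditSeq j F' G

theorem size_append (F G : OrdForest A) : (F.append G).size = F.size + G.size := by
  induction F with
  | nil => simp [append, size]
  | cons a c r _ ih => simp only [append, size, ih]; omega

theorem editSeq_nil (F : OrdForest A) : EditSeq F.size F nil := by
  generalize hm : F.size = m
  induction m generalizing F with
  | zero =>
    cases F with
    | nil => exact EditSeq.refl _
    | cons a c r => simp only [size] at hm; omega
  | succ m ih =>
    cases F with
    | nil => simp [size] at hm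
    | cons a c r =>
      refine EditSeq.step (Edit.delete a c r) (ih _ ?_)
      rw [size_append]; simp only [size] at hm; omega

theorem exists_editableIn (F F' : OrdForest A) : ∃ m, EditableIn F F' m :=
  ⟨F.size + F'.size, F.size, F'.size, nil, rfl, editSeq_nil F, editSeq_nil F'⟩

open Classical in
/-- The unweighted edit distance of two ordered labeled forests: the minimum total number of
operations performed on the two forests in order to obtain two identical forests. -/
noncomputable def editDist (F F' : OrdForest A) : ℕ := Nat.find (exists_editableIn F F')

/-- The nodes listed in preorder, each one as two numbers: the code of its label and the number
of its children. -/
def encode (code : A → ℕ) : OrdForest A → List ℕ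
  | nil => []
  | cons a children rest =>
      code a :: children.numTrees :: (children.encode code ++ rest.encode code)

end OrdForest

/-- Ordered rooted trees whose nodes carry labels from `A`: a root and the forest below it. -/
structure OrdTree (A : Type*) where
  label : A
  children : OrdForest A

namespace OrdTree

variable {A : Type*}

/-- A tree as a forest with exactly one tree. -/
def toForest (T : OrdTree A) : OrdForest A := OrdForest.cons T.label T.children OrdForest.nil

/-- Number of nodes. -/
def size (T : OrdTree A) : ℕ := T.toForest.size

/-- The unweighted tree edit distance. -/
noncomputable def editDist (T₁ T₂ : OrdTree A) : ℕ := T₁.toForest.editDist T₂.toForest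

/-- The input of the bounded tree edit distance problem as a list of numbers: the parameter `k`,
the numbers of nodes of the two trees, and the encodings of the two trees. -/
def input (code : A → ℕ) (k : ℕ) (T₁ T₂ : OrdTree A) : List ℕ :=
  k :: T₁.size :: T₂.size :: (T₁.toForest.encode code ++ T₂.toForest.encode code)

end OrdTree

/-! ### The word RAM -/

namespace WordRAM

/-- Instructions. Operands `r`, `s`, `t` are numbers of registers, `target` is a position in the
program. Every instruction is executed in one unit of time. -/
inductive Instr where
  /-- `r := c` -/
  | const (r c : ℕ)
  /-- `r := s + t` -/
  | add (r s t : ℕ)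
  /-- `r := s - t` -/
  | sub (r s t : ℕ)
  /-- `r := s * t` -/
  | mul (r s t : ℕ)
  /-- `r := memory[s]` -/
  | load (r s : ℕ)
  /-- `memory[r] := s` -/
  | store (r s : ℕ)
  /-- `if s < t then goto target` -/
  | jumpLt (s t target : ℕ)
  /-- `if s = t then goto target` -/
  | jumpEq (s t target : ℕ)
  /-- stop -/
  | halt

/-- A program is a finite list of instructions, and so uses only finitely many registers. -/
abbrev Program := List Instr

/-- Configurations: program counter, registers, and random access memory. -/
@[ext]
structure Config where
  pc : ℕ
  reg : ℕ → ℕ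
  mem : ℕ → ℕ

/-- Write `x` into register `r`, and go to the next instruction. -/
def Config.setReg (σ : Config) (r x : ℕ) : Config :=
  { σ with pc := σ.pc + 1, reg := Function.update σ.reg r x }

/-- The effect of one instruction on a machine with words of `w` bits. Arithmetic is modulo `2 ^ w`
and comparisons are those of unsigned integers. In particular registers always hold numbers below
`2 ^ w`, so that only memory cells with addresses below `2 ^ w` can be reached. -/
def exec (w : ℕ) (σ : Config) : Instr → Config
  | .const r c => σ.setReg r (c % 2 ^ w)
  | .add r s t => σ.setReg r ((σ.reg s + σ.reg t) % 2 ^ w)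
  | .sub r s t => σ.setReg r ((σ.reg s + (2 ^ w - σ.reg t)) % 2 ^ w)
  | .mul r s t => σ.setReg r ((σ.reg s * σ.reg t) % 2 ^ w)
  | .load r s => σ.setReg r (σ.mem (σ.reg s))
  | .store r s => { σ with pc := σ.pc + 1, mem := Function.update σ.mem (σ.reg r) (σ.reg s) }
  | .jumpLt s t target => { σ with pc := if σ.reg s < σ.reg t then target else σ.pc + 1 }
  | .jumpEq s t target => { σ with pc := if σ.reg s = σ.reg t then target else σ.pc + 1 }
  | .halt => σ

/-- One step of the program `P` on a machine with words of `w` bits. -/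
def step (w : ℕ) (P : Program) (σ : Config) : Config :=
  match P[σ.pc]? with
  | some i => exec w σ i
  | none => σ

/-- The machine has stopped: the current instruction is `halt`. -/
def Halted (P : Program) (σ : Config) : Prop := P[σ.pc]? = some Instr.halt

/-- Initially the input is stored in the memory cells `0, 1, 2, …`, and all the other memory cells
and all registers are zero. -/
def start (x : List ℕ) : Config where
  pc := 0
  reg := fun _ => 0
  mem := fun i => x.getD i 0

/-- The input fits into the memory of a machine with words of `w` bits: there are at most `2 ^ w`
numbers in it, and each of them is a word of `w` bits. -/
def Fits (w : ℕ) (x : List ℕ) : Prop := x.length ≤ 2 ^ w ∧ ∀ a ∈ x, a < 2 ^ w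

/-- On input `x`, the program `P` stops after `t` steps with output `y` in register `0`. -/
def OutputsIn (w : ℕ) (P : Program) (x : List ℕ) (t y : ℕ) : Prop :=
  Halted P ((step w P)^[t] (start x)) ∧ ((step w P)^[t] (start x)).reg 0 = y

end WordRAM

namespace OrdForest

/-! ### Edit distance by alignments, with recurrences at both ends of a forest -/

section EditDistance

variable {A : Type*}

/-! Both trees are written as one sequence of parentheses, the first one in `[0, L)` and the second
one in `[L, 2N)`. Subproblems are pairs of intervals of positions. Deleting an end root moves one
end of an interval by a single position, because the partner parenthesis becomes unmatched and is
ignored (`ofParens_delete_left`, `ofParens_delete_right`). The classical recurrence deletes one of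
two leftmost roots, or matches them and splits the problem into the forests below the roots and the
remaining forests; the same holds for rightmost roots. The left version comes from describing the
distance by `Align` (`editDist_le_iff`), the right one from reversing all sibling orders. Two
savings turn this recurrence into a fast algorithm.

Few intervals of the first tree. The recurrence may choose the side it works on. As long as the
current forest is not a single tree, the smaller one of its two end trees is removed position by
position, and its root is marked so that the nodes inside it are treated later. The removed tree has
at most half the length, so the number of intervals obeys the recursion solved by `stateBound`,
which is of order `n log n` (`stateBound_split`). The intervals are numbered in such a way that
every one refers to larger numbers only (`Planning.singleStep`, `Planning.leftStep`,
`Planning.rightStep`, `Planned.ok`).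

Few intervals of the second tree. The `potential` adds the displacements of the two ends, the
numbers of unmatched positions, and twice the distance. Some optimal branch of the recurrence never
increases it. A deletion lowers the distance by one and hence frees two units, which pay for one
unit of displacement and one newly unmatched parenthesis; skipping an unmatched position pays for
its own displacement; and at a match the displacement at the cut is controlled from each side by the
part lying on that side (`UpperOK.match_left`, `UpperOK.match_right`, `UpperOK.match_single`). At
the start the potential is at most four times the distance. With `B = 4 * min k N`, entries
displaced by more than `B` can therefore be replaced by the trivial bound `N`. A table entry is
never below the true distance, and equals it whenever the potential is at most `B` (`entry_good`,
`lookup_good`). This leaves on the order of `k ^ 2` entries for each interval of the first tree.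

The algorithm is written in a small imperative language over the natural numbers, whose semantics
carries a clock and forbids overflow. `Exec.runs` transfers results and running times to the word
RAM, and `main_correct` combines parsing, writing the states, and filling the table. -/

theorem append_nil (F : OrdForest A) : F.append nil = F := by
  induction F with
  | nil => rfl
  | cons a c r _ ih => simp [append, ih]

theorem append_assoc (F G H : OrdForest A) :
    (F.append G).append H = F.append (G.append H) := by
  induction F with
  | nil => rfl
  | cons a c r _ ih => simp [append, ih]

theorem Edit.append_right {F F' : OrdForest A} (h : Edit F F') (G : OrdForest A) :
    Edit (F.append G) (F'.append G) := by
  induction h with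
  | relabel a b c r h => exact Edit.relabel a b c _ h
  | delete a c r => rw [append_assoc]; exact Edit.delete a c _
  | inner a c c' r h _ => exact Edit.inner a c c' _ h
  | right a c r r' h ih => exact Edit.right a c _ _ ih

theorem Edit.append_left {F F' : OrdForest A} (h : Edit F F') (G : OrdForest A) :
    Edit (G.append F) (G.append F') := by
  induction G with
  | nil => exact h
  | cons a c r _ ih => exact Edit.right a c _ _ ih

/-- `Align F G m`: deleting and relabeling nodes of the two forests, starting from the left, makes
them equal at cost at most `m`. -/
inductive Align : OrdForest A → OrdForest A → ℕ → Prop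
  | nil (m : ℕ) : Align nil nil m
  | delLeft {a : A} {c r G : OrdForest A} {m : ℕ} (h : Align (c.append r) G m) :
      Align (cons a c r) G (m + 1)
  | delRight {b : A} {F c r : OrdForest A} {m : ℕ} (h : Align F (c.append r) m) :
      Align F (cons b c r) (m + 1)
  | pair {a b : A} {c r c' r' : OrdForest A} {d m m' : ℕ} (hd : a ≠ b → 1 ≤ d)
      (h : Align c c' m) (h' : Align r r' m') : Align (cons a c r) (cons b c' r') (d + m + m')

theorem Align.mono {F G : OrdForest A} {m m' : ℕ} (h : Align F G m) (hm : m ≤ m') :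
    Align F G m' := by
  induction h generalizing m' with
  | nil m => exact .nil _
  | delLeft _ ih =>
    obtain ⟨n, rfl⟩ : ∃ n, m' = n + 1 := ⟨m' - 1, by omega⟩
    exact .delLeft (ih (by omega))
  | delRight _ ih =>
    obtain ⟨n, rfl⟩ : ∃ n, m' = n + 1 := ⟨m' - 1, by omega⟩
    exact .delRight (ih (by omega))
  | @pair a b c r c' r' d m₁ m₂ hd _ h₂ ih₁ _ =>
    have := Align.pair hd (ih₁ (m' := m' - d - m₂) (by omega)) h₂
    rwa [show d + (m' - d - m₂) + m₂ = m' by omega] at this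

theorem Align.symm {F G : OrdForest A} {m : ℕ} (h : Align F G m) : Align G F m := by
  induction h with
  | nil m => exact .nil m
  | delLeft _ ih => exact .delRight ih
  | delRight _ ih => exact .delLeft ih
  | pair hd _ _ ih ih' => exact .pair (fun e => hd e.symm) ih ih'

theorem Align.refl (F : OrdForest A) : Align F F 0 := by
  induction F with
  | nil => exact .nil 0
  | cons a c r ih ih' => exact .pair (d := 0) (fun e => absurd rfl e) ih ih'

/-- Induction on the alignment, following the place of the edit. An undone deletion of the leftmost
root becomes a `delLeft`; a relabeling raises the label cost of a `pair`, and is lost if that root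
gets deleted anyway; edits elsewhere pass to the component that contains them. So edits in arbitrary
order can be absorbed into a left-to-right alignment. -/
theorem Align.of_edit {F' G : OrdForest A} {m : ℕ} (h : Align F' G m) :
    ∀ F, Edit F F' → Align F G (m + 1) := by
  induction h with
  | nil m =>
    intro F hF
    generalize hn : (OrdForest.nil : OrdForest A) = N at hF
    cases hF with
    | delete a c r => exact .delLeft (hn ▸ .nil m)
    | _ => cases hn
  | @delLeft b c r G m h ih =>
    intro F hF
    generalize hn : OrdForest.cons b c r = N at hF
    cases hF with
    | delete => exact .delLeft (by rw [← hn]; exact .delLeft h)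
    | relabel => cases hn; exact .delLeft (h.mono (by omega))
    | inner _ _ _ _ he => cases hn; exact .delLeft (ih _ (he.append_right _))
    | right _ _ _ _ he => cases hn; exact .delLeft (ih _ (he.append_left _))
  | delRight _ ih => exact fun F hF => .delRight (ih F hF)
  | @pair a b c r c' r' d m₁ m₂ hd h₁ h₂ ih₁ ih₂ =>
    intro F hF
    generalize hn : OrdForest.cons a c r = N at hF
    cases hF with
    | delete => exact .delLeft (by rw [← hn]; exact .pair hd h₁ h₂)
    | relabel =>
      cases hn
      rw [show d + m₁ + m₂ + 1 = (d + 1) + m₁ + m₂ by omega]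
      exact .pair (fun _ => by omega) h₁ h₂
    | inner _ _ _ _ he =>
      cases hn
      rw [show d + m₁ + m₂ + 1 = d + (m₁ + 1) + m₂ by omega]
      exact .pair hd (ih₁ _ he) h₂
    | right _ _ _ _ he =>
      cases hn
      rw [show d + m₁ + m₂ + 1 = d + m₁ + (m₂ + 1) by omega]
      exact .pair hd h₁ (ih₂ _ he)

theorem Align.of_editSeq {F F' G : OrdForest A} {i m : ℕ} (hs : EditSeq i F F')
    (h : Align F' G m) : Align F G (i + m) := by
  induction hs with
  | refl F => simpa using h
  | @step n F F' H he _ ih =>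
    have := (ih h).of_edit _ he
    rwa [show n + 1 + m = n + m + 1 by omega]

theorem EditSeq.trans {F G H : OrdForest A} {i j : ℕ} (h : EditSeq i F G) (h' : EditSeq j G H) :
    EditSeq (i + j) F H := by
  induction h with
  | refl F => simpa using h'
  | @step n F F' K he _ ih =>
    have := EditSeq.step he (ih h')
    rwa [show n + 1 + j = n + j + 1 by omega]

theorem EditSeq.cons (a : A) {c c' r r' : OrdForest A} {i j : ℕ} (h : EditSeq i c c')
    (h' : EditSeq j r r') : EditSeq (i + j) (OrdForest.cons a c r) (OrdForest.cons a c' r') := by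
  refine EditSeq.trans (G := OrdForest.cons a c' r) ?_ ?_
  · clear h'
    induction h with
    | refl F => exact .refl _
    | step he _ ih => exact .step (.inner _ _ _ _ he) ih
  · clear h
    induction h' with
    | refl F => exact .refl _
    | step he _ ih => exact .step (.right _ _ _ _ he) ih

/-- An alignment can be executed as it stands; in a pair with different labels, the root on the left
is the one relabeled. -/
theorem Align.exists_editSeq {F G : OrdForest A} {m : ℕ} (h : Align F G m) :
    ∃ (i j : ℕ) (H : OrdForest A), i + j ≤ m ∧ EditSeq i F H ∧ EditSeq j G H := by
  induction h with
  | nil m => exact ⟨0, 0, _, by omega, .refl _, .refl _⟩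
  | delLeft _ ih =>
    obtain ⟨i, j, H, hm, h₁, h₂⟩ := ih
    exact ⟨i + 1, j, H, by omega, .step (.delete _ _ _) h₁, h₂⟩
  | delRight _ ih =>
    obtain ⟨i, j, H, hm, h₁, h₂⟩ := ih
    exact ⟨i, j + 1, H, by omega, h₁, .step (.delete _ _ _) h₂⟩
  | @pair a b c r c' r' d m₁ m₂ hd _ _ ih ih' =>
    obtain ⟨i, j, H, hm, h₁, h₂⟩ := ih
    obtain ⟨i', j', H', hm', h₁', h₂'⟩ := ih'
    by_cases hab : a = b
    · subst hab
      exact ⟨_, _, _, by omega, h₁.cons a h₁', h₂.cons a h₂'⟩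
    · exact ⟨_, _, _, by have := hd hab; omega,
        .step (.relabel _ _ _ _ hab) (h₁.cons b h₁'), h₂.cons b h₂'⟩

theorem editDist_le_iff {F G : OrdForest A} {m : ℕ} : F.editDist G ≤ m ↔ Align F G m := by
  classical
  constructor
  · intro h
    obtain ⟨i, j, H, hm, h₁, h₂⟩ := Nat.find_spec (exists_editableIn F G)
    -- The common forest is aligned with itself for free; this alignment is pulled back along one
    -- script, reversed, and pulled back along the other.
    have h₃ := Align.of_editSeq h₁ (Align.of_editSeq h₂ (Align.refl H)).symm
    refine h₃.mono (le_trans (le_of_eq ?_) h)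
    rw [add_zero, hm]; rfl
  · intro h
    obtain ⟨i, j, H, hm, h₁, h₂⟩ := h.exists_editSeq
    exact (Nat.find_min' (exists_editableIn F G) ⟨i, j, H, rfl, h₁, h₂⟩).trans hm

theorem align_editDist (F G : OrdForest A) : Align F G (F.editDist G) := editDist_le_iff.1 le_rfl

theorem editDist_comm (F G : OrdForest A) : F.editDist G = G.editDist F :=
  le_antisymm (editDist_le_iff.2 (align_editDist G F).symm)
    (editDist_le_iff.2 (align_editDist F G).symm)

theorem Edit.editDist_le {F F' : OrdForest A} (h : Edit F F') (G : OrdForest A) :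
    F.editDist G ≤ 1 + F'.editDist G := by
  rw [add_comm]
  exact editDist_le_iff.2 ((align_editDist F' G).of_edit F h)

theorem Edit.editDist_le' {G G' : OrdForest A} (h : Edit G G') (F : OrdForest A) :
    F.editDist G ≤ 1 + F.editDist G' := by
  rw [editDist_comm F, editDist_comm F]
  exact h.editDist_le F

theorem editDist_nil_left (G : OrdForest A) : (nil : OrdForest A).editDist G = G.size := by
  apply le_antisymm
  · refine editDist_le_iff.2 (Align.symm ?_)
    exact Align.of_editSeq (m := 0) (editSeq_nil G) (.nil 0)
  · have key : ∀ {F G : OrdForest A} {m : ℕ}, Align F G m → G.size ≤ F.size + m := by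
      intro F G m h
      induction h with
      | nil m => simp
      | delLeft _ ih => simp only [size, size_append] at *; omega
      | delRight _ ih => simp only [size, size_append] at *; omega
      | pair hd _ _ ih ih' => simp only [size] at *; omega
    simpa [size] using key (align_editDist nil G)

/-- Only deletions change sizes, each by one. This later limits how much the lengths of two
intervals can differ. -/
theorem size_le_add_editDist (F G : OrdForest A) : G.size ≤ F.size + F.editDist G := by
  have key : ∀ {F G : OrdForest A} {m : ℕ}, Align F G m → G.size ≤ F.size + m := by
    intro F G m h
    induction h with
    | nil m => simp
    | delLeft _ ih => simp only [size, size_append] at *; omega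
    | delRight _ ih => simp only [size, size_append] at *; omega
    | pair hd _ _ ih ih' => simp only [size] at *; omega
  exact key (align_editDist F G)

theorem size_le_add_editDist' (F G : OrdForest A) : F.size ≤ G.size + F.editDist G := by
  rw [editDist_comm]; exact size_le_add_editDist G F

theorem editDist_nil_right (F : OrdForest A) : F.editDist nil = F.size := by
  rw [editDist_comm, editDist_nil_left]

theorem editDist_le_size (F G : OrdForest A) : F.editDist G ≤ F.size + G.size := by
  rw [editDist_le_iff]
  have h := Align.of_editSeq (m := 0) (editSeq_nil G) (.nil 0)
  exact Align.of_editSeq (editSeq_nil F) h.symm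

section

variable [DecidableEq A]

theorem editDist_cons_cons_le (a b : A) (c r c' r' : OrdForest A) :
    (cons a c r).editDist (cons b c' r') ≤
      (if a = b then 0 else 1) + c.editDist c' + r.editDist r' :=
  editDist_le_iff.2 (.pair (fun h => by simp [h]) (align_editDist _ _) (align_editDist _ _))

/-- The recurrence that treats the leftmost roots. -/
theorem editDist_cons_cons_cases (a b : A) (c r c' r' : OrdForest A) :
    1 + (c.append r).editDist (cons b c' r') ≤ (cons a c r).editDist (cons b c' r') ∨
    1 + (cons a c r).editDist (c'.append r') ≤ (cons a c r).editDist (cons b c' r') ∨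
    (if a = b then 0 else 1) + c.editDist c' + r.editDist r' ≤
      (cons a c r).editDist (cons b c' r') := by
  have h := align_editDist (cons a c r) (cons b c' r')
  generalize (cons a c r).editDist (cons b c' r') = m at h
  revert h
  generalize hF : cons a c r = F
  generalize hG : cons b c' r' = G
  intro h
  cases h with
  | nil m => cases hF
  | delLeft h =>
    cases hF; left
    have := editDist_le_iff.2 h
    omega
  | delRight h =>
    cases hG; right; left
    have := editDist_le_iff.2 h
    omega
  | pair hd h h' =>
    cases hF; cases hG; right; right
    have h₁ := editDist_le_iff.2 h
    have h₂ := editDist_le_iff.2 h'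
    split_ifs with hab
    · omega
    · have := hd hab; omega

end

/-- The forest with the order of siblings reversed everywhere. -/
def mirror : OrdForest A → OrdForest A
  | nil => nil
  | cons a c r => r.mirror.append (cons a c.mirror nil)

theorem mirror_append (F G : OrdForest A) :
    (F.append G).mirror = G.mirror.append F.mirror := by
  induction F with
  | nil => simp [append, mirror, append_nil]
  | cons a c r _ ih => simp [append, mirror, ih, append_assoc]

theorem mirror_mirror (F : OrdForest A) : F.mirror.mirror = F := by
  induction F with
  | nil => rfl
  | cons a c r ih ih' => simp [mirror, mirror_append, ih, ih', append]

/-- The elementary operations do not distinguish left from right. Hence every statement about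
leftmost roots yields one about rightmost roots. -/
theorem Edit.mirror {F F' : OrdForest A} (h : Edit F F') : Edit F.mirror F'.mirror := by
  induction h with
  | relabel a b c r h => exact (Edit.relabel a b _ _ h).append_left _
  | delete a c r =>
    rw [mirror_append]
    have := (Edit.delete a c.mirror OrdForest.nil).append_left r.mirror
    rwa [append_nil] at this
  | inner a c c' r h ih => exact (Edit.inner a _ _ _ ih).append_left _
  | right a c r r' h ih => exact ih.append_right _

theorem EditSeq.mirror {F F' : OrdForest A} {m : ℕ} (h : EditSeq m F F') :
    EditSeq m F.mirror F'.mirror := by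
  induction h with
  | refl F => exact .refl _
  | step he _ ih => exact .step he.mirror ih

theorem editDist_mirror (F G : OrdForest A) : F.mirror.editDist G.mirror = F.editDist G := by
  have key : ∀ F G : OrdForest A, F.mirror.editDist G.mirror ≤ F.editDist G := by
    intro F G
    obtain ⟨i, j, H, hm, h₁, h₂⟩ := (align_editDist F G).exists_editSeq
    classical
    exact (Nat.find_min' (exists_editableIn F.mirror G.mirror)
      ⟨i, j, _, rfl, h₁.mirror, h₂.mirror⟩).trans hm
  refine le_antisymm (key F G) ?_
  have := key F.mirror G.mirror
  rwa [mirror_mirror, mirror_mirror] at this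

theorem Edit.delete_last (a : A) (F c : OrdForest A) :
    Edit (F.append (OrdForest.cons a c OrdForest.nil)) (F.append c) := by
  have := (Edit.delete a c OrdForest.nil).append_left F
  rwa [append_nil] at this

section

variable [DecidableEq A]

theorem editDist_append_append_le (a b : A) (c r c' r' : OrdForest A) :
    (r.append (cons a c nil)).editDist (r'.append (cons b c' nil)) ≤
      (if a = b then 0 else 1) + c.editDist c' + r.editDist r' := by
  have := editDist_cons_cons_le a b c.mirror r.mirror c'.mirror r'.mirror
  rw [editDist_mirror, editDist_mirror, ← editDist_mirror] at this
  simpa [OrdForest.mirror, mirror_mirror] using this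

/-- The recurrence that treats the rightmost roots. -/
theorem editDist_append_append_cases (a b : A) (c r c' r' : OrdForest A) :
    1 + (r.append c).editDist (r'.append (cons b c' nil)) ≤
      (r.append (cons a c nil)).editDist (r'.append (cons b c' nil)) ∨
    1 + (r.append (cons a c nil)).editDist (r'.append c') ≤
      (r.append (cons a c nil)).editDist (r'.append (cons b c' nil)) ∨
    (if a = b then 0 else 1) + c.editDist c' + r.editDist r' ≤
      (r.append (cons a c nil)).editDist (r'.append (cons b c' nil)) := by
  have := editDist_cons_cons_cases a b c.mirror r.mirror c'.mirror r'.mirror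
  have e1 : ∀ (x : A) (s t : OrdForest A),
      cons x s.mirror t.mirror = (t.append (cons x s nil)).mirror := by
    intro x s t; simp [mirror_append, OrdForest.mirror, append]
  simpa only [e1, ← mirror_append, editDist_mirror] using this

end

/-- Applying a function to all the labels. -/
def map {A' : Type*} (f : A → A') : OrdForest A → OrdForest A'
  | nil => nil
  | cons a c r => cons (f a) (c.map f) (r.map f)

section

variable {A' : Type*} (f : A → A')

theorem map_append (F G : OrdForest A) : (F.append G).map f = (F.map f).append (G.map f) := by
  induction F with
  | nil => rfl
  | cons a c r _ ih => simp [append, map, ih]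

theorem size_map (F : OrdForest A) : (F.map f).size = F.size := by
  induction F with
  | nil => rfl
  | cons a c r ih ih' => simp [map, size, ih, ih']

theorem numTrees_map (F : OrdForest A) : (F.map f).numTrees = F.numTrees := by
  induction F with
  | nil => rfl
  | cons a c r _ ih' => simp [map, numTrees, ih']

theorem encode_map (code : A → ℕ) (F : OrdForest A) : (F.map code).encode id = F.encode code := by
  induction F with
  | nil => rfl
  | cons a c r ih ih' => simp [map, encode, numTrees_map, ih, ih']

theorem Align.map {F G : OrdForest A} {m : ℕ} (h : Align F G m) :
    Align (F.map f) (G.map f) m := by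
  induction h with
  | nil m => exact .nil m
  | delLeft _ ih => exact .delLeft (by rwa [map_append] at ih)
  | delRight _ ih => exact .delRight (by rwa [map_append] at ih)
  | pair hd _ _ ih ih' => exact .pair (fun e => hd fun e' => e (by rw [e'])) ih ih'

/-- Alignments are carried along any map of labels, and along a left inverse back again. This
permits replacing the alphabet by the codes of its symbols. -/
theorem editDist_map {f : A → A'} (hf : Function.Injective f) (F G : OrdForest A) :
    (F.map f).editDist (G.map f) = F.editDist G := by
  refine le_antisymm (editDist_le_iff.2 ((align_editDist F G).map f)) ?_
  -- `Function.invFun` needs a nonempty domain; over an empty alphabet both forests are `nil`.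
  obtain _ | _ := isEmpty_or_nonempty A
  · cases F with
    | nil =>
      cases G with
      | nil => exact editDist_le_iff.2 (.nil _)
      | cons a => exact isEmptyElim a
    | cons a => exact isEmptyElim a
  · have key : ∀ F : OrdForest A, (F.map f).map (Function.invFun f) = F := by
      intro F
      induction F with
      | nil => rfl
      | cons a c r ih ih' => simp [OrdForest.map, ih, ih', Function.leftInverse_invFun hf a]
    have := (align_editDist (F.map f) (G.map f)).map (Function.invFun f)
    rw [key, key] at this
    exact editDist_le_iff.2 this

end

end EditDistance

end OrdForest

namespace OrdForest

/-! ### Forests cut out of a sequence of parentheses -/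

section Parentheses

/-- The forest of the nodes both of whose parentheses lie in `[i, j)`, where `p` maps every
position of a sequence of parentheses to the position of its partner, and `lab x` is the label of
the node opened at `x`. -/
def ofParens (p lab : ℕ → ℕ) (i j : ℕ) : OrdForest ℕ :=
  if i < j then
    if i < p i ∧ p i < j then
      cons (lab i) (ofParens p lab (i + 1) (p i)) (ofParens p lab (p i + 1) j)
    else ofParens p lab (i + 1) j
  else nil
termination_by j - i

/-- The positions in `[lo, hi)` are the parentheses of a balanced sequence. -/
structure IsPairing (p : ℕ → ℕ) (lo hi : ℕ) : Prop where
  mem : ∀ x, lo ≤ x → x < hi → lo ≤ p x ∧ p x < hi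
  invol : ∀ x, lo ≤ x → x < hi → p (p x) = x
  ne : ∀ x, lo ≤ x → x < hi → p x ≠ x
  nested : ∀ x y, lo ≤ x → x < y → y < p x → x < hi → x < p y ∧ p y < p x

variable {p lab : ℕ → ℕ} {i j m lo hi : ℕ}

namespace IsPairing

theorem lt_apply (h : IsPairing p i j) (hij : i < j) : i < p i ∧ p i < j := by
  have := h.mem i le_rfl hij
  have := h.ne i le_rfl hij
  omega

theorem apply_lt (h : IsPairing p i (j + 1)) (hij : i ≤ j) : i ≤ p j ∧ p j < j := by
  have := h.mem j hij (by omega)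
  have := h.ne j hij (by omega)
  omega

theorem inner (h : IsPairing p lo hi) (h₁ : lo ≤ i) (h₂ : i < hi) (_ : i < p i) :
    IsPairing p (i + 1) (p i) := by
  have h₄ := h.mem i h₁ h₂
  refine ⟨fun x h₅ h₆ => ?_, fun x h₅ h₆ => h.invol x (by omega) (by omega),
    fun x h₅ h₆ => h.ne x (by omega) (by omega),
    fun x y h₅ h₆ h₇ h₈ => h.nested x y (by omega) h₆ h₇ (by omega)⟩
  have := h.nested i x h₁ (by omega) h₆ h₂
  omega

theorem tree (h : IsPairing p lo hi) (h₁ : lo ≤ i) (h₂ : i < hi) (_ : i < p i) :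
    IsPairing p i (p i + 1) := by
  have h₄ := h.mem i h₁ h₂
  have h₀ := h.invol i h₁ h₂
  refine ⟨fun x h₅ h₆ => ?_, fun x h₅ h₆ => h.invol x (by omega) (by omega),
    fun x h₅ h₆ => h.ne x (by omega) (by omega),
    fun x y h₅ h₆ h₇ h₈ => h.nested x y (by omega) h₆ h₇ (by omega)⟩
  rcases eq_or_lt_of_le h₅ with rfl | h₅
  · omega
  rcases eq_or_lt_of_le (Nat.le_of_lt_succ h₆) with rfl | h₆
  · omega
  have := h.nested i x h₁ h₅ h₆ h₂
  omega

/-- A position behind the first tree cannot have its partner in that tree: the two parentheses of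
the root are partners of each other, and nesting keeps partners of inner positions inside. -/
theorem right (h : IsPairing p i j) (hij : i < j) : IsPairing p (p i + 1) j := by
  have h₁ := h.lt_apply hij
  have h₀ := h.invol i le_rfl hij
  refine ⟨fun x h₅ h₆ => ?_, fun x h₅ h₆ => h.invol x (by omega) (by omega),
    fun x h₅ h₆ => h.ne x (by omega) (by omega),
    fun x y h₅ h₆ h₇ h₈ => h.nested x y (by omega) h₆ h₇ (by omega)⟩
  have h₂ := h.mem x (by omega) h₆
  have h₃ := h.invol x (by omega) h₆
  refine ⟨?_, h₂.2⟩
  by_contra hc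
  rcases eq_or_lt_of_le h₂.1 with h₄ | h₄
  · rw [← h₄] at h₃; omega
  rcases eq_or_lt_of_le (show p x ≤ p i by omega) with h₇ | h₇
  · rw [h₇] at h₃; omega
  have := h.nested i (p x) le_rfl h₄ h₇ hij
  omega

theorem left (h : IsPairing p i (j + 1)) (hij : i ≤ j) : IsPairing p i (p j) := by
  have h₁ := h.apply_lt hij
  have h₀ := h.invol j hij (by omega)
  refine ⟨fun x h₅ h₆ => ?_, fun x h₅ h₆ => h.invol x (by omega) (by omega),
    fun x h₅ h₆ => h.ne x (by omega) (by omega),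
    fun x y h₅ h₆ h₇ h₈ => h.nested x y (by omega) h₆ h₇ (by omega)⟩
  have h₂ := h.mem x h₅ (by omega)
  have h₃ := h.invol x h₅ (by omega)
  refine ⟨h₂.1, ?_⟩
  by_contra hc
  rcases eq_or_lt_of_le (show p x ≤ j by omega) with h₄ | h₄
  · rw [h₄] at h₃; omega
  rcases eq_or_lt_of_le (show p j ≤ p x by omega) with h₇ | h₇
  · rw [← h₇] at h₃; omega
  have := h.nested (p j) (p x) h₁.1 h₇ (by omega) (by omega)
  omega

end IsPairing

theorem ofParens_of_le (h : j ≤ i) : ofParens p lab i j = nil := by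
  rw [ofParens, if_neg (by omega)]

theorem ofParens_match (h : i < p i) (h' : p i < j) :
    ofParens p lab i j =
      cons (lab i) (ofParens p lab (i + 1) (p i)) (ofParens p lab (p i + 1) j) := by
  rw [ofParens, if_pos (by omega), if_pos ⟨h, h'⟩]

theorem ofParens_skip (h : ¬(i < p i ∧ p i < j)) :
    ofParens p lab i j = ofParens p lab (i + 1) j := by
  rw [ofParens]
  split_ifs with h₁
  · rfl
  · rw [ofParens_of_le (by omega)]

theorem two_mul_size_ofParens_le (p lab : ℕ → ℕ) (i j : ℕ) :
    2 * (ofParens p lab i j).size ≤ j - i := by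
  generalize hn : j - i = n
  induction n using Nat.strong_induction_on generalizing i j with
  | _ n ih =>
    subst hn
    by_cases h : i < p i ∧ p i < j
    · rw [ofParens_match h.1 h.2, size]
      have h₁ := ih (p i - (i + 1)) (by omega) _ _ rfl
      have h₂ := ih (j - (p i + 1)) (by omega) _ _ rfl
      omega
    · rcases Nat.lt_or_ge i j with h' | h'
      · rw [ofParens_skip h]
        have h₁ := ih (j - (i + 1)) (by omega) _ _ rfl
        omega
      · rw [ofParens_of_le h']
        simp [size]

theorem IsPairing.two_mul_size (lab : ℕ → ℕ) (h : IsPairing p i j) :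
    2 * (ofParens p lab i j).size = j - i := by
  generalize hn : j - i = n
  induction n using Nat.strong_induction_on generalizing i j with
  | _ n ih =>
    subst hn
    rcases Nat.lt_or_ge i j with h' | h'
    · have h₀ := h.lt_apply h'
      rw [ofParens_match h₀.1 h₀.2, size]
      have h₁ := ih (p i - (i + 1)) (by omega) (h.inner le_rfl h' h₀.1) rfl
      have h₂ := ih (j - (p i + 1)) (by omega) (h.right h') rfl
      omega
    · rw [ofParens_of_le h']
      simp [size]; omega

/-- Cutting an interval at `m` loses exactly the nodes opened before `m` and closed after it; the
hypothesis excludes them. -/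
theorem ofParens_append (him : i ≤ m) (hmj : m ≤ j)
    (h : ∀ x, i ≤ x → x < m → ¬(m ≤ p x ∧ p x < j)) :
    (ofParens p lab i m).append (ofParens p lab m j) = ofParens p lab i j := by
  generalize hn : m - i = n
  induction n using Nat.strong_induction_on generalizing i with
  | _ n ih =>
    subst hn
    rcases eq_or_lt_of_le him with rfl | him
    · rw [ofParens_of_le le_rfl]; rfl
    by_cases h' : i < p i ∧ p i < m
    · rw [ofParens_match h'.1 h'.2, ofParens_match h'.1 (by omega), append,
        ih (m - (p i + 1)) (by omega) (by omega) (fun x _ _ => h x (by omega) (by omega)) rfl]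
    · have := h i le_rfl him
      rw [ofParens_skip h', ofParens_skip (i := i) (j := j) (by omega),
        ih (m - (i + 1)) (by omega) (by omega) (fun x _ _ => h x (by omega) (by omega)) rfl]

section

variable (hp : IsPairing p lo hi)
include hp

/-- Dropping the opening parenthesis alone already deletes the root: its closing parenthesis has
lost its partner, and the children join the siblings. This is why all subproblems are intervals. -/
theorem ofParens_delete_left (h₁ : lo ≤ i) (h₂ : i < p i) (h₃ : p i < j) (h₄ : j ≤ hi) :
    (ofParens p lab (i + 1) (p i)).append (ofParens p lab (p i + 1) j) =
      ofParens p lab (i + 1) j := by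
  -- The interval after the tree may as well start at its closing parenthesis, which is unmatched
  -- there.
  rw [← ofParens_skip (i := p i) (by rw [hp.invol i h₁ (by omega)]; omega)]
  refine ofParens_append (by omega) (by omega) fun x hx hx' => ?_
  have := hp.nested i x h₁ (by omega) hx' (by omega)
  omega

/-- `ofParens` scans from the left, so the view from the right needs a cut at `p j`; by nesting no
node straddles it. -/
theorem ofParens_match_right (h₁ : lo ≤ i) (h₂ : i ≤ p j) (h₃ : p j < j) (h₄ : j < hi) :
    ofParens p lab i (j + 1) = (ofParens p lab i (p j)).append
      (cons (lab (p j)) (ofParens p lab (p j + 1) j) nil) := by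
  have h₀ := hp.invol j (by omega) h₄
  rw [← ofParens_append (m := p j) h₂ (by omega), ofParens_match (i := p j) (by omega) (by omega),
    h₀, ofParens_of_le (i := j + 1) le_rfl]
  intro x hx hx' hc
  have h₅ := hp.invol x (by omega) (by omega)
  rcases eq_or_lt_of_le hc.1 with h₆ | h₆
  · rw [← h₆] at h₅; omega
  rcases eq_or_lt_of_le (Nat.le_of_lt_succ hc.2) with h₇ | h₇
  · rw [h₇] at h₅; omega
  have := hp.nested (p j) (p x) (by omega) h₆ (by omega) (by omega)
  omega

theorem ofParens_skip_right (h₁ : lo ≤ i) (h₂ : i ≤ j) (h₃ : ¬(i ≤ p j ∧ p j < j)) (h₄ : j < hi) :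
    ofParens p lab i (j + 1) = ofParens p lab i j := by
  have h₀ := hp.invol j (by omega) h₄
  rw [← ofParens_append (m := j) h₂ (by omega), ofParens_skip (i := j) (by omega),
    ofParens_of_le (i := j + 1) le_rfl, append_nil]
  intro x hx hx' hc
  have h₅ := hp.invol x (by omega) (by omega)
  rw [show p x = j by omega] at h₅
  omega

theorem ofParens_delete_right (h₁ : lo ≤ i) (h₂ : i ≤ p j) (h₃ : p j < j) (h₄ : j < hi) :
    (ofParens p lab i (p j)).append (ofParens p lab (p j + 1) j) = ofParens p lab i j := by
  have h₀ := hp.invol j (by omega) h₄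
  rw [← ofParens_skip (i := p j) (by omega)]
  refine ofParens_append (by omega) (by omega) fun x hx hx' hc => ?_
  have h₅ := hp.invol x (by omega) (by omega)
  rcases eq_or_lt_of_le hc.1 with h₆ | h₆
  · rw [← h₆] at h₅; omega
  have := hp.nested (p j) (p x) (by omega) h₆ (by omega) (by omega)
  omega

end

/-- From position `e` on, `p` and `lab` describe the parentheses of the given forest. -/
def Represents (p lab : ℕ → ℕ) : OrdForest ℕ → ℕ → Prop
  | nil, _ => True
  | cons a c r, e => lab e = a ∧ p e = e + 1 + 2 * c.size ∧ p (e + 1 + 2 * c.size) = e ∧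
      Represents p lab c (e + 1) ∧ Represents p lab r (e + 2 + 2 * c.size)

theorem Represents.ofParens_eq {F : OrdForest ℕ} {e : ℕ} (h : Represents p lab F e) :
    ofParens p lab e (e + 2 * F.size) = F := by
  induction F generalizing e with
  | nil => exact ofParens_of_le (by simp [size])
  | cons a c r ih ih' =>
    obtain ⟨h₁, h₂, -, h₃, h₄⟩ := h
    have h₃ := ih h₃
    have h₄ := ih' h₄
    rw [ofParens_match (by omega) (by simp only [size]; omega), h₂, h₃, h₁]
    rw [show e + 1 + 2 * c.size + 1 = e + 2 + 2 * c.size by omega]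
    rw [show e + 2 * (cons a c r).size = e + 2 + 2 * c.size + 2 * r.size by
      simp only [size]; omega, h₄]

theorem Represents.isPairing {F : OrdForest ℕ} {e : ℕ} (h : Represents p lab F e) :
    IsPairing p e (e + 2 * F.size) := by
  induction F generalizing e with
  | nil => constructor <;> intros <;> simp only [size] at * <;> omega
  | cons a c r ih ih' =>
    obtain ⟨-, h₂, h₂', h₃, h₄⟩ := h
    have h₃ := ih h₃
    have h₄ := ih' h₄
    have hs : e + 2 * (cons a c r).size = e + 2 + 2 * c.size + 2 * r.size := by
      simp only [size]; omega
    have key : ∀ x, e ≤ x → x < e + 2 + 2 * c.size + 2 * r.size →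
        x = e ∨ x = e + 1 + 2 * c.size ∨ (e + 1 ≤ x ∧ x < e + 1 + 2 * c.size) ∨
        (e + 2 + 2 * c.size ≤ x ∧ x < e + 2 + 2 * c.size + 2 * r.size) := by omega
    rw [hs]
    constructor
    · intro x hx hx'
      rcases key x hx hx' with rfl | rfl | ⟨h, h'⟩ | ⟨h, h'⟩
      · omega
      · omega
      · have := h₃.mem x h h'; omega
      · have := h₄.mem x h h'; omega
    · intro x hx hx'
      rcases key x hx hx' with rfl | rfl | ⟨h, h'⟩ | ⟨h, h'⟩
      · rw [h₂, h₂']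
      · rw [h₂', h₂]
      · exact h₃.invol x h h'
      · exact h₄.invol x h h'
    · intro x hx hx'
      rcases key x hx hx' with rfl | rfl | ⟨h, h'⟩ | ⟨h, h'⟩
      · omega
      · omega
      · exact h₃.ne x h h'
      · exact h₄.ne x h h'
    · intro x y hx hy hy' hx'
      rcases key x hx hx' with rfl | rfl | ⟨h, h'⟩ | ⟨h, h'⟩
      · have := h₃.mem y (by omega) (by omega); omega
      · omega
      · exact h₃.nested x y h hy hy' h'
      · exact h₄.nested x y h hy hy' h'

/-- Needed because parsing goes on writing to the same arrays at other positions. -/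
theorem Represents.congr {p' lab' : ℕ → ℕ} {F : OrdForest ℕ} {e : ℕ} (h : Represents p lab F e)
    (hp : ∀ x, e ≤ x → x < e + 2 * F.size → p' x = p x ∧ lab' x = lab x) :
    Represents p' lab' F e := by
  induction F generalizing e with
  | nil => trivial
  | cons a c r ih ih' =>
    obtain ⟨h₁, h₂, h₂', h₃, h₄⟩ := h
    simp only [size] at hp
    refine ⟨?_, ?_, ?_, ih h₃ fun x _ _ => hp x (by omega) (by omega),
      ih' h₄ fun x _ _ => hp x (by omega) (by omega)⟩
    · rw [(hp e le_rfl (by omega)).2, h₁]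
    · rw [(hp e le_rfl (by omega)).1, h₂]
    · rw [(hp (e + 1 + 2 * c.size) (by omega) (by omega)).1, h₂']

end Parentheses

end OrdForest

namespace OrdForest

/-! ### The potential does not increase along an optimal branch -/

section BandedDistance

/-- The edit distance of the forests between positions `i`, `j` and `q`, `r`. -/
noncomputable abbrev parenDist (p lab : ℕ → ℕ) (i j q r : ℕ) : ℕ :=
  (ofParens p lab i j).editDist (ofParens p lab q r)

/-- The amount by which `q` differs from `L + i`. -/
def shift (L i q : ℕ) : ℕ := (q - (L + i)) + ((L + i) - q)

/-- The number of unmatched positions in `[i, j)`. -/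
def unmatched (p lab : ℕ → ℕ) (i j : ℕ) : ℕ := j - i - 2 * (ofParens p lab i j).size

/-- An upper bound for the amount by which the intervals of the subproblems of a subproblem can be
shifted against each other; `L` is the position at which the second forest starts. -/
noncomputable def potential (p lab : ℕ → ℕ) (L i j q r : ℕ) : ℕ :=
  shift L i q + shift L j r + unmatched p lab i j + unmatched p lab q r +
    2 * parenDist p lab i j q r

/-- `x` is at most the edit distance, provided that the potential is at most `B`. -/
def UpperOK (p lab : ℕ → ℕ) (L B i j q r x : ℕ) : Prop :=
  potential p lab L i j q r ≤ B → x ≤ parenDist p lab i j q r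

variable {p lab : ℕ → ℕ} {i j q r lo hi : ℕ}

theorem unmatched_add (p lab : ℕ → ℕ) (i j : ℕ) :
    unmatched p lab i j + 2 * (ofParens p lab i j).size = j - i := by
  have := two_mul_size_ofParens_le p lab i j
  unfold unmatched
  omega

theorem shift_succ_left_le (L i q : ℕ) : shift L (i + 1) q ≤ shift L i q + 1 := by
  unfold shift; omega

theorem shift_succ_right_le (L i q : ℕ) : shift L i (q + 1) ≤ shift L i q + 1 := by
  unfold shift; omega

theorem shift_le_succ_left (L i q : ℕ) : shift L i q ≤ shift L (i + 1) q + 1 := by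
  unfold shift; omega

theorem shift_le_succ_right (L i q : ℕ) : shift L i q ≤ shift L i (q + 1) + 1 := by
  unfold shift; omega

theorem shift_succ_succ (L i q : ℕ) : shift L (i + 1) (q + 1) = shift L i q := by
  unfold shift; omega

theorem shift_le_shift_add {L i q i' q' d : ℕ} (h : i' + q ≤ q' + i + d) (h' : q' + i ≤ i' + q + d) :
    shift L i' q' ≤ shift L i q + d := by
  unfold shift; omega

/-- Cost of skipping the first position of `[q, r)`. -/
abbrev costLeft (p : ℕ → ℕ) (q r : ℕ) : ℕ := if q < p q ∧ p q < r then 1 else 0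

/-- Cost of skipping the last position of `[q, r + 1)`. -/
abbrev costRight (p : ℕ → ℕ) (q r : ℕ) : ℕ := if q ≤ p r ∧ p r < r then 1 else 0

section

variable (hp : IsPairing p lo hi)
include hp

theorem size_costLeft (h₁ : lo ≤ q) (h₂ : r ≤ hi) :
    (ofParens p lab q r).size = costLeft p q r + (ofParens p lab (q + 1) r).size := by
  rw [costLeft]
  split_ifs with h
  · rw [← ofParens_delete_left hp h₁ h.1 h.2 h₂, ofParens_match h.1 h.2, size, size_append]
    omega
  · rw [ofParens_skip h]; omega

theorem size_costRight (h₀ : q ≤ r) (h₁ : lo ≤ q) (h₂ : r < hi) :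
    (ofParens p lab q (r + 1)).size = costRight p q r + (ofParens p lab q r).size := by
  rw [costRight]
  split_ifs with h
  · rw [← ofParens_delete_right hp h₁ h.1 h.2 h₂, ofParens_match_right hp h₁ h.1 h.2 h₂]
    simp only [size, size_append]
    omega
  · rw [ofParens_skip_right hp h₁ h₀ h h₂]; omega

theorem edit_ofParens_left (h₁ : lo ≤ q) (h₂ : r ≤ hi) (h : q < p q) (h' : p q < r) :
    Edit (ofParens p lab q r) (ofParens p lab (q + 1) r) := by
  rw [← ofParens_delete_left hp h₁ h h' h₂, ofParens_match h h']
  exact .delete _ _ _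

theorem edit_ofParens_right (h₁ : lo ≤ q) (h₂ : r < hi) (h : q ≤ p r) (h' : p r < r) :
    Edit (ofParens p lab q (r + 1)) (ofParens p lab q r) := by
  rw [← ofParens_delete_right hp h₁ h h' h₂, ofParens_match_right hp h₁ h h' h₂]
  exact Edit.delete_last _ _ _

theorem editDist_costLeft_le (h₁ : lo ≤ q) (h₂ : r ≤ hi) (F : OrdForest ℕ) :
    F.editDist (ofParens p lab q r) ≤
      costLeft p q r + F.editDist (ofParens p lab (q + 1) r) := by
  rw [costLeft]
  split_ifs with h
  · exact (edit_ofParens_left hp h₁ h₂ h.1 h.2).editDist_le' F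
  · rw [ofParens_skip h]; omega

theorem editDist_costRight_le (h₀ : q ≤ r) (h₁ : lo ≤ q) (h₂ : r < hi) (F : OrdForest ℕ) :
    F.editDist (ofParens p lab q (r + 1)) ≤
      costRight p q r + F.editDist (ofParens p lab q r) := by
  rw [costRight]
  split_ifs with h
  · exact (edit_ofParens_right hp h₁ h₂ h.1 h.2).editDist_le' F
  · rw [ofParens_skip_right hp h₁ h₀ h h₂]; omega

end

theorem parenDist_match_left_le (h₁ : i < p i) (h₂ : p i < j) (h₃ : q < p q) (h₄ : p q < r) :
    parenDist p lab i j q r ≤ (if lab i = lab q then 0 else 1) +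
      parenDist p lab (i + 1) (p i) (q + 1) (p q) + parenDist p lab (p i + 1) j (p q + 1) r := by
  rw [parenDist, ofParens_match h₁ h₂, ofParens_match h₃ h₄]
  exact editDist_cons_cons_le _ _ _ _ _ _

theorem parenDist_match_left_cases {L E : ℕ} (hp : IsPairing p 0 L) (hp' : IsPairing p L E)
    (hj : j ≤ L) (hq : L ≤ q) (hr : r ≤ E)
    (h₁ : i < p i) (h₂ : p i < j) (h₃ : q < p q) (h₄ : p q < r) :
    1 + parenDist p lab (i + 1) j q r ≤ parenDist p lab i j q r ∨
    1 + parenDist p lab i j (q + 1) r ≤ parenDist p lab i j q r ∨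
    (if lab i = lab q then 0 else 1) + parenDist p lab (i + 1) (p i) (q + 1) (p q) +
      parenDist p lab (p i + 1) j (p q + 1) r ≤ parenDist p lab i j q r := by
  have := editDist_cons_cons_cases (lab i) (lab q) (ofParens p lab (i + 1) (p i))
    (ofParens p lab (p i + 1) j) (ofParens p lab (q + 1) (p q)) (ofParens p lab (p q + 1) r)
  rwa [ofParens_delete_left hp (Nat.zero_le _) h₁ h₂ hj, ofParens_delete_left hp' hq h₃ h₄ hr,
    ← ofParens_match h₁ h₂, ← ofParens_match h₃ h₄] at this

section

variable {L E : ℕ}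

section

variable (hp : IsPairing p 0 L) (hp' : IsPairing p L E)
include hp hp'

theorem parenDist_match_right_le (hj : j < L) (hq : L ≤ q) (hr : r < E)
    (h₁ : i ≤ p j) (h₂ : p j < j) (h₃ : q ≤ p r) (h₄ : p r < r) :
    parenDist p lab i (j + 1) q (r + 1) ≤ (if lab (p j) = lab (p r) then 0 else 1) +
      parenDist p lab (p j + 1) j (p r + 1) r + parenDist p lab i (p j) q (p r) := by
  rw [parenDist, ofParens_match_right hp (Nat.zero_le _) h₁ h₂ hj,
    ofParens_match_right hp' hq h₃ h₄ hr]
  exact editDist_append_append_le _ _ _ _ _ _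

theorem parenDist_match_right_cases (hj : j < L) (hq : L ≤ q) (hr : r < E)
    (h₁ : i ≤ p j) (h₂ : p j < j) (h₃ : q ≤ p r) (h₄ : p r < r) :
    1 + parenDist p lab i j q (r + 1) ≤ parenDist p lab i (j + 1) q (r + 1) ∨
    1 + parenDist p lab i (j + 1) q r ≤ parenDist p lab i (j + 1) q (r + 1) ∨
    (if lab (p j) = lab (p r) then 0 else 1) + parenDist p lab (p j + 1) j (p r + 1) r +
      parenDist p lab i (p j) q (p r) ≤ parenDist p lab i (j + 1) q (r + 1) := by
  have := editDist_append_append_cases (lab (p j)) (lab (p r)) (ofParens p lab (p j + 1) j)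
    (ofParens p lab i (p j)) (ofParens p lab (p r + 1) r) (ofParens p lab q (p r))
  rwa [ofParens_delete_right hp (Nat.zero_le _) h₁ h₂ hj,
    ofParens_delete_right hp' hq h₃ h₄ hr,
    ← ofParens_match_right hp (Nat.zero_le _) h₁ h₂ hj,
    ← ofParens_match_right hp' hq h₃ h₄ hr] at this

end

/-- Skipping a position of the second forest that is unmatched. -/
theorem UpperOK.skip_left_right {B x v : ℕ} (hqr : q < r)
    (h : ¬(q < p q ∧ p q < r)) (hx : UpperOK p lab L B i j (q + 1) r x)
    (hv : v ≤ costLeft p q r + x) : UpperOK p lab L B i j q r v := by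
  intro hB
  have hs := unmatched_add p lab q r
  have hs' := unmatched_add p lab (q + 1) r
  have hc : costLeft p q r = 0 := if_neg h
  have hd := shift_succ_right_le L i q
  unfold UpperOK potential parenDist at hx
  unfold potential parenDist at hB
  unfold parenDist
  rw [ofParens_skip h] at *
  omega

/-- The displacement grows by at most one while one unmatched position disappears, so the bound on
the potential persists. The distance itself is unchanged. -/
theorem UpperOK.skip_left_left {B x v : ℕ} (hij : i < j)
    (h : ¬(i < p i ∧ p i < j)) (hx : UpperOK p lab L B (i + 1) j q r x)
    (hv : v ≤ x) : UpperOK p lab L B i j q r v := by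
  intro hB
  have hs := unmatched_add p lab i j
  have hs' := unmatched_add p lab (i + 1) j
  have hd := shift_succ_left_le L i q
  unfold UpperOK potential parenDist at hx
  unfold potential parenDist at hB
  unfold parenDist
  rw [ofParens_skip h] at *
  omega

theorem UpperOK.skip_right_right {B x v : ℕ} (hp' : IsPairing p L E) (hq : L ≤ q) (hqr : q ≤ r)
    (hr : r < E) (h : ¬(q ≤ p r ∧ p r < r)) (hx : UpperOK p lab L B i j q r x)
    (hv : v ≤ costRight p q r + x) : UpperOK p lab L B i j q (r + 1) v := by
  intro hB
  have hs := unmatched_add p lab q r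
  have hs' := unmatched_add p lab q (r + 1)
  have hc : costRight p q r = 0 := if_neg h
  have hd := shift_le_succ_right L j r
  unfold UpperOK potential parenDist at hx
  unfold potential parenDist at hB
  unfold parenDist
  rw [ofParens_skip_right hp' hq hqr h hr] at *
  omega

theorem UpperOK.skip_right_left {B x v : ℕ} (hp : IsPairing p 0 L) (hij : i ≤ j) (hj : j < L)
    (h : ¬(i ≤ p j ∧ p j < j)) (hx : UpperOK p lab L B i j q r x)
    (hv : v ≤ x) : UpperOK p lab L B i (j + 1) q r v := by
  intro hB
  have hs := unmatched_add p lab i j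
  have hs' := unmatched_add p lab i (j + 1)
  have hd := shift_le_succ_left L j r
  unfold UpperOK potential parenDist at hx
  unfold potential parenDist at hB
  unfold parenDist
  rw [ofParens_skip_right hp (Nat.zero_le _) hij h hj] at *
  omega

/-- Against the empty forest every node has to be deleted, so the left end of the second interval
may always advance. A deletion frees two units of potential and uses at most two, for the
displacement and for the partner left behind. -/
theorem UpperOK.empty {B v : ℕ} (hp' : IsPairing p L E) (hij : i = j) (hq : L ≤ q) (hqr : q ≤ r)
    (hr : r ≤ E) (h₀ : q = r → v = 0)
    (h₁ : q < r → ∃ x, UpperOK p lab L B i j (q + 1) r x ∧ v ≤ costLeft p q r + x) :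
    UpperOK p lab L B i j q r v := by
  rcases eq_or_lt_of_le hqr with h | h
  · intro _
    rw [h₀ h]; omega
  obtain ⟨x, hx, hv⟩ := h₁ h
  clear h₁ h₀
  intro hB
  have hs := unmatched_add p lab q r
  have hs' := unmatched_add p lab (q + 1) r
  have hc := size_costLeft (lab := lab) hp' hq hr
  have hc' : costLeft p q r ≤ 1 := by unfold costLeft; split_ifs <;> omega
  generalize costLeft p q r = c at hc hc' hv
  have hd := shift_succ_right_le L i q
  unfold UpperOK potential parenDist at hx
  unfold potential parenDist at hB
  unfold parenDist
  rw [ofParens_of_le (i := i) (j := j) (by omega), editDist_nil_left] at *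
  omega

section

variable (hp : IsPairing p 0 L) (hp' : IsPairing p L E)
include hp hp'

/-- Deletions are paid for by the two units that a drop of the distance frees. If the roots are
matched, the inner and the remaining problem share the cut `p i`, `p q`. The inner problem inherits
the displacement of the left ends, and its right displacement is bounded through the remaining part;
for the remaining problem it is the other way round. In both cases the terms of the part left out
pay for the cut. -/
theorem UpperOK.match_left {B x v : ℕ} (hj : j ≤ L) (hq : L ≤ q) (hqr : q ≤ r) (hr : r ≤ E)
    (h₁ : i < p i) (h₂ : p i < j)
    (hx : UpperOK p lab L B (i + 1) j q r x) (hv : v ≤ 1 + x)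
    (hy : q < r → ∃ y, UpperOK p lab L B i j (q + 1) r y ∧ v ≤ costLeft p q r + y)
    (hz : q < p q → p q < r → ∃ y z, UpperOK p lab L B (i + 1) (p i) (q + 1) (p q) y ∧
      UpperOK p lab L B (p i + 1) j (p q + 1) r z ∧
      v ≤ (if lab i = lab q then 0 else 1) + y + z) :
    UpperOK p lab L B i j q r v := by
  have hs := unmatched_add p lab i j
  have hs' := unmatched_add p lab (i + 1) j
  have ht := unmatched_add p lab q r
  have ht' := unmatched_add p lab (q + 1) r
  have hc := size_costLeft (lab := lab) hp (Nat.zero_le i) hj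
  have hd := shift_succ_left_le L i q
  have hd' := shift_succ_right_le L i q
  rw [costLeft, if_pos ⟨h₁, h₂⟩] at hc
  by_cases hm : q < p q ∧ p q < r
  · intro hB
    replace hy := hy (by omega)
    obtain ⟨y, hy, hvy⟩ := hy
    replace hz := hz hm.1 hm.2
    obtain ⟨y', z, hy', hz, hvz⟩ := hz
    have hc' := size_costLeft (lab := lab) hp' hq hr
    rw [costLeft, if_pos hm] at hc' hvy
    have hcases := parenDist_match_left_cases (lab := lab) hp hp' hj hq hr h₁ h₂ hm.1 hm.2
    generalize (if lab i = lab q then 0 else 1) = δ at hcases hvz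
    unfold UpperOK potential at hx hy hy' hz
    unfold potential at hB
    rcases hcases with h | h | h
    · clear hy hy' hz; omega
    · clear hx hy' hz; omega
    · clear hx hy hd hd' hs' ht' hc hc'
      have e₁ := (hp.inner (Nat.zero_le i) (by omega) h₁).two_mul_size lab
      have e₂ := (hp'.inner hq (by omega) hm.1).two_mul_size lab
      have l₁ := size_le_add_editDist (ofParens p lab (i + 1) (p i))
        (ofParens p lab (q + 1) (p q))
      have l₂ := size_le_add_editDist' (ofParens p lab (i + 1) (p i))
        (ofParens p lab (q + 1) (p q))
      have l₃ := size_le_add_editDist (ofParens p lab (p i + 1) j)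
        (ofParens p lab (p q + 1) r)
      have l₄ := size_le_add_editDist' (ofParens p lab (p i + 1) j)
        (ofParens p lab (p q + 1) r)
      have b₁ := unmatched_add p lab (p i + 1) j
      have b₂ := unmatched_add p lab (p q + 1) r
      have b₃ := unmatched_add p lab (i + 1) (p i)
      have b₄ := unmatched_add p lab (q + 1) (p q)
      have s₁ : (ofParens p lab i j).size = 1 + (ofParens p lab (i + 1) (p i)).size +
        (ofParens p lab (p i + 1) j).size := by rw [ofParens_match h₁ h₂, size]
      have s₂ : (ofParens p lab q r).size = 1 + (ofParens p lab (q + 1) (p q)).size +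
        (ofParens p lab (p q + 1) r).size := by rw [ofParens_match hm.1 hm.2, size]
      -- The inner intervals are balanced, so their lengths are twice their sizes, which differ by
      -- at most the inner distance.
      have d₁ : shift L (p i) (p q) ≤ shift L i q +
          2 * parenDist p lab (i + 1) (p i) (q + 1) (p q) :=
        shift_le_shift_add (by unfold parenDist; omega) (by unfold parenDist; omega)
      -- Seen from the right ends, the lengths of the remainders are twice their sizes plus their
      -- unmatched positions.
      have d₂ : shift L (p i) (p q) ≤ shift L j r + (unmatched p lab (p i + 1) j +
          unmatched p lab (p q + 1) r + 2 * parenDist p lab (p i + 1) j (p q + 1) r) :=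
        shift_le_shift_add (by unfold parenDist; omega) (by unfold parenDist; omega)
      rw [shift_succ_succ] at hy' hz
      clear l₁ l₂ l₃ l₄
      have hy' := hy' (by omega)
      have hz := hz (by omega)
      omega
  · rcases eq_or_lt_of_le hqr with h | h
    · clear hz hy
      intro hB
      unfold UpperOK potential parenDist at hx
      unfold potential parenDist at hB
      unfold parenDist
      rw [ofParens_of_le (i := q) (j := r) (by omega)] at *
      rw [editDist_nil_right] at *
      omega
    · obtain ⟨y, hy, hvy⟩ := hy h
      exact hy.skip_left_right h hm hvy

/-- The same accounting at the right ends, with the cut at `p j` and `p (r - 1)`. Here the inner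
problem keeps the right displacement, and the remaining problem keeps the left one. -/
theorem UpperOK.match_right {B x v : ℕ} (hj : j < L) (hq : L ≤ q) (hqr : q ≤ r) (hr : r ≤ E)
    (h₁ : i ≤ p j) (h₂ : p j < j)
    (hx : UpperOK p lab L B i j q r x) (hv : v ≤ 1 + x)
    (hy : q < r → ∃ y, UpperOK p lab L B i (j + 1) q (r - 1) y ∧ v ≤ costRight p q (r - 1) + y)
    (hz : q ≤ p (r - 1) → p (r - 1) < r - 1 → ∃ y z,
      UpperOK p lab L B (p j + 1) j (p (r - 1) + 1) (r - 1) y ∧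
      UpperOK p lab L B i (p j) q (p (r - 1)) z ∧
      v ≤ (if lab (p j) = lab (p (r - 1)) then 0 else 1) + y + z) :
    UpperOK p lab L B i (j + 1) q r v := by
  have hs := unmatched_add p lab i j
  have hs' := unmatched_add p lab i (j + 1)
  have hc := size_costRight (lab := lab) hp (by omega : i ≤ j) (Nat.zero_le i) hj
  have hd := shift_le_succ_left L j r
  rw [costRight, if_pos ⟨h₁, h₂⟩] at hc
  rcases eq_or_lt_of_le hqr with h | h
  · clear hy hz
    intro hB
    unfold UpperOK potential parenDist at hx
    unfold potential parenDist at hB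
    unfold parenDist
    rw [ofParens_of_le (i := q) (j := r) (by omega)] at *
    rw [editDist_nil_right] at *
    omega
  obtain ⟨r, rfl⟩ : ∃ s, r = s + 1 := ⟨r - 1, by omega⟩
  have ht := unmatched_add p lab q r
  have ht' := unmatched_add p lab q (r + 1)
  have hd' := shift_le_succ_right L (j + 1) r
  simp only [Nat.add_sub_cancel] at hy hz
  replace hy := hy h
  obtain ⟨y, hy, hvy⟩ := hy
  by_cases hm : q ≤ p r ∧ p r < r
  · intro hB
    replace hz := hz hm.1 hm.2
    obtain ⟨y', z, hy', hz, hvz⟩ := hz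
    have hc' := size_costRight (lab := lab) hp' (by omega : q ≤ r) hq hr
    rw [costRight, if_pos hm] at hc' hvy
    have hcases := parenDist_match_right_cases (lab := lab) hp hp' hj hq hr h₁ h₂ hm.1 hm.2
    generalize (if lab (p j) = lab (p r) then 0 else 1) = δ at hcases hvz
    unfold UpperOK potential at hx hy hy' hz
    unfold potential at hB
    rcases hcases with h | h | h
    · clear hy hy' hz; omega
    · clear hx hy' hz; omega
    · clear hx hy hd hd' hs ht hc hc'
      have i₁ := hp.invol j (Nat.zero_le _) hj
      have i₂ := hp'.invol r (by omega) (by omega)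
      have e₁ := (hp.inner (Nat.zero_le (p j)) (by omega) (by omega)).two_mul_size lab
      have e₂ := (hp'.inner (i := p r) (by omega) (by omega) (by omega)).two_mul_size lab
      rw [i₁] at e₁
      rw [i₂] at e₂
      have l₁ := size_le_add_editDist (ofParens p lab (p j + 1) j) (ofParens p lab (p r + 1) r)
      have l₂ := size_le_add_editDist' (ofParens p lab (p j + 1) j) (ofParens p lab (p r + 1) r)
      have l₃ := size_le_add_editDist (ofParens p lab i (p j)) (ofParens p lab q (p r))
      have l₄ := size_le_add_editDist' (ofParens p lab i (p j)) (ofParens p lab q (p r))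
      have b₁ := unmatched_add p lab i (p j)
      have b₂ := unmatched_add p lab q (p r)
      have b₃ := unmatched_add p lab (p j + 1) j
      have b₄ := unmatched_add p lab (p r + 1) r
      have s₁ : (ofParens p lab i (j + 1)).size = 1 + (ofParens p lab (p j + 1) j).size +
          (ofParens p lab i (p j)).size := by
        rw [ofParens_match_right hp (Nat.zero_le i) h₁ h₂ hj]
        simp only [size, size_append]; omega
      have s₂ : (ofParens p lab q (r + 1)).size = 1 + (ofParens p lab (p r + 1) r).size +
          (ofParens p lab q (p r)).size := by
        rw [ofParens_match_right hp' hq hm.1 hm.2 hr]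
        simp only [size, size_append]; omega
      have d₁ : shift L (p j) (p r) ≤ shift L j r +
          2 * parenDist p lab (p j + 1) j (p r + 1) r :=
        shift_le_shift_add (by unfold parenDist; omega) (by unfold parenDist; omega)
      have d₂ : shift L (p j) (p r) ≤ shift L i q + (unmatched p lab i (p j) +
          unmatched p lab q (p r) + 2 * parenDist p lab i (p j) q (p r)) :=
        shift_le_shift_add (by unfold parenDist; omega) (by unfold parenDist; omega)
      rw [shift_succ_succ] at hy' hB
      clear l₁ l₂ l₃ l₄
      have hy' := hy' (by omega)
      have hz := hz (by omega)
      omega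
  · exact hy.skip_right_right hp' hq (by omega) (by omega) hm hvy

/-- For a single tree, deleting the root removes both of its parentheses at once, so two units of
displacement are paid for and nothing becomes unmatched. A match with the root at `q` is offered
only if this root also spans the second interval. Otherwise such a match forces the deletion of the
last tree on the right, and the option of deleting the last root is just as good. -/
theorem UpperOK.match_single {B x v : ℕ} (hj : j < L) (hq : L ≤ q) (hqr : q ≤ r) (hr : r ≤ E)
    (h₁ : i < j) (h₂ : p i = j)
    (hx : UpperOK p lab L B (i + 1) j q r x) (hv : v ≤ 1 + x)
    (hy : q < r → ∃ y, UpperOK p lab L B i (j + 1) (q + 1) r y ∧ v ≤ costLeft p q r + y)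
    (hy' : q < r → ∃ y, UpperOK p lab L B i (j + 1) q (r - 1) y ∧
      v ≤ costRight p q (r - 1) + y)
    (hz : q < p q → p q = r - 1 → ∃ y, UpperOK p lab L B (i + 1) j (q + 1) (r - 1) y ∧
      v ≤ (if lab i = lab q then 0 else 1) + y) :
    UpperOK p lab L B i (j + 1) q r v := by
  have hs := unmatched_add p lab (i + 1) j
  have hs' := unmatched_add p lab i (j + 1)
  have hF : ofParens p lab i (j + 1) = cons (lab i) (ofParens p lab (i + 1) j) nil := by
    rw [ofParens_match (i := i) (by omega) (by omega), h₂, ofParens_of_le (i := j + 1) le_rfl]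
  have hsF : (ofParens p lab i (j + 1)).size = 1 + (ofParens p lab (i + 1) j).size := by
    rw [hF]; simp [size]
  have hd := shift_succ_left_le L i q
  have hd' := shift_le_succ_left L j r
  rcases eq_or_lt_of_le hqr with h | h
  · clear hy hy' hz
    intro hB
    clear hF
    unfold UpperOK potential parenDist at hx
    unfold potential parenDist at hB
    unfold parenDist
    rw [ofParens_of_le (i := q) (j := r) (by omega)] at *
    rw [editDist_nil_right] at *
    omega
  obtain ⟨r, rfl⟩ : ∃ s, r = s + 1 := ⟨r - 1, by omega⟩
  have ht := unmatched_add p lab q (r + 1)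
  have ht₁ := unmatched_add p lab q r
  have ht₂ := unmatched_add p lab (q + 1) (r + 1)
  have hd₁ := shift_succ_right_le L i q
  have hd₂ := shift_le_succ_right L (j + 1) r
  simp only [Nat.add_sub_cancel] at hy' hz
  replace hy := hy h
  obtain ⟨y, hy, hvy⟩ := hy
  replace hy' := hy' h
  obtain ⟨y', hy', hvy'⟩ := hy'
  by_cases hm : q < p q ∧ p q < r + 1
  swap
  · exact hy.skip_left_right h hm hvy
  by_cases hm' : q ≤ p r ∧ p r < r
  swap
  · exact hy'.skip_right_right hp' hq (by omega) (by omega) hm' hvy'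
  intro hB
  have hc := size_costLeft (lab := lab) hp' hq hr
  have hc' := size_costRight (lab := lab) hp' (by omega : q ≤ r) hq hr
  rw [costLeft, if_pos hm] at hc hvy
  rw [costRight, if_pos hm'] at hc' hvy'
  have hcases := parenDist_match_left_cases (lab := lab) (i := i) (j := j + 1) hp hp' (by omega)
    hq hr (by omega) (by omega) hm.1 hm.2
  -- Without its partner `i`, the closing position `j` contributes no node.
  have hdel : parenDist p lab (i + 1) (j + 1) q (r + 1) = parenDist p lab (i + 1) j q (r + 1) := by
    rw [parenDist, ofParens_skip_right hp (Nat.zero_le _) (by omega) _ hj]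
    rw [← h₂, hp.invol i (Nat.zero_le _) (by omega)]; omega
  rw [hdel, h₂] at hcases
  have hle := parenDist_match_left_le (p := p) (lab := lab) (i := i) (j := j + 1) (q := q)
    (r := r) (by omega) (by omega) hm.1
  generalize (if lab i = lab q then 0 else 1) = δ at hcases hz hle
  unfold UpperOK potential at hx hy hy'
  unfold potential at hB
  rcases hcases with h' | h' | h'
  · clear hy hy' hz hle; omega
  · clear hx hy' hz hle; omega
  · clear hx hy
    by_cases hqr' : p q = r
    · clear hle
      replace hz := hz hm.1 hqr'
      obtain ⟨z, hz, hvz⟩ := hz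
      unfold UpperOK potential at hz
      have b := unmatched_add p lab (q + 1) r
      have s₂ : (ofParens p lab q (r + 1)).size = 1 + (ofParens p lab (q + 1) r).size := by
        rw [ofParens_match hm.1 hm.2, hqr', size, ofParens_of_le (i := r + 1) le_rfl, size, add_zero]
      rw [hqr'] at h'
      rw [shift_succ_succ] at hz hB
      clear hy'
      have := hz (by omega)
      omega
    -- The tree at `q` is not the last one. Everything behind it is deleted at the cost of its size,
    -- so removing the last root lowers the distance by one.
    · have hpr := hp'.invol r (by omega) (by omega)
      have hpq := hp'.invol q (by omega) (by omega)
      -- By nesting, the last tree starts behind the tree at `q`, so its root is one of the nodes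
      -- deleted there.
      have hlt : p q < p r := by
        clear hy' hz hB hle
        by_contra hc₁
        rcases eq_or_lt_of_le hm'.1 with h₃ | h₃
        · rw [← h₃] at hpr; omega
        rcases eq_or_lt_of_le (show p r ≤ p q by omega) with h₄ | h₄
        · rw [h₄] at hpr; omega
        have := hp'.nested q (p r) hq h₃ h₄ (by omega)
        omega
      have hle := hle (by omega)
      clear hz
      rw [h₂] at hle
      unfold parenDist at *
      rw [ofParens_of_le (i := j + 1) (j := j + 1) le_rfl, editDist_nil_left] at hle h'
      have hsz := size_costRight (lab := lab) (q := p q + 1) (r := r) hp' (by omega) (by omega) hr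
      rw [costRight, if_pos (by omega)] at hsz
      have := hy' (by omega)
      omega

end

end

end BandedDistance

end OrdForest

/-! ### A small imperative language and its compilation to the word RAM -/

namespace Imp

open WordRAM

variable {V A : Type}

/-- Comparisons. -/
inductive Cmp where
  | lt
  | eq

/-- The truth value of a comparison. -/
def Cmp.Holds : Cmp → ℕ → ℕ → Prop
  | lt, a, b => a < b
  | eq, a, b => a = b

instance : (o : Cmp) → (a b : ℕ) → Decidable (o.Holds a b)
  | .lt, a, b => inferInstanceAs (Decidable (a < b))
  | .eq, a, b => inferInstanceAs (Decidable (a = b))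

@[simp] theorem Cmp.holds_lt (a b : ℕ) : Cmp.lt.Holds a b ↔ a < b := Iff.rfl

@[simp] theorem Cmp.holds_eq (a b : ℕ) : Cmp.eq.Holds a b ↔ a = b := Iff.rfl

/-- Expressions in variables from `V`, arrays from `A`, and the input. -/
inductive Exp (V A : Type) where
  | const (n : ℕ)
  | var (x : V)
  | inp (e : Exp V A)
  | arr (a : A) (e : Exp V A)
  | add (e f : Exp V A)
  | sub (e f : Exp V A)
  | mul (e f : Exp V A)
  | ite (o : Cmp) (e f s t : Exp V A)

/-- States: values of variables and arrays, and a clock. -/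
structure St (V A : Type) where
  v : V → ℕ
  a : A → ℕ → ℕ
  clk : ℕ

/-- The input, its length, the size of the arrays, and the number of bits of a word. -/
structure Env where
  inp : ℕ → ℕ
  base : ℕ
  cap : ℕ
  w : ℕ

/-- The number of words. -/
def Env.lim (E : Env) : ℕ := 2 ^ E.w

namespace Exp

/-- The value of an expression. -/
@[simp] def eval (E : Env) (σ : St V A) : Exp V A → ℕ
  | const n => n
  | var x => σ.v x
  | inp e => E.inp (e.eval E σ)
  | arr a e => σ.a a (e.eval E σ)
  | add e f => e.eval E σ + f.eval E σ
  | sub e f => e.eval E σ - f.eval E σ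
  | mul e f => e.eval E σ * f.eval E σ
  | ite o e f s t =>
      if o.Holds (e.eval E σ) (f.eval E σ) then s.eval E σ else t.eval E σ

/-- There is no overflow in the evaluation, and all the accesses to arrays are within bounds. -/
@[simp] def Safe (E : Env) (σ : St V A) : Exp V A → Prop
  | const n => n < E.lim
  | var _ => True
  | inp e => e.Safe E σ ∧ e.eval E σ < E.base
  | arr _ e => e.Safe E σ ∧ e.eval E σ < E.cap
  | add e f => e.Safe E σ ∧ f.Safe E σ ∧ e.eval E σ + f.eval E σ < E.lim
  | sub e f => e.Safe E σ ∧ f.Safe E σ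
  | mul e f => e.Safe E σ ∧ f.Safe E σ ∧ e.eval E σ * f.eval E σ < E.lim
  | ite o e f s t => e.Safe E σ ∧ f.Safe E σ ∧
      (o.Holds (e.eval E σ) (f.eval E σ) → s.Safe E σ) ∧
      (¬o.Holds (e.eval E σ) (f.eval E σ) → t.Safe E σ)

/-- A bound for the time of the evaluation. -/
@[simp] def cost : Exp V A → ℕ
  | const _ => 1
  | var _ => 2
  | inp e => e.cost + 1
  | arr _ e => e.cost + 6
  | add e f => e.cost + f.cost + 1
  | sub e f => e.cost + f.cost + 3
  | mul e f => e.cost + f.cost + 1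
  | ite _ e f s t => e.cost + f.cost + s.cost + t.cost + 2

end Exp

/-- Commands. -/
inductive Cmd (V A : Type) where
  | skip
  | set (x : V) (e : Exp V A)
  | store (a : A) (e f : Exp V A)
  | seq (c d : Cmd V A)
  | cond (o : Cmp) (e f : Exp V A) (c d : Cmd V A)
  | loop (o : Cmp) (e f : Exp V A) (c : Cmd V A)

/-- Let time pass. -/
def St.tick (σ : St V A) (n : ℕ) : St V A := ⟨σ.v, σ.a, σ.clk + n⟩

/-! ### Semantics with a clock, and rules for proving termination -/

section Semantics

variable [DecidableEq V] [DecidableEq A]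

namespace St

/-- Assign to a variable. -/
def setVar (σ : St V A) (x : V) (n : ℕ) : St V A := ⟨Function.update σ.v x n, σ.a, σ.clk⟩

/-- Assign to an array cell. -/
def setArr (σ : St V A) (a : A) (i n : ℕ) : St V A :=
  ⟨σ.v, Function.update σ.a a (Function.update (σ.a a) i n), σ.clk⟩

end St

/-- Big-step semantics. -/
inductive Exec (E : Env) : Cmd V A → St V A → St V A → Prop
  | skip (σ) : Exec E .skip σ σ
  | set (x e σ) (h : e.Safe E σ) :
      Exec E (.set x e) σ ((σ.setVar x (e.eval E σ)).tick (e.cost + 2))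
  | store (a e f σ) (h : e.Safe E σ) (h' : f.Safe E σ) (h'' : e.eval E σ < E.cap) :
      Exec E (.store a e f) σ
        ((σ.setArr a (e.eval E σ) (f.eval E σ)).tick (e.cost + f.cost + 6))
  | seq {c d σ σ' σ''} (h : Exec E c σ σ') (h' : Exec E d σ' σ'') : Exec E (.seq c d) σ σ''
  | condTrue {o e f c d σ σ'} (h : e.Safe E σ) (h' : f.Safe E σ)
      (ho : o.Holds (e.eval E σ) (f.eval E σ))
      (hc : Exec E c (σ.tick (e.cost + f.cost + 2)) σ') : Exec E (.cond o e f c d) σ σ'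
  | condFalse {o e f c d σ σ'} (h : e.Safe E σ) (h' : f.Safe E σ)
      (ho : ¬o.Holds (e.eval E σ) (f.eval E σ))
      (hd : Exec E d (σ.tick (e.cost + f.cost + 2)) σ') : Exec E (.cond o e f c d) σ σ'
  | loopTrue {o e f c σ σ' σ''} (h : e.Safe E σ) (h' : f.Safe E σ)
      (ho : o.Holds (e.eval E σ) (f.eval E σ))
      (hc : Exec E c (σ.tick (e.cost + f.cost + 2)) σ') (hl : Exec E (.loop o e f c) σ' σ'') :
      Exec E (.loop o e f c) σ σ''
  | loopFalse {o e f c σ} (h : e.Safe E σ) (h' : f.Safe E σ)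
      (ho : ¬o.Holds (e.eval E σ) (f.eval E σ)) :
      Exec E (.loop o e f c) σ (σ.tick (e.cost + f.cost + 2))

/-- The command terminates in a state with property `Q`. -/
def Term (E : Env) (c : Cmd V A) (σ : St V A) (Q : St V A → Prop) : Prop :=
  ∃ σ', Exec E c σ σ' ∧ Q σ'

namespace Term

variable {E : Env} {σ : St V A} {Q Q' : St V A → Prop}

theorem mono {c : Cmd V A} (h : Term E c σ Q) (hQ : ∀ σ', Q σ' → Q' σ') : Term E c σ Q' :=
  ⟨h.choose, h.choose_spec.1, hQ _ h.choose_spec.2⟩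

theorem skip (h : Q σ) : Term E .skip σ Q := ⟨σ, .skip σ, h⟩

theorem set {x : V} {e : Exp V A} (h : e.Safe E σ)
    (hQ : Q ((σ.setVar x (e.eval E σ)).tick (e.cost + 2))) : Term E (.set x e) σ Q :=
  ⟨_, .set _ _ _ h, hQ⟩

theorem store {a : A} {e f : Exp V A} (h : e.Safe E σ) (h' : f.Safe E σ)
    (h'' : e.eval E σ < E.cap)
    (hQ : Q ((σ.setArr a (e.eval E σ) (f.eval E σ)).tick (e.cost + f.cost + 6))) :
    Term E (.store a e f) σ Q :=
  ⟨_, .store _ _ _ _ h h' h'', hQ⟩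

theorem seq {c d : Cmd V A} (h : Term E c σ fun σ' => Term E d σ' Q) :
    Term E (.seq c d) σ Q := by
  obtain ⟨σ', h₁, σ'', h₂, h₃⟩ := h
  exact ⟨σ'', .seq h₁ h₂, h₃⟩

theorem cond {o : Cmp} {e f : Exp V A} {c d : Cmd V A} (h : e.Safe E σ) (h' : f.Safe E σ)
    (hc : o.Holds (e.eval E σ) (f.eval E σ) → Term E c (σ.tick (e.cost + f.cost + 2)) Q)
    (hd : ¬o.Holds (e.eval E σ) (f.eval E σ) → Term E d (σ.tick (e.cost + f.cost + 2)) Q) :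
    Term E (.cond o e f c d) σ Q := by
  by_cases ho : o.Holds (e.eval E σ) (f.eval E σ)
  · obtain ⟨σ', h₁, h₂⟩ := hc ho
    exact ⟨σ', .condTrue h h' ho h₁, h₂⟩
  · obtain ⟨σ', h₁, h₂⟩ := hd ho
    exact ⟨σ', .condFalse h h' ho h₁, h₂⟩

theorem loop_false {o : Cmp} {e f : Exp V A} {c : Cmd V A} (h : e.Safe E σ) (h' : f.Safe E σ)
    (ho : ¬o.Holds (e.eval E σ) (f.eval E σ)) (hQ : Q (σ.tick (e.cost + f.cost + 2))) :
    Term E (.loop o e f c) σ Q :=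
  ⟨_, .loopFalse h h' ho, hQ⟩

theorem loop_true {o : Cmp} {e f : Exp V A} {c : Cmd V A} (h : e.Safe E σ) (h' : f.Safe E σ)
    (ho : o.Holds (e.eval E σ) (f.eval E σ))
    (hQ : Term E c (σ.tick (e.cost + f.cost + 2)) fun σ' => Term E (.loop o e f c) σ' Q) :
    Term E (.loop o e f c) σ Q := by
  obtain ⟨σ', h₁, σ'', h₂, h₃⟩ := hQ
  exact ⟨_, .loopTrue h h' ho h₁ h₂, h₃⟩

/-- Loops with an invariant and a measure that decreases. -/
theorem loop {o : Cmp} {e f : Exp V A} {c : Cmd V A} (I : St V A → Prop) (m : St V A → ℕ)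
    (hI : I σ) (hs : ∀ σ, I σ → e.Safe E σ ∧ f.Safe E σ)
    (hstep : ∀ σ, I σ → o.Holds (e.eval E σ) (f.eval E σ) →
      Term E c (σ.tick (e.cost + f.cost + 2)) fun σ' => I σ' ∧ m σ' < m σ)
    (hend : ∀ σ, I σ → ¬o.Holds (e.eval E σ) (f.eval E σ) → Q (σ.tick (e.cost + f.cost + 2))) :
    Term E (.loop o e f c) σ Q := by
  generalize hn : m σ = n
  induction n using Nat.strong_induction_on generalizing σ with
  | _ n ih =>
    subst hn
    by_cases ho : o.Holds (e.eval E σ) (f.eval E σ)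
    · exact loop_true (hs σ hI).1 (hs σ hI).2 ho
        ((hstep σ hI ho).mono fun σ' h => ih _ h.2 h.1 rfl)
    · exact loop_false (hs σ hI).1 (hs σ hI).2 ho (hend σ hI ho)

end Term

end Semantics

/-! #### Compilation -/

/-- Numbers of variables and arrays. -/
structure Layout (V A : Type) where
  var : V → ℕ
  var_inj : Function.Injective var
  arr : A → ℕ
  arr_inj : Function.Injective arr
  width : ℕ
  arr_lt : ∀ a, arr a < width

variable (Y : Layout V A)

/-- From an index in the register `2 * d + 1`, compute the address of the array cell. -/
def addrCode (a : A) (d : ℕ) : List Instr :=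
  [.const (2 * d + 3) Y.width, .mul (2 * d + 1) (2 * d + 1) (2 * d + 3),
    .add (2 * d + 1) (2 * d + 1) 1, .const (2 * d + 3) (Y.arr a),
    .add (2 * d + 1) (2 * d + 1) (2 * d + 3)]

/-- The jump that corresponds to a comparison. -/
def Cmp.jump : Cmp → ℕ → ℕ → ℕ → Instr
  | lt => .jumpLt
  | eq => .jumpEq

/-- Code at position `o` that evaluates the expression into the register `2 * d + 1`. -/
def Exp.code : Exp V A → ℕ → ℕ → List Instr
  | const n, d, _ => [.const (2 * d + 1) n]
  | var x, d, _ => [.const (2 * d + 1) 0, .add (2 * d + 1) (2 * d + 1) (2 * Y.var x)]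
  | inp e, d, o => e.code d o ++ [.load (2 * d + 1) (2 * d + 1)]
  | arr a e, d, o => e.code d o ++ (addrCode Y a d ++ [.load (2 * d + 1) (2 * d + 1)])
  | add e f, d, o => e.code d o ++ (f.code (d + 1) (o + (e.code d o).length) ++
      [.add (2 * d + 1) (2 * d + 1) (2 * d + 3)])
  | sub e f, d, o =>
      let o₁ := o + (e.code d o).length
      let o₂ := o₁ + (f.code (d + 1) o₁).length
      e.code d o ++ (f.code (d + 1) o₁ ++ [.jumpLt (2 * d + 1) (2 * d + 3) (o₂ + 3),
        .sub (2 * d + 1) (2 * d + 1) (2 * d + 3), .jumpEq (2 * d + 1) (2 * d + 1) (o₂ + 4),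
        .const (2 * d + 1) 0])
  | mul e f, d, o => e.code d o ++ (f.code (d + 1) (o + (e.code d o).length) ++
      [.mul (2 * d + 1) (2 * d + 1) (2 * d + 3)])
  | ite c e f s t, d, o =>
      let o₁ := o + (e.code d o).length
      let o₂ := o₁ + (f.code (d + 1) o₁).length
      let o₃ := o₂ + 1 + (t.code d (o₂ + 1)).length
      let o₄ := o₃ + 1 + (s.code d (o₃ + 1)).length
      e.code d o ++ (f.code (d + 1) o₁ ++ (c.jump (2 * d + 1) (2 * d + 3) (o₃ + 1) ::
        (t.code d (o₂ + 1) ++ (.jumpEq (2 * d + 1) (2 * d + 1) o₄ :: s.code d (o₃ + 1)))))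

/-- Code for a command at position `o`. -/
def Cmd.code : Cmd V A → ℕ → List Instr
  | skip, _ => []
  | set x e, o => e.code Y 1 o ++ [.const (2 * Y.var x) 0, .add (2 * Y.var x) (2 * Y.var x) 3]
  | store a e f, o =>
      let o₁ := o + (e.code Y 1 o).length
      e.code Y 1 o ++ (addrCode Y a 1 ++ (f.code Y 2 (o₁ + 5) ++ [.store 3 5]))
  | seq c d, o => c.code o ++ d.code (o + (c.code o).length)
  | cond c e f s t, o =>
      let o₁ := o + (e.code Y 1 o).length
      let o₂ := o₁ + (f.code Y 2 o₁).length
      let o₃ := o₂ + 1 + (t.code (o₂ + 1)).length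
      let o₄ := o₃ + 1 + (s.code (o₃ + 1)).length
      e.code Y 1 o ++ (f.code Y 2 o₁ ++ (c.jump 3 5 (o₃ + 1) ::
        (t.code (o₂ + 1) ++ (.jumpEq 3 3 o₄ :: s.code (o₃ + 1)))))
  | loop c e f s, o =>
      let o₁ := o + (e.code Y 1 o).length
      let o₂ := o₁ + (f.code Y 2 o₁).length
      let o₃ := o₂ + 2 + (s.code (o₂ + 2)).length
      e.code Y 1 o ++ (f.code Y 2 o₁ ++ (c.jump 3 5 (o₂ + 2) :: .jumpEq 3 3 (o₃ + 1) ::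
        (s.code (o₂ + 2) ++ [.jumpEq 3 3 o])))

/-- The list of instructions `l` stands at position `o` of the program. -/
def CodeAt (P : Program) (o : ℕ) (l : List Instr) : Prop :=
  ∀ i, i < l.length → P[o + i]? = l[i]?

theorem CodeAt.append {P : Program} {o : ℕ} {l l' : List Instr} (h : CodeAt P o (l ++ l')) :
    CodeAt P o l ∧ CodeAt P (o + l.length) l' := by
  constructor
  · intro i hi
    rw [h i (by simp; omega), List.getElem?_append_left hi]
  · intro i hi
    rw [add_assoc, h (l.length + i) (by simp; omega), List.getElem?_append_right (by omega)]
    simp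

theorem CodeAt.cons {P : Program} {o : ℕ} {c : Instr} {l : List Instr} (h : CodeAt P o (c :: l)) :
    P[o]? = some c ∧ CodeAt P (o + 1) l := by
  constructor
  · simpa using h 0 (by simp)
  · intro i hi
    have := h (i + 1) (by simp; omega)
    rw [show o + (i + 1) = o + 1 + i by ring] at this
    simpa using this

/-- `Runs w P T c c'`: at most `T` steps lead from `c` to `c'`. -/
def Runs (w : ℕ) (P : Program) (T : ℕ) (c c' : Config) : Prop :=
  ∃ t, t ≤ T ∧ (step w P)^[t] c = c'

theorem Runs.refl {w : ℕ} {P : Program} {c : Config} (T : ℕ) : Runs w P T c c :=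
  ⟨0, Nat.zero_le _, rfl⟩

theorem Runs.trans {w : ℕ} {P : Program} {T T' : ℕ} {c c' c'' : Config} (h : Runs w P T c c')
    (h' : Runs w P T' c' c'') : Runs w P (T + T') c c'' := by
  obtain ⟨t, ht, rfl⟩ := h
  obtain ⟨t', ht', rfl⟩ := h'
  exact ⟨t' + t, by omega, by rw [Function.iterate_add_apply]⟩

theorem Runs.mono {w : ℕ} {P : Program} {T T' : ℕ} {c c' : Config} (h : Runs w P T c c')
    (hT : T ≤ T') : Runs w P T' c c' :=
  ⟨h.choose, h.choose_spec.1.trans hT, h.choose_spec.2⟩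

theorem Runs.head {w : ℕ} {P : Program} {T : ℕ} {c c' : Config} {i : Instr}
    (hi : P[c.pc]? = some i) (h : Runs w P T (exec w c i) c') : Runs w P (T + 1) c c' := by
  obtain ⟨t, ht, rfl⟩ := h
  refine ⟨t + 1, by omega, ?_⟩
  rw [Function.iterate_succ_apply, step, hi]

/-- All the numbers in a configuration are words. -/
def Words (w : ℕ) (c : Config) : Prop := (∀ r, c.reg r < 2 ^ w) ∧ ∀ a, c.mem a < 2 ^ w

theorem Words.exec {w : ℕ} {c : Config} (h : Words w c) (i : Instr) : Words w (exec w c i) := by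
  have hw : 0 < 2 ^ w := by positivity
  have key : ∀ (f : ℕ → ℕ) (a x : ℕ), (∀ b, f b < 2 ^ w) → x < 2 ^ w →
      ∀ b, Function.update f a x b < 2 ^ w := by
    intro f a x hf hx b
    rw [Function.update_apply]
    split_ifs
    · exact hx
    · exact hf b
  cases i
  case store r s => exact ⟨h.1, key _ _ _ h.2 (h.1 _)⟩
  case load r s => exact ⟨key _ _ _ h.1 (h.2 _), h.2⟩
  case jumpLt | jumpEq | halt => exact h
  all_goals exact ⟨key _ _ _ h.1 (Nat.mod_lt _ hw), h.2⟩

theorem Words.runs {w : ℕ} {P : Program} {T : ℕ} {c c' : Config} (h : Words w c)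
    (hr : Runs w P T c c') : Words w c' := by
  obtain ⟨t, -, rfl⟩ := hr
  clear T
  induction t generalizing c with
  | zero => exact h
  | succ t ih =>
    rw [Function.iterate_succ_apply]
    apply ih
    unfold step
    split
    · exact h.exec _
    · exact h

/-- The configuration represents the state. -/
structure Rel (E : Env) (σ : St V A) (c : Config) : Prop where
  words : Words E.w c
  var : ∀ x, c.reg (2 * Y.var x) = σ.v x
  base : c.reg 1 = E.base
  inp : ∀ i, i < E.base → c.mem i = E.inp i
  arr : ∀ a i, i < E.cap → c.mem (E.base + (i * Y.width + Y.arr a)) = σ.a a i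

/-- The addresses of array cells are words. -/
def Env.Ok (E : Env) : Prop := E.base + E.cap * Y.width ≤ 2 ^ E.w ∧ Y.width < 2 ^ E.w

/-! ### Correctness of the compiler -/

variable {Y} {E : Env} {P : Program}

/-- The effect of evaluating an expression. -/
structure Computes (d o x : ℕ) (c c' : Config) : Prop where
  pc : c'.pc = o
  val : c'.reg (2 * d + 1) = x
  mem : c'.mem = c.mem
  frame : ∀ r, (∀ k, d ≤ k → r ≠ 2 * k + 1) → c'.reg r = c.reg r

theorem Computes.rel {d o x : ℕ} {c c' : Config} {σ : St V A} {T : ℕ} (h : Computes d o x c c')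
    (hr : Rel Y E σ c) (hd : 1 ≤ d) (hc : Runs E.w P T c c') : Rel Y E σ c' where
  words := hr.words.runs hc
  var y := by rw [h.frame _ (fun k _ => by omega), hr.var]
  base := by rw [h.frame _ (fun k _ => by omega), hr.base]
  inp := by rw [h.mem]; exact hr.inp
  arr := by rw [h.mem]; exact hr.arr

theorem addr_lt {n : ℕ} (a : A) (hn : n < E.cap) :
    n * Y.width + Y.arr a < E.cap * Y.width := by
  have := Y.arr_lt a
  nlinarith

/-- The arrays are interleaved with stride `Y.width` behind the input, whose length is kept in
register `1`. One multiplication and two additions give the address, and `Env.Ok` keeps every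
intermediate value below `2 ^ w`. -/
theorem exists_addrCode (hE : E.Ok Y) {a : A} {d o n : ℕ} {c : Config}
    (hP : CodeAt P o (addrCode Y a d)) (hd : 1 ≤ d) (hpc : c.pc = o)
    (hbase : c.reg 1 = E.base) (hn : c.reg (2 * d + 1) = n) (hcap : n < E.cap) :
    ∃ c', Runs E.w P 5 c c' ∧ Computes d (o + 5) (E.base + (n * Y.width + Y.arr a)) c c' := by
  obtain ⟨h₁, hP⟩ := hP.cons
  obtain ⟨h₂, hP⟩ := hP.cons
  obtain ⟨h₃, hP⟩ := hP.cons
  obtain ⟨h₄, hP⟩ := hP.cons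
  obtain ⟨h₅, -⟩ := hP.cons
  have hlt := addr_lt (Y := Y) a hcap
  have := hE.1
  have := hE.2
  have ha := Y.arr_lt a
  subst hpc
  refine ⟨_, .head h₁ (.head h₂ (.head h₃ (.head h₄ (.head h₅ (.refl 0))))), ?_⟩
  have e₁ : 2 * d + 1 ≠ 2 * d + 3 := by omega
  have e₂ : 1 ≠ 2 * d + 3 := by omega
  have e₃ : 1 ≠ 2 * d + 1 := by omega
  constructor
  · simp [exec, Config.setReg]
  · simp only [exec, Config.setReg, Function.update_self, Function.update_of_ne e₁,
      Function.update_of_ne e₂, Function.update_of_ne e₃, hbase, hn]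
    rw [Nat.mod_eq_of_lt (a := Y.width) (by omega), Nat.mod_eq_of_lt (a := Y.arr a) (by omega),
      Nat.mod_eq_of_lt (a := n * Y.width) (by omega),
      Nat.mod_eq_of_lt (a := n * Y.width + E.base) (by omega), Nat.mod_eq_of_lt (by omega)]
    ring
  · rfl
  · intro r hr
    have h₁ := hr d le_rfl
    have h₂ := hr (d + 1) (by omega)
    simp only [exec, Config.setReg]
    simp only [Function.update_apply]
    simp only [show r ≠ 2 * d + 3 by omega, h₁, if_false]

theorem exec_jump {w : ℕ} {c : Config} (o : Cmp) (s t k : ℕ) :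
    exec w c (o.jump s t k) =
      { c with pc := if o.Holds (c.reg s) (c.reg t) then k else c.pc + 1 } := by
  cases o <;> rfl

/-- Evaluating two expressions into neighboring registers. -/
theorem Computes.pair {d o₁ o₂ x y : ℕ} {c c₁ c₂ : Config} (h : Computes d o₁ x c c₁)
    (h' : Computes (d + 1) o₂ y c₁ c₂) :
    c₂.pc = o₂ ∧ c₂.reg (2 * d + 1) = x ∧ c₂.reg (2 * d + 3) = y ∧ c₂.mem = c.mem ∧
      ∀ r, (∀ k, d ≤ k → r ≠ 2 * k + 1) → c₂.reg r = c.reg r := by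
  refine ⟨h'.pc, ?_, h'.val, by rw [h'.mem, h.mem], fun r hr => ?_⟩
  · rw [h'.frame _ fun k hk => by omega, h.val]
  · rw [h'.frame _ fun k hk => hr k (by omega), h.frame _ hr]

/-- The depth `d` acts as a stack pointer: intermediate values occupy the odd registers from `2 * d
+ 1` on, and variables the even ones. The frame condition in `Computes` thus protects the variables,
register `1`, and the values at smaller depth. `Safe` makes the modular arithmetic agree with that
of natural numbers. -/
theorem exists_expCode (hE : E.Ok Y) {σ : St V A} (e : Exp V A) :
    ∀ {d o : ℕ} {c : Config}, CodeAt P o (e.code Y d o) → 1 ≤ d → c.pc = o → Rel Y E σ c →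
      e.Safe E σ → ∃ c', Runs E.w P e.cost c c' ∧
        Computes d (o + (e.code Y d o).length) (e.eval E σ) c c' := by
  have upd : ∀ (d x : ℕ) (f : ℕ → ℕ) (r : ℕ), (∀ k, d ≤ k → r ≠ 2 * k + 1) →
      Function.update f (2 * d + 1) x r = f r := by
    intro d x f r hr
    exact Function.update_of_ne (hr d le_rfl) _ _
  induction e with
  | const n =>
    intro d o c hP hd hpc hr hs
    obtain ⟨h₁, -⟩ := hP.cons
    subst hpc
    exact ⟨_, .head h₁ (.refl 0), by simp [exec, Config.setReg, Exp.code],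
      by simpa [exec, Config.setReg] using Nat.mod_eq_of_lt (show _ < 2 ^ E.w from hs), rfl,
      fun r hr => upd _ _ _ _ hr⟩
  | var x =>
    intro d o c hP hd hpc hr hs
    obtain ⟨h₁, hP⟩ := hP.cons
    obtain ⟨h₂, -⟩ := hP.cons
    subst hpc
    refine ⟨_, .head h₁ (.head h₂ (.refl 0)), by simp [exec, Config.setReg, Exp.code],
      ?_, rfl, fun r hr => ?_⟩
    · have h := hr.words.1 (2 * Y.var x)
      rw [hr.var] at h
      simp only [exec, Config.setReg, Function.update_self,
        Function.update_of_ne (show 2 * Y.var x ≠ 2 * d + 1 by omega), hr.var]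
      simpa using Nat.mod_eq_of_lt h
    · simp only [exec, Config.setReg]
      rw [upd _ _ _ _ hr, upd _ _ _ _ hr]
  | inp e ih =>
    intro d o c hP hd hpc hr hs
    obtain ⟨hP, hP'⟩ := hP.append
    obtain ⟨h₁, -⟩ := hP'.cons
    obtain ⟨c₁, hc₁, hv⟩ := ih hP hd hpc hr hs.1
    refine ⟨_, hc₁.trans (.head (by rw [hv.pc]; exact h₁) (.refl 0)), ?_, ?_, ?_, ?_⟩
    · simp [exec, Config.setReg, Exp.code, hv.pc, add_assoc]
    · simp only [exec, Config.setReg, Function.update_self, hv.val, hv.mem, Exp.eval]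
      exact hr.inp _ hs.2
    · exact hv.mem
    · intro r hr'
      simp only [exec, Config.setReg]
      rw [upd _ _ _ _ hr', hv.frame _ hr']
  | arr a e ih =>
    intro d o c hP hd hpc hr hs
    obtain ⟨hP, hP'⟩ := hP.append
    obtain ⟨hP', hP''⟩ := hP'.append
    obtain ⟨h₁, -⟩ := hP''.cons
    obtain ⟨c₁, hc₁, hv⟩ := ih hP hd hpc hr hs.1
    obtain ⟨c₂, hc₂, hv₂⟩ := exists_addrCode hE hP' hd hv.pc (hv.rel hr hd hc₁).base hv.val hs.2
    have hr₂ := hv₂.rel (hv.rel hr hd hc₁) hd hc₂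
    refine ⟨_, (hc₁.trans hc₂).trans
      (.head (by rw [hv₂.pc]; exact h₁) (.refl 0)), ?_, ?_, ?_, ?_⟩
    · simp [exec, Config.setReg, Exp.code, hv₂.pc, addrCode, add_assoc]
    · simp only [exec, Config.setReg, Function.update_self, hv₂.val, Exp.eval]
      exact hr₂.arr _ _ hs.2
    · exact hv₂.mem.trans hv.mem
    · intro r hr'
      simp only [exec, Config.setReg]
      rw [upd _ _ _ _ hr', hv₂.frame _ hr', hv.frame _ hr']
  | add e f ihe ihf =>
    intro d o c hP hd hpc hr hs
    obtain ⟨hP, hP'⟩ := hP.append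
    obtain ⟨hP', hP''⟩ := hP'.append
    obtain ⟨h₁, -⟩ := hP''.cons
    obtain ⟨c₁, hc₁, hv⟩ := ihe hP hd hpc hr hs.1
    obtain ⟨c₂, hc₂, hv₂⟩ := ihf hP' (by omega) hv.pc (hv.rel hr hd hc₁) hs.2.1
    obtain ⟨q₁, q₂, q₃, q₄, q₅⟩ := hv.pair hv₂
    refine ⟨_, (hc₁.trans hc₂).trans (.head (by rw [q₁]; exact h₁) (.refl 0)), ?_, ?_, ?_, ?_⟩
    · simp [exec, Config.setReg, Exp.code, q₁, add_assoc]
    · simp only [exec, Config.setReg, Function.update_self, q₂, q₃, Exp.eval]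
      exact Nat.mod_eq_of_lt hs.2.2
    · exact q₄
    · intro r hr'
      simp only [exec, Config.setReg]
      rw [upd _ _ _ _ hr', q₅ _ hr']
  | mul e f ihe ihf =>
    intro d o c hP hd hpc hr hs
    obtain ⟨hP, hP'⟩ := hP.append
    obtain ⟨hP', hP''⟩ := hP'.append
    obtain ⟨h₁, -⟩ := hP''.cons
    obtain ⟨c₁, hc₁, hv⟩ := ihe hP hd hpc hr hs.1
    obtain ⟨c₂, hc₂, hv₂⟩ := ihf hP' (by omega) hv.pc (hv.rel hr hd hc₁) hs.2.1
    obtain ⟨q₁, q₂, q₃, q₄, q₅⟩ := hv.pair hv₂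
    refine ⟨_, (hc₁.trans hc₂).trans (.head (by rw [q₁]; exact h₁) (.refl 0)), ?_, ?_, ?_, ?_⟩
    · simp [exec, Config.setReg, Exp.code, q₁, add_assoc]
    · simp only [exec, Config.setReg, Function.update_self, q₂, q₃, Exp.eval]
      exact Nat.mod_eq_of_lt hs.2.2
    · exact q₄
    · intro r hr'
      simp only [exec, Config.setReg]
      rw [upd _ _ _ _ hr', q₅ _ hr']
  | sub e f ihe ihf =>
    intro d o c hP hd hpc hr hs
    obtain ⟨hP, hP'⟩ := hP.append
    obtain ⟨hP', hP''⟩ := hP'.append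
    obtain ⟨h₁, hP''⟩ := hP''.cons
    obtain ⟨h₂, hP''⟩ := hP''.cons
    obtain ⟨h₃, hP''⟩ := hP''.cons
    obtain ⟨h₄, -⟩ := hP''.cons
    obtain ⟨c₁, hc₁, hv⟩ := ihe hP hd hpc hr hs.1
    obtain ⟨c₂, hc₂, hv₂⟩ := ihf hP' (by omega) hv.pc (hv.rel hr hd hc₁) hs.2
    have hr₂ := hv₂.rel (hv.rel hr hd hc₁) (by omega) hc₂
    obtain ⟨q₁, q₂, q₃, q₄, q₅⟩ := hv.pair hv₂
    rw [← q₁] at h₁ h₂ h₃ h₄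
    have hle : (e.eval E σ) < 2 ^ E.w := by rw [← q₂]; exact hr₂.words.1 _
    -- Subtraction of expressions is truncated while that of the machine is modular; the code jumps
    -- to a constant `0` when the result would be negative.
    by_cases hlt : e.eval E σ < f.eval E σ
    · have e₁ : exec E.w c₂ (.jumpLt (2 * d + 1) (2 * d + 3) (c₂.pc + 3)) =
          { c₂ with pc := c₂.pc + 3 } := by simp [exec, q₂, q₃, hlt]
      refine ⟨_, ((hc₁.trans hc₂).trans (T' := 2) (.head h₁ (by
        rw [e₁]; exact .head h₄ (.refl 0)))).mono (by simp), ?_, ?_, ?_, ?_⟩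
      · simp [exec, Config.setReg, Exp.code, q₁, add_assoc]
      · simp only [exec, Config.setReg, Function.update_self, Exp.eval]
        rw [Nat.zero_mod]; omega
      · exact q₄
      · intro r hr'
        simp only [exec, Config.setReg]
        rw [upd _ _ _ _ hr', q₅ _ hr']
    · have e₁ : exec E.w c₂ (.jumpLt (2 * d + 1) (2 * d + 3) (c₂.pc + 3)) =
          { c₂ with pc := c₂.pc + 1 } := by simp [exec, q₂, q₃, hlt]
      refine ⟨_, ((hc₁.trans hc₂).trans (T' := 3) (.head h₁ (by
        rw [e₁]; exact .head h₂ (.head h₃ (.refl 0))))).mono (by simp), ?_, ?_, ?_, ?_⟩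
      · simp [exec, Config.setReg, Exp.code, q₁, add_assoc]
      · simp only [exec, Config.setReg, Function.update_self, Exp.eval, q₂, q₃]
        rw [show e.eval E σ + (2 ^ E.w - f.eval E σ) =
          (e.eval E σ - f.eval E σ) + 2 ^ E.w by omega, Nat.add_mod_right]
        exact Nat.mod_eq_of_lt (by omega)
      · exact q₄
      · intro r hr'
        simp only [exec, Config.setReg]
        rw [upd _ _ _ _ hr', q₅ _ hr']
  | ite cm e f s t ihe ihf ihs iht =>
    intro d o c hP hd hpc hr hs
    obtain ⟨hP, hP'⟩ := hP.append
    obtain ⟨hP', hP''⟩ := hP'.append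
    obtain ⟨h₁, hP''⟩ := hP''.cons
    obtain ⟨hPt, hP''⟩ := hP''.append
    obtain ⟨h₂, hPs⟩ := hP''.cons
    obtain ⟨hse, hsf, hss, hst⟩ := hs
    obtain ⟨c₁, hc₁, hv⟩ := ihe hP hd hpc hr hse
    obtain ⟨c₂, hc₂, hv₂⟩ := ihf hP' (by omega) hv.pc (hv.rel hr hd hc₁) hsf
    have hr₂ := hv₂.rel (hv.rel hr hd hc₁) (by omega) hc₂
    obtain ⟨q₁, q₂, q₃, q₄, q₅⟩ := hv.pair hv₂
    have h₁ := (congrArg (P[·]?) q₁).trans h₁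
    by_cases ho : cm.Holds (e.eval E σ) (f.eval E σ)
    · obtain ⟨c₃, hc₃, hv₃⟩ := ihs (c := { c₂ with pc := _ }) hPs hd rfl
        ⟨hr₂.words, hr₂.var, hr₂.base, hr₂.inp, hr₂.arr⟩ (hss ho)
      refine ⟨c₃, ((hc₁.trans hc₂).trans (T' := s.cost + 1) (.head h₁ ?_)).mono
        (by simp; omega), ?_, ?_, ?_, ?_⟩
      · rw [exec_jump, q₂, q₃, if_pos ho]; exact hc₃
      · rw [hv₃.pc]; simp [Exp.code]; omega
      · rw [hv₃.val]; simp [ho]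
      · rw [hv₃.mem]; exact q₄
      · intro r hr'
        rw [hv₃.frame _ hr']; exact q₅ _ hr'
    · obtain ⟨c₃, hc₃, hv₃⟩ := iht (c := { c₂ with pc := _ }) hPt hd rfl
        ⟨hr₂.words, hr₂.var, hr₂.base, hr₂.inp, hr₂.arr⟩ (hst ho)
      have hrun := hc₃.trans (.head (by rw [hv₃.pc]; exact h₂) (.refl 0))
      have e₁ := exec_jump (w := E.w) (c := c₂) cm (2 * d + 1) (2 * d + 3)
        (o + (e.code Y d o).length + (f.code Y (d + 1) (o + (e.code Y d o).length)).length + 1 +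
          (t.code Y d (o + (e.code Y d o).length +
            (f.code Y (d + 1) (o + (e.code Y d o).length)).length + 1)).length + 1)
      rw [q₂, q₃, if_neg ho, q₁] at e₁
      rw [← e₁] at hrun
      refine ⟨_, ((hc₁.trans hc₂).trans (.head h₁ hrun)).mono (by simp; omega), ?_, ?_, ?_, ?_⟩
      · simp [exec, Exp.code]; omega
      · simp [exec, hv₃.val, ho]
      · exact hv₃.mem.trans q₄
      · intro r hr'
        simp only [exec]
        rw [hv₃.frame _ hr']; exact q₅ _ hr'

theorem Rel.tick {σ : St V A} {c : Config} (h : Rel Y E σ c) (n : ℕ) : Rel Y E (σ.tick n) c :=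
  ⟨h.words, h.var, h.base, h.inp, h.arr⟩

theorem Rel.withPc {σ : St V A} {c : Config} (h : Rel Y E σ c) (n : ℕ) :
    Rel Y E σ { c with pc := n } :=
  ⟨h.words, h.var, h.base, h.inp, h.arr⟩

/-- Evaluating the two sides of a comparison and jumping. -/
theorem exists_compareCode (hE : E.Ok Y) {σ : St V A} {o : ℕ} {c : Config} {cm : Cmp}
    {e f : Exp V A} {k : ℕ} {l : List Instr}
    (hP : CodeAt P o (e.code Y 1 o ++ (f.code Y 2 (o + (e.code Y 1 o).length) ++
      (cm.jump 3 5 k :: l)))) (hpc : c.pc = o) (hr : Rel Y E σ c)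
    (hs : e.Safe E σ) (hs' : f.Safe E σ) :
    ∃ c', Runs E.w P (e.cost + f.cost + 1) c c' ∧ Rel Y E σ c' ∧
      c'.pc = if cm.Holds (e.eval E σ) (f.eval E σ) then k else
        o + (e.code Y 1 o).length + (f.code Y 2 (o + (e.code Y 1 o).length)).length + 1 := by
  obtain ⟨hP, hP'⟩ := hP.append
  obtain ⟨hP', hP''⟩ := hP'.append
  obtain ⟨h₁, -⟩ := hP''.cons
  obtain ⟨c₁, hc₁, hv⟩ := exists_expCode hE e hP le_rfl hpc hr hs
  have hr₁ := hv.rel hr le_rfl hc₁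
  obtain ⟨c₂, hc₂, hv₂⟩ := exists_expCode hE f hP' (by omega) hv.pc hr₁ hs'
  have hr₂ := hv₂.rel hr₁ (by omega) hc₂
  obtain ⟨q₁, q₂, q₃, -, -⟩ := hv.pair hv₂
  rw [← q₁] at h₁
  refine ⟨_, (hc₁.trans hc₂).trans (.head h₁ (.refl 0)), ?_, ?_⟩
  · rw [exec_jump]; exact hr₂.withPc _
  · rw [exec_jump]
    simp only [mul_one] at q₂ q₃
    simp only [Nat.reduceAdd] at q₂ q₃
    simp only [q₂, q₃, q₁]

section

variable [DecidableEq V] [DecidableEq A]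

/-- The compiled command does what the command does. -/
theorem Exec.runs (hE : E.Ok Y) {cmd : Cmd V A} {σ σ' : St V A} (h : Exec E cmd σ σ') :
    ∀ {o : ℕ} {c : Config}, CodeAt P o (cmd.code Y o) → c.pc = o → Rel Y E σ c →
      σ.clk ≤ σ'.clk ∧ ∃ c', Runs E.w P (σ'.clk - σ.clk) c c' ∧ Rel Y E σ' c' ∧
        c'.pc = o + (cmd.code Y o).length := by
  induction h with
  | skip σ =>
    intro o c hP hpc hr
    exact ⟨le_rfl, c, .refl _, hr, by simpa [Cmd.code] using hpc⟩
  | set x e σ hs =>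
    intro o c hP hpc hr
    obtain ⟨hP, hP'⟩ := hP.append
    obtain ⟨h₁, hP'⟩ := hP'.cons
    obtain ⟨h₂, -⟩ := hP'.cons
    obtain ⟨c₁, hc₁, hv⟩ := exists_expCode hE e hP le_rfl hpc hr hs
    have hr₁ := hv.rel hr le_rfl hc₁
    rw [← hv.pc] at h₁ h₂
    have hruns := hc₁.trans (.head h₁ (.head h₂ (.refl 0)))
    have hw := hr₁.words.1 3
    have hval : c₁.reg 3 = e.eval E σ := hv.val
    refine ⟨by simp [St.tick, St.setVar], _, hruns.mono (by simp [St.tick, St.setVar]),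
      ⟨hr.words.runs hruns, ?_, ?_, ?_, ?_⟩, ?_⟩
    · intro y
      have := Nat.mod_eq_of_lt (hval ▸ hw)
      by_cases hxy : y = x
      · subst hxy
        simp [exec, Config.setReg, St.tick, St.setVar, Function.update_of_ne
          (show 3 ≠ 2 * Y.var y by omega), this, hval]
      · have h3 : 2 * Y.var y ≠ 2 * Y.var x := fun h => hxy (Y.var_inj (by omega))
        simp [exec, Config.setReg, St.tick, St.setVar, Function.update_of_ne h3,
          Function.update_of_ne hxy, hr₁.var]
    · simp [exec, Config.setReg, Function.update_of_ne (show 1 ≠ 2 * Y.var x by omega), hr₁.base]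
    · exact hr₁.inp
    · exact hr₁.arr
    · simp [exec, Config.setReg, Cmd.code, hv.pc, add_assoc]
  | store a e f σ hs hs' hcap =>
    intro o c hP hpc hr
    obtain ⟨hP, hP'⟩ := hP.append
    obtain ⟨hP', hP''⟩ := hP'.append
    obtain ⟨hPf, hP''⟩ := hP''.append
    obtain ⟨h₁, -⟩ := hP''.cons
    obtain ⟨c₁, hc₁, hv⟩ := exists_expCode hE e hP le_rfl hpc hr hs
    have hr₁ := hv.rel hr le_rfl hc₁
    obtain ⟨c₂, hc₂, hv₂⟩ := exists_addrCode hE hP' le_rfl hv.pc hr₁.base hv.val hcap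
    have hr₂ := hv₂.rel hr₁ le_rfl hc₂
    obtain ⟨c₃, hc₃, hv₃⟩ := exists_expCode hE f hPf (by omega) hv₂.pc hr₂ hs'
    have hr₃ := hv₃.rel hr₂ (by omega) hc₃
    obtain ⟨q₁, q₂, q₃, -, -⟩ := hv₂.pair hv₃
    simp only [mul_one, Nat.reduceAdd] at q₂ q₃
    have h₁' : P[c₃.pc]? = some (.store 3 5) := by rw [q₁, ← h₁]; rfl
    have hruns := ((hc₁.trans hc₂).trans hc₃).trans (.head h₁' (.refl 0))
    have hlt := addr_lt (Y := Y) a hcap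
    refine ⟨by simp [St.tick, St.setArr], _, hruns.mono
      (by simp only [St.tick, St.setArr]; omega),
      ⟨hr.words.runs hruns, hr₃.var, hr₃.base, ?_, ?_⟩, ?_⟩
    · intro i hi
      simp only [exec, q₂, q₃]
      rw [Function.update_of_ne (by omega)]
      exact hr₃.inp i hi
    · intro b i hi
      simp only [exec, q₂, q₃, St.tick, St.setArr]
      have h₂ := Y.arr_lt a
      have h₃ := Y.arr_lt b
      by_cases hab : b = a
      · subst hab
        rw [Function.update_self]
        by_cases hin : i = e.eval E σ
        · subst hin; rw [Function.update_self, Function.update_self]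
        · rw [Function.update_of_ne hin, Function.update_of_ne, hr₃.arr _ _ hi]
          intro h
          exact hin (Nat.eq_of_mul_eq_mul_right (by omega : 0 < Y.width) (by omega))
      · rw [Function.update_of_ne hab, Function.update_of_ne, hr₃.arr _ _ hi]
        intro h
        apply hab
        apply Y.arr_inj
        -- Cells of different arrays have different residues modulo the width.
        have h := Nat.add_left_cancel h
        have := congrArg (· % Y.width) h
        simpa [Nat.mul_add_mod', Nat.mod_eq_of_lt h₂, Nat.mod_eq_of_lt h₃] using this
    · simp [exec, Cmd.code, q₁, addrCode]; omega
  | seq _ _ ih ih' =>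
    intro o c hP hpc hr
    obtain ⟨hP, hP'⟩ := hP.append
    obtain ⟨hk, c₁, hc₁, hr₁, hpc₁⟩ := ih hP hpc hr
    obtain ⟨hk', c₂, hc₂, hr₂, hpc₂⟩ := ih' hP' hpc₁ hr₁
    refine ⟨hk.trans hk', c₂, (hc₁.trans hc₂).mono (by omega), hr₂, ?_⟩
    rw [hpc₂]; simp [Cmd.code, add_assoc]
  | @condTrue cm e f s t σ σ' hs hs' ho _ ih =>
    intro o c hP hpc hr
    obtain ⟨c₁, hc₁, hr₁, hpc₁⟩ := exists_compareCode hE hP hpc hr hs hs'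
    rw [if_pos ho] at hpc₁
    obtain ⟨-, hP⟩ := hP.append
    obtain ⟨-, hP⟩ := hP.append
    obtain ⟨-, hP⟩ := hP.cons
    obtain ⟨-, hP⟩ := hP.append
    obtain ⟨-, hP⟩ := hP.cons
    obtain ⟨hk, c₂, hc₂, hr₂, hpc₂⟩ := ih hP hpc₁ (hr₁.tick _)
    simp only [St.tick] at hk hc₂
    refine ⟨by omega, c₂, (hc₁.trans hc₂).mono (by omega), hr₂, ?_⟩
    rw [hpc₂]; simp [Cmd.code]; omega
  | @condFalse cm e f s t σ σ' hs hs' ho _ ih =>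
    intro o c hP hpc hr
    obtain ⟨c₁, hc₁, hr₁, hpc₁⟩ := exists_compareCode hE hP hpc hr hs hs'
    rw [if_neg ho] at hpc₁
    obtain ⟨-, hP⟩ := hP.append
    obtain ⟨-, hP⟩ := hP.append
    obtain ⟨-, hP⟩ := hP.cons
    obtain ⟨hP, hP'⟩ := hP.append
    obtain ⟨h₁, -⟩ := hP'.cons
    obtain ⟨hk, c₂, hc₂, hr₂, hpc₂⟩ := ih hP hpc₁ (hr₁.tick _)
    simp only [St.tick] at hk hc₂
    have h₁ := (congrArg (P[·]?) hpc₂).trans h₁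
    refine ⟨by omega, _, (hc₁.trans (hc₂.trans (.head h₁ (.refl 0)))).mono (by omega),
      hr₂.withPc _, ?_⟩
    simp [exec, Cmd.code]; omega
  | @loopTrue cm e f s σ σ' σ'' hs hs' ho _ _ ih ih' =>
    intro o c hP hpc hr
    obtain ⟨c₁, hc₁, hr₁, hpc₁⟩ := exists_compareCode hE hP hpc hr hs hs'
    rw [if_pos ho] at hpc₁
    have hP₀ := hP
    obtain ⟨-, hP⟩ := hP.append
    obtain ⟨-, hP⟩ := hP.append
    obtain ⟨-, hP⟩ := hP.cons
    obtain ⟨-, hP⟩ := hP.cons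
    obtain ⟨hP, hP'⟩ := hP.append
    obtain ⟨h₁, -⟩ := hP'.cons
    obtain ⟨hk, c₂, hc₂, hr₂, hpc₂⟩ := ih hP hpc₁ (hr₁.tick _)
    simp only [St.tick] at hk hc₂
    rw [← hpc₂] at h₁
    obtain ⟨hk', c₃, hc₃, hr₃, hpc₃⟩ := ih' (c := { c₂ with pc := o }) hP₀ rfl (hr₂.withPc _)
    refine ⟨by omega, c₃, (hc₁.trans (hc₂.trans (T' := σ''.clk - σ'.clk + 1)
      (.head h₁ ?_))).mono (by omega), hr₃, hpc₃⟩
    simpa [exec] using hc₃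
  | @loopFalse cm e f s σ hs hs' ho =>
    intro o c hP hpc hr
    obtain ⟨c₁, hc₁, hr₁, hpc₁⟩ := exists_compareCode hE hP hpc hr hs hs'
    rw [if_neg ho] at hpc₁
    obtain ⟨-, hP⟩ := hP.append
    obtain ⟨-, hP⟩ := hP.append
    obtain ⟨-, hP⟩ := hP.cons
    obtain ⟨h₁, -⟩ := hP.cons
    rw [← hpc₁] at h₁
    refine ⟨by simp [St.tick], _, (hc₁.trans (.head h₁ (.refl 0))).mono (by simp [St.tick]),
      (hr₁.tick _).withPc _, ?_⟩
    simp [exec, Cmd.code]; omega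

end

end Imp

namespace OrdForest

/-! ### The recurrence on numbered intervals of the first tree -/

section Schedule

/-- Data of the states of the dynamic program: the interval `[lo s, hi s)` of state `s` in the first
tree, the kind of the state, and for every node the number of the state that consists of the nodes
below it. The kinds are: `0` empty, `1` an end of the interval is unmatched, `2` the tree at
the left end is removed, `3` the tree at the right end is removed, `4` a single tree. -/
structure StateData where
  lo : ℕ → ℕ
  hi : ℕ → ℕ
  kind : ℕ → ℕ
  below : ℕ → ℕ

variable (p lab : ℕ → ℕ) (Z : StateData)

/-- The recurrence can be applied to state `s`, and refers to states with larger numbers only. -/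
structure StateData.Ok (L S s : ℕ) : Prop where
  le : Z.lo s ≤ Z.hi s
  hi_le : Z.hi s ≤ L
  kind_le : Z.kind s ≤ 4
  empty : Z.kind s = 0 → Z.lo s = Z.hi s
  next_lt : Z.kind s ≠ 0 → s + 1 < S
  skip : Z.kind s = 1 → Z.lo s < Z.hi s ∧
    ((¬(Z.lo s < p (Z.lo s) ∧ p (Z.lo s) < Z.hi s) ∧
      Z.lo (s + 1) = Z.lo s + 1 ∧ Z.hi (s + 1) = Z.hi s) ∨
    (¬(Z.lo s ≤ p (Z.hi s - 1) ∧ p (Z.hi s - 1) < Z.hi s - 1) ∧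
      Z.lo (s + 1) = Z.lo s ∧ Z.hi (s + 1) = Z.hi s - 1))
  left : Z.kind s = 2 → Z.lo s < p (Z.lo s) ∧ p (Z.lo s) < Z.hi s ∧
    Z.lo (s + 1) = Z.lo s + 1 ∧ Z.hi (s + 1) = Z.hi s ∧
    s + (p (Z.lo s) + 1 - Z.lo s) < S ∧
    Z.lo (s + (p (Z.lo s) + 1 - Z.lo s)) = p (Z.lo s) + 1 ∧
    Z.hi (s + (p (Z.lo s) + 1 - Z.lo s)) = Z.hi s ∧
    s < Z.below (Z.lo s) ∧ Z.below (Z.lo s) < S ∧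
    Z.lo (Z.below (Z.lo s)) = Z.lo s + 1 ∧ Z.hi (Z.below (Z.lo s)) = p (Z.lo s)
  right : Z.kind s = 3 → Z.lo s ≤ p (Z.hi s - 1) ∧ p (Z.hi s - 1) < Z.hi s - 1 ∧
    Z.lo (s + 1) = Z.lo s ∧ Z.hi (s + 1) = Z.hi s - 1 ∧
    s + (Z.hi s - p (Z.hi s - 1)) < S ∧
    Z.lo (s + (Z.hi s - p (Z.hi s - 1))) = Z.lo s ∧
    Z.hi (s + (Z.hi s - p (Z.hi s - 1))) = p (Z.hi s - 1) ∧
    s < Z.below (p (Z.hi s - 1)) ∧ Z.below (p (Z.hi s - 1)) < S ∧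
    Z.lo (Z.below (p (Z.hi s - 1))) = p (Z.hi s - 1) + 1 ∧
    Z.hi (Z.below (p (Z.hi s - 1))) = Z.hi s - 1
  single : Z.kind s = 4 → Z.lo s < Z.hi s - 1 ∧ p (Z.lo s) = Z.hi s - 1 ∧
    Z.lo (s + 1) = Z.lo s + 1 ∧ Z.hi (s + 1) = Z.hi s - 1

/-- The number `x` is a correct entry of the table of the dynamic program. -/
def StateData.Good (L B s q r x : ℕ) : Prop :=
  parenDist p lab (Z.lo s) (Z.hi s) q r ≤ x ∧ UpperOK p lab L B (Z.lo s) (Z.hi s) q r x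

/-- The option to remove an end of the interval of the first tree. -/
def optNext (N : ℕ) (g : ℕ → ℕ → ℕ → ℕ) (s q r : ℕ) : ℕ :=
  if Z.kind s = 0 then (if q = r then 0 else N)
  else (if Z.kind s = 1 then 0 else 1) + g (s + 1) q r

/-- The option to remove the left end of the interval of the second tree. -/
def optLeft (N : ℕ) (g : ℕ → ℕ → ℕ → ℕ) (s q r : ℕ) : ℕ :=
  if q < r then (if q < p q then (if p q < r then 1 else 0) else 0) + g s (q + 1) r else N

/-- The option to remove the right end of the interval of the second tree. -/
def optRight (N : ℕ) (g : ℕ → ℕ → ℕ → ℕ) (s q r : ℕ) : ℕ :=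
  if q < r then (if p (r - 1) < q then 0 else (if p (r - 1) < r - 1 then 1 else 0)) +
    g s q (r - 1) else N

/-- The option to match the leftmost roots. -/
def optMatchLeft (N : ℕ) (g : ℕ → ℕ → ℕ → ℕ) (s q r : ℕ) : ℕ :=
  if Z.kind s = 2 then (if q < r then (if q < p q then (if p q < r then
    (if lab (Z.lo s) = lab q then 0 else 1) + g (Z.below (Z.lo s)) (q + 1) (p q) +
      g (s + (p (Z.lo s) + 1 - Z.lo s)) (p q + 1) r
    else N) else N) else N) else N

/-- The option to match the rightmost roots. -/
def optMatchRight (N : ℕ) (g : ℕ → ℕ → ℕ → ℕ) (s q r : ℕ) : ℕ :=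
  if Z.kind s = 3 then (if q < r then (if p (r - 1) < q then N else (if p (r - 1) < r - 1 then
    (if lab (p (Z.hi s - 1)) = lab (p (r - 1)) then 0 else 1) +
      g (Z.below (p (Z.hi s - 1))) (p (r - 1) + 1) (r - 1) +
      g (s + (Z.hi s - p (Z.hi s - 1))) q (p (r - 1))
    else N)) else N) else N

/-- The option to match the roots of two trees. -/
def optMatchSingle (N : ℕ) (g : ℕ → ℕ → ℕ → ℕ) (s q r : ℕ) : ℕ :=
  if Z.kind s = 4 then (if q < r then (if q < p q then (if p q = r - 1 then
    (if lab (Z.lo s) = lab q then 0 else 1) + g (s + 1) (q + 1) (r - 1)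
    else N) else N) else N) else N

/-- The entry of the table computed from other entries. -/
def entry (N : ℕ) (g : ℕ → ℕ → ℕ → ℕ) (s q r : ℕ) : ℕ :=
  min (min (min (min (min (min N (optNext Z N g s q r)) (optLeft p N g s q r))
    (optRight p N g s q r)) (optMatchLeft p lab Z N g s q r)) (optMatchRight p lab Z N g s q r))
    (optMatchSingle p lab Z N g s q r)

variable {p lab Z}

theorem parenDist_le {L N i j q r : ℕ} (hj : j ≤ L) (hq : L ≤ q) (hqr : q ≤ r)
    (hr : r ≤ 2 * N) : parenDist p lab i j q r ≤ N := by
  have h₁ := two_mul_size_ofParens_le p lab i j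
  have h₂ := two_mul_size_ofParens_le p lab q r
  have h₃ := editDist_le_size (ofParens p lab i j) (ofParens p lab q r)
  unfold parenDist
  omega

theorem le_ite_of {c : Prop} [Decidable c] {d x N : ℕ} (h : d ≤ N) (h' : c → d ≤ x) :
    d ≤ if c then x else N := by
  split_ifs with hc
  · exact h' hc
  · exact h

theorem le_ite_of_not {c : Prop} [Decidable c] {d x N : ℕ} (h : d ≤ N) (h' : ¬c → d ≤ x) :
    d ≤ if c then N else x := by
  split_ifs with hc
  · exact h
  · exact h' hc

theorem entry_le {N s q r : ℕ} {g : ℕ → ℕ → ℕ → ℕ} :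
    entry p lab Z N g s q r ≤ optNext Z N g s q r ∧
    entry p lab Z N g s q r ≤ optLeft p N g s q r ∧
    entry p lab Z N g s q r ≤ optRight p N g s q r ∧
    entry p lab Z N g s q r ≤ optMatchLeft p lab Z N g s q r ∧
    entry p lab Z N g s q r ≤ optMatchRight p lab Z N g s q r ∧
    entry p lab Z N g s q r ≤ optMatchSingle p lab Z N g s q r := by
  unfold entry
  omega

/-- The options use nested conditionals since expressions of the program test one comparison at a
time; here they are brought back to the conjunction in `costLeft`. -/
theorem optLeft_eq {N s q r : ℕ} {g : ℕ → ℕ → ℕ → ℕ} (h : q < r) :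
    optLeft p N g s q r = costLeft p q r + g s (q + 1) r := by
  have hcl : (if q < p q then (if p q < r then 1 else 0) else 0) = costLeft p q r := by
    unfold costLeft; split_ifs <;> first | rfl | omega
  rw [optLeft, if_pos h, hcl]

theorem optRight_eq {N s q r : ℕ} {g : ℕ → ℕ → ℕ → ℕ} (h : q < r) :
    optRight p N g s q r = costRight p q (r - 1) + g s q (r - 1) := by
  have hcr : (if p (r - 1) < q then 0 else (if p (r - 1) < r - 1 then 1 else 0)) =
      costRight p q (r - 1) := by
    unfold costRight; split_ifs <;> first | rfl | omega
  rw [optRight, if_pos h, hcr]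

/-- Each option is the cost of a legitimate way of editing, or the default `N`, which bounds every
distance. This half requires nothing of the potential, so values at the border of the band do no
harm. -/
theorem parenDist_le_entry {L S B N s q r : ℕ} {g : ℕ → ℕ → ℕ → ℕ} (hp : IsPairing p 0 L)
    (hp' : IsPairing p L (2 * N)) (hZ : Z.Ok p L S s)
    (hq : L ≤ q) (hqr : q ≤ r) (hr : r ≤ 2 * N)
    (hg : ∀ s' q' r', s < s' → s' < S → L ≤ q' → q' ≤ r' → r' ≤ 2 * N →
      Z.Good p lab L B s' q' r' (g s' q' r'))
    (hgl : q < r → Z.Good p lab L B s (q + 1) r (g s (q + 1) r))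
    (hgr : q < r → Z.Good p lab L B s q (r - 1) (g s q (r - 1))) :
    parenDist p lab (Z.lo s) (Z.hi s) q r ≤ entry p lab Z N g s q r := by
  have hN := parenDist_le (p := p) (lab := lab) (i := Z.lo s) hZ.hi_le hq hqr hr
  have hle := hZ.le
  have hhi := hZ.hi_le
  simp only [entry, le_min_iff]
  refine ⟨⟨⟨⟨⟨⟨hN, ?_⟩, ?_⟩, ?_⟩, ?_⟩, ?_⟩, ?_⟩
  · unfold optNext
    split_ifs with h₁ h₂ h₂
    · rw [parenDist, ofParens_of_le (i := Z.lo s) (by rw [hZ.empty h₁]),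
        ofParens_of_le (i := q) (by omega), editDist_nil_left]
      simp [size]
    · exact hN
    · have hG := (hg (s + 1) q r (by omega) (hZ.next_lt h₁) hq hqr hr).1
      obtain ⟨h₃, h | h⟩ := hZ.skip h₂
      · rw [parenDist, ofParens_skip h.1]
        rw [h.2.1, h.2.2] at hG
        unfold parenDist at hG; omega
      · rw [h.2.1, h.2.2] at hG
        have := ofParens_skip_right (lab := lab) hp (Nat.zero_le _) (by omega) h.1 (by omega)
        rw [Nat.sub_add_cancel (by omega)] at this
        rw [parenDist, this]
        unfold parenDist at hG; omega
    · have hG := (hg (s + 1) q r (by omega) (hZ.next_lt h₁) hq hqr hr).1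
      have hk := hZ.kind_le
      rcases (by omega : Z.kind s = 2 ∨ Z.kind s = 3 ∨ Z.kind s = 4) with h | h | h
      · obtain ⟨h₃, h₄, h₅, h₆, -⟩ := hZ.left h
        rw [h₅, h₆] at hG
        have := (edit_ofParens_left (lab := lab) hp (Nat.zero_le _) hhi h₃ h₄).editDist_le
          (ofParens p lab q r)
        unfold parenDist at *; omega
      · obtain ⟨h₃, h₄, h₅, h₆, -⟩ := hZ.right h
        rw [h₅, h₆] at hG
        have := (edit_ofParens_right (lab := lab) hp (Nat.zero_le _) (by omega) h₃ h₄).editDist_le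
          (ofParens p lab q r)
        rw [Nat.sub_add_cancel (by omega)] at this
        unfold parenDist at *; omega
      · obtain ⟨h₃, h₄, h₅, h₆⟩ := hZ.single h
        rw [h₅, h₆] at hG
        have := (edit_ofParens_left (lab := lab) hp (Nat.zero_le _) hhi (by omega)
          (by omega : p (Z.lo s) < Z.hi s)).editDist_le (ofParens p lab q r)
        -- In a single tree the next state drops the closing parenthesis of the deleted root too,
        -- without changing the forest.
        have e := ofParens_skip_right (lab := lab) (i := Z.lo s + 1) (j := Z.hi s - 1) hp
          (Nat.zero_le _) (by omega)
          (by rw [← h₄, hp.invol _ (Nat.zero_le _) (by omega)]; omega) (by omega)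
        rw [Nat.sub_add_cancel (by omega)] at e
        rw [e] at this
        unfold parenDist at *; omega
  · by_cases h : q < r
    · rw [optLeft_eq h]
      have := editDist_costLeft_le (lab := lab) hp' hq hr (ofParens p lab (Z.lo s) (Z.hi s))
      exact this.trans (Nat.add_le_add_left (hgl h).1 _)
    · rw [optLeft, if_neg h]; exact hN
  · by_cases h : q < r
    · rw [optRight_eq h]
      have := editDist_costRight_le (lab := lab) hp' (by omega : q ≤ r - 1) hq (by omega)
        (ofParens p lab (Z.lo s) (Z.hi s))
      rw [Nat.sub_add_cancel (by omega)] at this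
      exact this.trans (Nat.add_le_add_left (hgr h).1 _)
    · rw [optRight, if_neg h]; exact hN
  · refine le_ite_of hN fun h => le_ite_of hN fun h₁ => le_ite_of hN fun h₂ =>
      le_ite_of hN fun h₃ => ?_
    obtain ⟨a₁, a₂, -, -, a₃, a₄, a₅, a₆, a₇, a₈, a₉⟩ := hZ.left h
    have G₁ := (hg _ (q + 1) (p q) a₆ a₇ (by omega) (by omega) (by omega)).1
    have G₂ := (hg (s + (p (Z.lo s) + 1 - Z.lo s)) (p q + 1) r (by omega) a₃ (by omega)
      (by omega) (by omega)).1
    rw [a₈, a₉] at G₁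
    rw [a₄, a₅] at G₂
    have := parenDist_match_left_le (lab := lab) a₁ a₂ h₂ h₃
    omega
  · refine le_ite_of hN fun h => le_ite_of hN fun h₁ => le_ite_of_not hN fun h₂ =>
      le_ite_of hN fun h₃ => ?_
    obtain ⟨a₁, a₂, -, -, a₃, a₄, a₅, a₆, a₇, a₈, a₉⟩ := hZ.right h
    have G₁ := (hg _ (p (r - 1) + 1) (r - 1) a₆ a₇ (by omega) (by omega) (by omega)).1
    have G₂ := (hg (s + (Z.hi s - p (Z.hi s - 1))) q (p (r - 1)) (by omega) a₃ (by omega)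
      (by omega) (by omega)).1
    rw [a₈, a₉] at G₁
    rw [a₄, a₅] at G₂
    have := parenDist_match_right_le (lab := lab) hp hp' (j := Z.hi s - 1) (r := r - 1)
      (by omega) hq (by omega) a₁ a₂ (by omega) h₃
    rw [Nat.sub_add_cancel (by omega), Nat.sub_add_cancel (by omega)] at this
    omega
  · refine le_ite_of hN fun h => le_ite_of hN fun h₁ => le_ite_of hN fun h₂ =>
      le_ite_of hN fun h₃ => ?_
    obtain ⟨a₁, a₂, a₃, a₄⟩ := hZ.single h
    have G := (hg (s + 1) (q + 1) (r - 1) (by omega) (hZ.next_lt (by omega)) (by omega)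
      (by omega) (by omega)).1
    rw [a₃, a₄] at G
    have := parenDist_match_left_le (lab := lab) (i := Z.lo s) (j := Z.hi s) (q := q) (r := r)
      (by omega) (by omega) h₂ (by omega)
    rw [a₂, h₃, Nat.sub_add_cancel (by omega), Nat.sub_add_cancel (by omega)] at this
    rw [parenDist, parenDist, parenDist, ofParens_of_le (i := Z.hi s) le_rfl,
      ofParens_of_le (i := r) le_rfl, editDist_nil_left] at this
    simp only [size] at this
    unfold parenDist at G ⊢
    omega

/-- The kind of the state decides which of the lemmas on `UpperOK` applies. Each of these asks only
that the entry be at most the options it names, so taking the minimum with further options does not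
matter. -/
theorem entry_upperOK {L S B N s q r : ℕ} {g : ℕ → ℕ → ℕ → ℕ} (hp : IsPairing p 0 L)
    (hp' : IsPairing p L (2 * N)) (hZ : Z.Ok p L S s)
    (hq : L ≤ q) (hqr : q ≤ r) (hr : r ≤ 2 * N)
    (hg : ∀ s' q' r', s < s' → s' < S → L ≤ q' → q' ≤ r' → r' ≤ 2 * N →
      Z.Good p lab L B s' q' r' (g s' q' r'))
    (hgl : q < r → Z.Good p lab L B s (q + 1) r (g s (q + 1) r))
    (hgr : q < r → Z.Good p lab L B s q (r - 1) (g s q (r - 1))) :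
    UpperOK p lab L B (Z.lo s) (Z.hi s) q r (entry p lab Z N g s q r) := by
  have hle := hZ.le
  have hhi := hZ.hi_le
  obtain ⟨v₁, v₂, v₃, v₄, v₅, v₆⟩ := entry_le (p := p) (lab := lab) (Z := Z) (N := N) (g := g)
    (s := s) (q := q) (r := r)
  generalize entry p lab Z N g s q r = v at *
  have u₂ : q < r → ∃ y, UpperOK p lab L B (Z.lo s) (Z.hi s) (q + 1) r y ∧
      v ≤ costLeft p q r + y := fun h => ⟨_, (hgl h).2, by rw [← optLeft_eq h]; exact v₂⟩
  have u₃ : q < r → ∃ y, UpperOK p lab L B (Z.lo s) (Z.hi s) q (r - 1) y ∧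
      v ≤ costRight p q (r - 1) + y := fun h => ⟨_, (hgr h).2, by rw [← optRight_eq h]; exact v₃⟩
  have hk := hZ.kind_le
  rcases (by omega : Z.kind s = 0 ∨ Z.kind s = 1 ∨ Z.kind s = 2 ∨ Z.kind s = 3 ∨ Z.kind s = 4)
    with h | h | h | h | h
  · refine UpperOK.empty hp' (hZ.empty h) hq hqr hr (fun e => ?_) u₂
    simp only [optNext, h, e, if_true] at v₁
    omega
  · have hG := (hg (s + 1) q r (by omega) (hZ.next_lt (by omega)) hq hqr hr).2
    simp only [optNext, h, if_true, one_ne_zero, if_false, zero_add] at v₁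
    obtain ⟨h₃, h' | h'⟩ := hZ.skip h
    · rw [h'.2.1, h'.2.2] at hG
      exact hG.skip_left_left h₃ h'.1 v₁
    · rw [h'.2.1, h'.2.2] at hG
      have := hG.skip_right_left hp (by omega) (by omega) h'.1 v₁
      rwa [Nat.sub_add_cancel (by omega)] at this
  · have hG := (hg (s + 1) q r (by omega) (hZ.next_lt (by omega)) hq hqr hr).2
    simp only [optNext, h, OfNat.ofNat_ne_zero, OfNat.ofNat_ne_one, if_false] at v₁
    obtain ⟨a₁, a₂, a₁₀, a₁₁, a₃, a₄, a₅, a₆, a₇, a₈, a₉⟩ := hZ.left h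
    rw [a₁₀, a₁₁] at hG
    refine UpperOK.match_left hp hp' hhi hq hqr hr a₁ a₂ hG v₁ u₂ fun h₂ h₃ => ?_
    have G₁ := (hg _ (q + 1) (p q) a₆ a₇ (by omega) (by omega) (by omega)).2
    have G₂ := (hg (s + (p (Z.lo s) + 1 - Z.lo s)) (p q + 1) r (by omega) a₃ (by omega)
      (by omega) (by omega)).2
    rw [a₈, a₉] at G₁
    rw [a₄, a₅] at G₂
    refine ⟨_, _, G₁, G₂, ?_⟩
    rwa [optMatchLeft, if_pos h, if_pos (by omega), if_pos h₂, if_pos h₃] at v₄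
  · have hG := (hg (s + 1) q r (by omega) (hZ.next_lt (by omega)) hq hqr hr).2
    simp only [optNext, h, OfNat.ofNat_ne_zero, OfNat.ofNat_ne_one, if_false] at v₁
    obtain ⟨a₁, a₂, a₁₀, a₁₁, a₃, a₄, a₅, a₆, a₇, a₈, a₉⟩ := hZ.right h
    rw [a₁₀, a₁₁] at hG
    have hh : Z.hi s - 1 + 1 = Z.hi s := Nat.sub_add_cancel (by omega)
    have key := UpperOK.match_right (v := v) hp hp' (by omega) hq hqr hr a₁ a₂ hG v₁
    rw [hh] at key
    refine key u₃ fun h₂ h₃ => ?_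
    have G₁ := (hg _ (p (r - 1) + 1) (r - 1) a₆ a₇ (by omega) (by omega) (by omega)).2
    have G₂ := (hg (s + (Z.hi s - p (Z.hi s - 1))) q (p (r - 1)) (by omega) a₃ (by omega)
      (by omega) (by omega)).2
    rw [a₈, a₉] at G₁
    rw [a₄, a₅] at G₂
    refine ⟨_, _, G₁, G₂, ?_⟩
    rwa [optMatchRight, if_pos h, if_pos (by omega), if_neg (by omega), if_pos h₃] at v₅
  · have hG := (hg (s + 1) q r (by omega) (hZ.next_lt (by omega)) hq hqr hr).2
    simp only [optNext, h, OfNat.ofNat_ne_zero, OfNat.ofNat_ne_one, if_false] at v₁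
    obtain ⟨a₁, a₂, a₃, a₄⟩ := hZ.single h
    rw [a₃, a₄] at hG
    have hh : Z.hi s - 1 + 1 = Z.hi s := Nat.sub_add_cancel (by omega)
    have key := UpperOK.match_single (v := v) hp hp' (by omega) hq hqr hr a₁ a₂ hG v₁
    rw [hh] at key
    refine key u₂ u₃ fun h₂ h₃ => ?_
    have G := (hg (s + 1) (q + 1) (r - 1) (by omega) (hZ.next_lt (by omega)) (by omega)
        (by omega) (by omega)).2
    rw [a₃, a₄] at G
    refine ⟨_, G, ?_⟩
    rwa [optMatchSingle, if_pos h, if_pos (by omega), if_pos h₂, if_pos h₃] at v₆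

theorem entry_good {L S B N s q r : ℕ} {g : ℕ → ℕ → ℕ → ℕ} (hp : IsPairing p 0 L)
    (hp' : IsPairing p L (2 * N)) (hZ : Z.Ok p L S s)
    (hq : L ≤ q) (hqr : q ≤ r) (hr : r ≤ 2 * N)
    (hg : ∀ s' q' r', s < s' → s' < S → L ≤ q' → q' ≤ r' → r' ≤ 2 * N →
      Z.Good p lab L B s' q' r' (g s' q' r'))
    (hgl : q < r → Z.Good p lab L B s (q + 1) r (g s (q + 1) r))
    (hgr : q < r → Z.Good p lab L B s q (r - 1) (g s q (r - 1))) :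
    Z.Good p lab L B s q r (entry p lab Z N g s q r) :=
  ⟨parenDist_le_entry hp hp' hZ hq hqr hr hg hgl hgr,
    entry_upperOK hp hp' hZ hq hqr hr hg hgl hgr⟩

end Schedule

/-! ### Counting the states -/

/-- A bound for the number of states in the treatment of an interval of length `n`. -/
def stateBound (n : ℕ) : ℕ := 2 * n * (1 + Nat.log 2 n) + 1

theorem stateBound_mono {a b : ℕ} (h : a ≤ b) : stateBound a ≤ stateBound b := by
  unfold stateBound
  have := Nat.log_mono_right (b := 2) h
  gcongr

/-- The smaller part has at most half the length, so its logarithm is smaller by at least one. The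
resulting slack of `2 * a` pays for the `a` states that remove this part and for one extra additive
constant, as `1 ≤ a`. -/
theorem stateBound_split {a b n : ℕ} (ha : 1 ≤ a) (hab : a ≤ b) (hn : a + b = n) :
    a + stateBound a + stateBound b ≤ stateBound n := by
  have h₁ : Nat.log 2 a + 1 ≤ Nat.log 2 n := by
    rw [← Nat.log_mul_base (by omega) (by omega)]
    exact Nat.log_mono_right (by omega)
  have h₂ : Nat.log 2 b ≤ Nat.log 2 n := Nat.log_mono_right (by omega)
  unfold stateBound
  subst hn
  nlinarith [Nat.mul_le_mul_left a h₁, Nat.mul_le_mul_left b h₂]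

/-- The count for the step from a single tree to the forest below its root: one state, two
positions. -/
theorem stateBound_succ (n : ℕ) : 1 + stateBound n ≤ stateBound (n + 2) := by
  have h₂ : Nat.log 2 n ≤ Nat.log 2 (n + 2) := Nat.log_mono_right (by omega)
  unfold stateBound
  nlinarith [Nat.mul_le_mul_left n h₂]

end OrdForest

/-! ### The program -/

namespace TreeEdit

open Imp

/-- Variables of the program. -/
inductive Var where
  | res | N | L | T | B | W | t | e | cur | rem | d | v | i | j | s | m | a | b | q | r
  | val | tmp
  deriving DecidableEq

/-- Arrays of the program. -/
inductive Arr where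
  | P | LB | SC | SR | SI | SJ | SM | ID | TOP | TAB
  deriving DecidableEq

/-- The number of a variable. -/
def Var.index : Var → ℕ
  | res => 0 | N => 1 | L => 2 | T => 3 | B => 4 | W => 5 | t => 6 | e => 7 | cur => 8 | rem => 9
  | d => 10 | v => 11 | i => 12 | j => 13 | s => 14 | m => 15 | a => 16
  | b => 17 | q => 18 | r => 19 | val => 20 | tmp => 21

theorem Var.index_injective : Function.Injective Var.index := by
  have h : ∀ x : Var, [res, N, L, T, B, W, t, e, cur, rem, d, v, i, j, s, m, a, b, q, r,
      val, tmp][x.index]? = some x := by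
    intro x; cases x <;> rfl
  intro x y hxy
  have := h x
  rw [hxy, h y] at this
  exact (Option.some.inj this).symm

/-- The number of an array. -/
def Arr.index : Arr → ℕ
  | P => 0 | LB => 1 | SC => 2 | SR => 3 | SI => 4 | SJ => 5 | SM => 6 | ID => 7 | TOP => 8
  | TAB => 9

theorem Arr.index_injective : Function.Injective Arr.index := by
  have h : ∀ x : Arr, [P, LB, SC, SR, SI, SJ, SM, ID, TOP, TAB][x.index]? = some x := by
    intro x; cases x <;> rfl
  intro x y hxy
  have := h x
  rw [hxy, h y] at this
  exact (Option.some.inj this).symm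

/-- The numbering of variables and arrays. -/
def layout : Layout Var Arr where
  var := Var.index
  var_inj := Var.index_injective
  arr := Arr.index
  arr_inj := Arr.index_injective
  width := 10
  arr_lt a := by cases a <;> decide

open Exp Cmd

/-- The smaller one of two numbers. -/
abbrev minExp (e f : Exp Var Arr) : Exp Var Arr := ite .lt e f e f

/-- Sequences of commands. -/
def block : List (Cmd Var Arr) → Cmd Var Arr
  | [] => skip
  | [c] => c
  | c :: l => seq c (block l)

/-- Computes the parameters. -/
def initCmd : Cmd Var Arr := block [
  set .N (add (inp (const 1)) (inp (const 2))),
  set .L (mul (const 2) (inp (const 1))),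
  set .T (mul (const 2) (var .N)),
  set .B (mul (const 4) (minExp (inp (const 0)) (var .N))),
  set .W (add (mul (const 2) (var .B)) (const 1)),
  set .t (const 3),
  set .rem (const 2)]

/-- Reads the next node and writes an opening parenthesis. -/
def pushCmd : Cmd Var Arr := block [
  store .LB (var .e) (inp (var .t)),
  store .SC (var .d) (var .cur),
  store .SR (var .d) (sub (var .rem) (const 1)),
  set .d (add (var .d) (const 1)),
  set .cur (var .e),
  set .rem (inp (add (var .t) (const 1))),
  set .t (add (var .t) (const 2)),
  set .e (add (var .e) (const 1))]

/-- Writes a closing parenthesis. -/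
def popCmd : Cmd Var Arr := block [
  store .P (var .cur) (var .e),
  store .P (var .e) (var .cur),
  set .e (add (var .e) (const 1)),
  set .d (sub (var .d) (const 1)),
  set .cur (arr .SC (var .d)),
  set .rem (arr .SR (var .d))]

/-- Computes the sequence of parentheses of the two trees. -/
def parseCmd : Cmd Var Arr :=
  loop .lt (var .e) (var .T) (cond .eq (var .rem) (const 0) popCmd pushCmd)

/-! ### Correctness of parsing -/

theorem Term.block_cons {E : Env} {σ : St Var Arr} {Q : St Var Arr → Prop} {c c' : Cmd Var Arr}
    {l : List (Cmd Var Arr)} (h : Term E c σ fun σ' => Term E (block (c' :: l)) σ' Q) :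
    Term E (block (c :: c' :: l)) σ Q := Term.seq h

theorem Term.block_single {E : Env} {σ : St Var Arr} {Q : St Var Arr → Prop} {c : Cmd Var Arr}
    (h : Term E c σ Q) : Term E (block [c]) σ Q := h

/-- Bounds for the sizes of the numbers. -/
structure Bounds (E : Env) (N : ℕ) : Prop where
  base_eq : E.base = 2 * N + 3
  base_lt : E.base < E.lim
  cap_lt : E.cap < E.lim
  le_cap : 20 * (N + 1) ≤ E.cap

/-- The list `l` stands at position `t` of the input. -/
def InputAt (E : Env) (t : ℕ) (l : List ℕ) : Prop :=
  ∀ i, i < l.length → E.inp (t + i) = l.getD i 0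

theorem InputAt.append {E : Env} {t : ℕ} {l l' : List ℕ} (h : InputAt E t (l ++ l')) :
    InputAt E t l ∧ InputAt E (t + l.length) l' := by
  constructor
  · intro i hi
    rw [h i (by simp; omega), List.getD_append _ _ _ _ hi]
  · intro i hi
    rw [add_assoc, h (l.length + i) (by simp; omega), List.getD_append_right _ _ _ _ (by omega)]
    simp

theorem InputAt.cons {E : Env} {t x : ℕ} {l : List ℕ} (h : InputAt E t (x :: l)) :
    E.inp t = x ∧ InputAt E (t + 1) l := by
  constructor
  · simpa using h 0 (by simp)
  · intro i hi
    have := h (i + 1) (by simp; omega)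
    rw [show t + (i + 1) = t + 1 + i by ring] at this
    simpa using this

theorem length_encode (F : OrdForest ℕ) : (F.encode id).length = 2 * F.size := by
  induction F with
  | nil => rfl
  | cons a c r ih ih' =>
    simp only [OrdForest.encode, List.length_cons, List.length_append, ih, ih', OrdForest.size]
    omega

/-- Two states agree except for the variables and arrays that are used in parsing. -/
def ParseFrame (σ σ' : St Var Arr) : Prop :=
  (∀ x, x ≠ .e → x ≠ .t → x ≠ .rem → x ≠ .d → x ≠ .cur → σ'.v x = σ.v x) ∧
  ∀ x, x ≠ .P → x ≠ .LB → x ≠ .SC → x ≠ .SR → σ'.a x = σ.a x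

theorem ParseFrame.trans {σ σ' σ'' : St Var Arr} (h : ParseFrame σ σ') (h' : ParseFrame σ' σ'') :
    ParseFrame σ σ'' :=
  ⟨fun x a b c d e => (h'.1 x a b c d e).trans (h.1 x a b c d e),
    fun x a b c d => (h'.2 x a b c d).trans (h.2 x a b c d)⟩

/-- The effect of parsing a forest. -/
structure Parsed (F : OrdForest ℕ) (e₀ m : ℕ) (σ σ' : St Var Arr) : Prop where
  e : σ'.v .e = e₀ + 2 * F.size
  t : σ'.v .t = σ.v .t + 2 * F.size
  rem : σ'.v .rem = m
  d : σ'.v .d = σ.v .d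
  cur : σ'.v .cur = σ.v .cur
  clk : σ'.clk ≤ σ.clk + 300 * F.size
  repr : OrdForest.Represents (σ'.a .P) (σ'.a .LB) F e₀
  outside : ∀ x, (x < e₀ ∨ e₀ + 2 * F.size ≤ x) → σ'.a .P x = σ.a .P x ∧ σ'.a .LB x = σ.a .LB x
  stack : ∀ x, x < σ.v .d → σ'.a .SC x = σ.a .SC x ∧ σ'.a .SR x = σ.a .SR x
  frame : ParseFrame σ σ'

/-- The parser is one loop with an explicit stack, while the proof is by recursion on the forest.
The statement is therefore in continuation form: some iterations of the loop consume `F`, and what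
the rest of the loop achieves from there is assumed. Of the open siblings, `m` remain afterwards. -/
theorem parse_forest {E : Env} {N : ℕ} (hE : Bounds E N) (F : OrdForest ℕ) :
    ∀ {σ : St Var Arr} {Q : St Var Arr → Prop} {e₀ m : ℕ},
      (∀ x ∈ F.encode id, x < E.lim) →
      InputAt E (σ.v .t) (F.encode id) → σ.v .e = e₀ → σ.v .rem = F.numTrees + m →
      σ.v .T = 2 * N → e₀ + 2 * F.size ≤ 2 * N → σ.v .t + 2 * F.size ≤ 2 * N + 3 →
      σ.v .d + F.size ≤ N →
      σ.v .cur ≤ 2 * N →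
      (∀ σ', Parsed F e₀ m σ σ' → Term E parseCmd σ' Q) → Term E parseCmd σ Q := by
  induction F with
  | nil =>
    intro σ Q e₀ m hw hin he hrem hT h₁ h₂ h₃ h₃' hK
    refine hK σ ⟨he, rfl, by rw [hrem]; simp [OrdForest.numTrees], rfl, rfl, by simp, trivial,
      fun _ _ => ⟨rfl, rfl⟩, fun _ _ => ⟨rfl, rfl⟩, fun _ _ _ _ _ _ => rfl, fun _ _ _ _ _ => rfl⟩
  | cons lbl c r ihc ihr =>
    intro σ Q e₀ m hw hin he hrem hT h₁ h₂ h₃ h₃' hK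
    have b₁ := hE.base_eq
    have b₂ := hE.base_lt
    have b₃ := hE.cap_lt
    have b₄ := hE.le_cap
    simp only [OrdForest.encode] at hin hw
    obtain ⟨i₁, hin⟩ := hin.cons
    obtain ⟨i₂, hin⟩ := hin.cons
    obtain ⟨i₃, i₄⟩ := hin.append
    rw [length_encode] at i₄
    simp only [OrdForest.size] at h₁ h₂ h₃
    simp only [OrdForest.numTrees] at hrem
    refine Term.loop_true (by simp) (by simp) (by simp [he, hT]; omega) ?_
    refine Term.cond (by simp) (by simp; omega) (fun h => ?_) fun _ => ?_
    · simp [St.tick, hrem] at h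
    simp only [St.tick]
    refine Term.block_cons (Term.store ?_ ?_ ?_ ?_)
    · simp
    · simp; omega
    · simp [he]; omega
    refine Term.block_cons (Term.store ?_ ?_ ?_ ?_)
    · simp
    · simp
    · simp [St.tick, St.setArr]; omega
    refine Term.block_cons (Term.store ?_ ?_ ?_ ?_)
    · simp
    · simp; omega
    · simp [St.tick, St.setArr]; omega
    refine Term.block_cons (Term.set ?_ ?_)
    · simp [St.tick, St.setArr]; omega
    refine Term.block_cons (Term.set ?_ ?_)
    · simp
    refine Term.block_cons (Term.set ?_ ?_)
    · simp [St.tick, St.setArr, St.setVar]; omega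
    refine Term.block_cons (Term.set ?_ ?_)
    · simp [St.tick, St.setArr, St.setVar]; omega
    refine Term.block_single (Term.set ?_ ?_)
    · simp [St.tick, St.setArr, St.setVar, he]; omega
    simp only [St.tick, St.setArr, St.setVar, eval, cost, ne_eq, reduceCtorEq, not_false_eq_true,
      Function.update_of_ne, he, hrem, i₁, i₂]
    -- With `m := 0` the children are used up when this call ends, so the next iteration must close
    -- the root.
    refine ihc (e₀ := e₀ + 1) (m := 0) (fun x hx => hw x (by simp [hx])) (by simpa using i₃)
      (by simp) (by simp) (by simpa using hT) (by omega) (by simp; omega) (by simp; omega)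
      (by simp; omega) ?_
    intro σ₁ p₁
    have f₁ := p₁.frame.1 .T (by simp) (by simp) (by simp) (by simp) (by simp)
    have s₁ := p₁.stack (σ.v .d) (by simp)
    have v₁ := p₁.e
    have v₂ := p₁.t
    have v₃ := p₁.rem
    have v₄ := p₁.d
    have v₅ := p₁.cur
    have v₆ := p₁.clk
    simp only [ne_eq, reduceCtorEq, not_false_eq_true, Function.update_of_ne, Function.update_self]
      at f₁ s₁ v₂ v₄ v₅ v₆
    rw [hT] at f₁
    -- This iteration writes the closing parenthesis and restores `cur` and `rem`, which
    -- `Parsed.stack` has kept at depth `σ.v .d`.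
    refine Term.loop_true (by simp) (by simp) (by simp [v₁, f₁]; omega) ?_
    refine Term.cond (by simp) (by simp; omega) (fun h => ?_) fun h => ?_
    swap
    · simp [St.tick, v₃] at h
    simp only [St.tick]
    refine Term.block_cons (Term.store ?_ ?_ ?_ ?_)
    · simp
    · simp
    · simp [v₅]; omega
    refine Term.block_cons (Term.store ?_ ?_ ?_ ?_)
    · simp
    · simp
    · simp [St.tick, St.setArr, v₁]; omega
    refine Term.block_cons (Term.set ?_ ?_)
    · simp [St.tick, St.setArr, v₁]; omega
    refine Term.block_cons (Term.set ?_ ?_)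
    · simp; omega
    refine Term.block_cons (Term.set ?_ ?_)
    · simp [St.tick, St.setArr, St.setVar, v₄]; omega
    refine Term.block_single (Term.set ?_ ?_)
    · simp [St.tick, St.setArr, St.setVar, v₄]; omega
    simp only [St.tick, St.setArr, St.setVar, eval, cost, ne_eq, reduceCtorEq, not_false_eq_true,
      Function.update_of_ne, Function.update_self, v₁, v₄, v₅, Nat.add_sub_cancel, s₁.1, s₁.2]
    refine ihr (e₀ := e₀ + 2 + 2 * c.size) (m := m) (fun x hx => hw x (by simp [hx]))
      (by simp only [ne_eq, reduceCtorEq, not_false_eq_true, Function.update_of_ne, v₂]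
          rwa [show σ.v .t + 2 + 2 * c.size = σ.v .t + 1 + 1 + 2 * c.size by ring])
      (by simp; omega) (by simp; omega) (by simpa using f₁) (by omega) (by simp [v₂]; omega)
      (by simp; omega) (by simp; omega) ?_
    intro σ₂ p₂
    refine hK σ₂ ?_
    have w₁ := p₂.e
    have w₂ := p₂.t
    have w₃ := p₂.rem
    have w₄ := p₂.d
    have w₅ := p₂.cur
    have w₆ := p₂.clk
    have w₇ := p₂.outside
    have w₈ := p₂.stack
    have v₇ := p₁.outside
    have v₈ := p₁.stack
    simp only [ne_eq, reduceCtorEq, not_false_eq_true, Function.update_of_ne, Function.update_self]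
      at w₂ w₄ w₅ w₆ w₇ w₈ v₇ v₈
    refine ⟨by simp only [OrdForest.size]; omega, by simp only [OrdForest.size]; omega, w₃, w₄, w₅,
      by simp only [OrdForest.size]; omega, ?_, ?_, ?_, ?_⟩
    · refine ⟨?_, ?_, ?_, ?_, p₂.repr⟩
      · rw [(w₇ e₀ (by omega)).2, (v₇ e₀ (by omega)).2]; simp
      · rw [(w₇ e₀ (by omega)).1, Function.update_of_ne (by omega), Function.update_self]
      · rw [(w₇ _ (by omega)).1, Function.update_self]
      · refine p₁.repr.congr fun x hx hx' => ?_
        rw [(w₇ x (by omega)).1, (w₇ x (by omega)).2, Function.update_of_ne (by omega),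
          Function.update_of_ne (by omega)]
        exact ⟨rfl, rfl⟩
    · intro x hx
      simp only [OrdForest.size] at hx
      rw [(w₇ x (by omega)).1, (w₇ x (by omega)).2, Function.update_of_ne (by omega),
        Function.update_of_ne (by omega), (v₇ x (by omega)).1, (v₇ x (by omega)).2,
        Function.update_of_ne (by omega)]
      exact ⟨rfl, rfl⟩
    · intro x hx
      rw [(w₈ x hx).1, (w₈ x hx).2, (v₈ x (by omega)).1, (v₈ x (by omega)).2,
        Function.update_of_ne (by omega), Function.update_of_ne (by omega)]
      exact ⟨rfl, rfl⟩
    · refine ParseFrame.trans ⟨fun x _ _ _ _ _ => ?_, fun x _ _ _ _ => ?_⟩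
        (ParseFrame.trans p₁.frame (ParseFrame.trans
        ⟨fun x _ _ _ _ _ => ?_, fun x _ _ _ _ => ?_⟩ p₂.frame))
      · simp [*]
      · simp [*]
      · simp [*]
      · simp [*]

/-- The state after the first phase. -/
structure Ready (F₁ F₂ : OrdForest ℕ) (k : ℕ) (σ : St Var Arr) : Prop where
  N : σ.v .N = F₁.size + F₂.size
  L : σ.v .L = 2 * F₁.size
  T : σ.v .T = 2 * (F₁.size + F₂.size)
  B : σ.v .B = 4 * min k (F₁.size + F₂.size)
  W : σ.v .W = 2 * (4 * min k (F₁.size + F₂.size)) + 1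
  v : σ.v .v = 0
  s : σ.v .s = 0
  id : ∀ x, σ.a .ID x = 0
  top : ∀ x, σ.a .TOP x = 0
  pairing₁ : OrdForest.IsPairing (σ.a .P) 0 (2 * F₁.size)
  pairing₂ : OrdForest.IsPairing (σ.a .P) (2 * F₁.size) (2 * (F₁.size + F₂.size))
  forest₁ : OrdForest.ofParens (σ.a .P) (σ.a .LB) 0 (2 * F₁.size) = F₁
  forest₂ : OrdForest.ofParens (σ.a .P) (σ.a .LB) (2 * F₁.size)
    (2 * (F₁.size + F₂.size)) = F₂
  root : σ.a .P 0 + 1 = 2 * F₁.size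
  clk : σ.clk ≤ 300 * (F₁.size + F₂.size) + 200

theorem prologue {E : Env} {k a₁ a₂ : ℕ} {c₁ c₂ F₁ F₂ : OrdForest ℕ}
    (hF₁ : F₁ = .cons a₁ c₁ .nil) (hF₂ : F₂ = .cons a₂ c₂ .nil)
    (hE : Bounds E (F₁.size + F₂.size)) (h₀ : E.inp 0 = k)
    (h₁ : E.inp 1 = F₁.size) (h₂ : E.inp 2 = F₂.size)
    (hin : InputAt E 3 (F₁.encode id ++ F₂.encode id))
    (hw : ∀ x ∈ F₁.encode id ++ F₂.encode id, x < E.lim) {Q : St Var Arr → Prop}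
    (hQ : ∀ σ, Ready F₁ F₂ k σ → Q σ) :
    Term E (seq initCmd parseCmd) ⟨fun _ => 0, fun _ _ => 0, 0⟩ Q := by
  have b₁ := hE.base_eq
  have b₂ := hE.base_lt
  have b₃ := hE.cap_lt
  have b₄ := hE.le_cap
  -- The two encodings in a row are the encoding of a forest with two trees. A single pass with
  -- `rem` starting at `2` parses both.
  have henc : F₁.encode id ++ F₂.encode id =
      (OrdForest.cons a₁ c₁ (.cons a₂ c₂ .nil)).encode id := by
    simp [hF₁, hF₂, OrdForest.encode]
  have hs : (OrdForest.cons a₁ c₁ (.cons a₂ c₂ .nil)).size = F₁.size + F₂.size := by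
    simp [hF₁, hF₂, OrdForest.size]
  have hs₁ : F₁.size = 1 + c₁.size := by simp [hF₁, OrdForest.size]
  rw [henc] at hin hw
  obtain ⟨n₁, e₁⟩ : ∃ n, n = F₁.size := ⟨_, rfl⟩
  obtain ⟨n₂, e₂⟩ : ∃ n, n = F₂.size := ⟨_, rfl⟩
  have hmin : min k (n₁ + n₂) ≤ n₁ + n₂ := min_le_right _ _
  rw [← e₁, ← e₂] at b₁ b₄ hs
  rw [← e₁] at h₁ hs₁
  rw [← e₂] at h₂
  have hmin' : (if k < n₁ + n₂ then k else n₁ + n₂) = min k (n₁ + n₂) := by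
    rw [min_def]; split_ifs <;> omega
  refine Term.seq ?_
  refine Term.block_cons (Term.set ?_ ?_)
  · simp [h₁, h₂]; omega
  refine Term.block_cons (Term.set ?_ ?_)
  · simp [h₁]; omega
  refine Term.block_cons (Term.set ?_ ?_)
  · simp [h₁, h₂, St.tick, St.setVar]; omega
  refine Term.block_cons (Term.set ?_ ?_)
  · simp [h₀, h₁, h₂, St.tick, St.setVar, hmin']; omega
  refine Term.block_cons (Term.set ?_ ?_)
  · simp [h₀, h₁, h₂, St.tick, St.setVar, hmin']; omega
  refine Term.block_cons (Term.set ?_ ?_)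
  · simp; omega
  refine Term.block_single (Term.set ?_ ?_)
  · simp; omega
  simp only [St.tick, St.setVar, eval, cost, Cmp.holds_lt, h₀, h₁, h₂, ne_eq, reduceCtorEq,
    not_false_eq_true, Function.update_of_ne, Function.update_self, hmin']
  refine parse_forest hE (.cons a₁ c₁ (.cons a₂ c₂ .nil)) (e₀ := 0) (m := 0) hw (by simpa using hin)
    (by simp) (by simp [OrdForest.numTrees]) (by simp [e₁, e₂]) (by omega) (by simp; omega)
    (by simp; omega) (by simp) ?_
  intro σ p
  have v₁ := p.e
  have v₂ := p.clk
  have f₁ := p.frame.1 .T (by simp) (by simp) (by simp) (by simp) (by simp)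
  have f₂ := p.frame.1 .N (by simp) (by simp) (by simp) (by simp) (by simp)
  have f₃ := p.frame.1 .L (by simp) (by simp) (by simp) (by simp) (by simp)
  have f₄ := p.frame.1 .B (by simp) (by simp) (by simp) (by simp) (by simp)
  have f₅ := p.frame.1 .W (by simp) (by simp) (by simp) (by simp) (by simp)
  have f₆ := p.frame.1 .v (by simp) (by simp) (by simp) (by simp) (by simp)
  have f₇ := p.frame.1 .s (by simp) (by simp) (by simp) (by simp) (by simp)
  have f₈ := p.frame.2 .ID (by simp) (by simp) (by simp) (by simp)
  have f₉ := p.frame.2 .TOP (by simp) (by simp) (by simp) (by simp)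
  simp only [ne_eq, reduceCtorEq, not_false_eq_true, Function.update_of_ne, Function.update_self]
    at f₁ f₂ f₃ f₄ f₅ f₆ f₇ f₈ f₉ v₂
  obtain ⟨r₁, r₂, r₃, r₄, r₅⟩ := p.repr
  have q₁ : OrdForest.Represents (σ.a .P) (σ.a .LB) F₁ 0 := by
    rw [hF₁]; exact ⟨r₁, r₂, r₃, r₄, trivial⟩
  have q₂ : OrdForest.Represents (σ.a .P) (σ.a .LB) F₂ (2 * n₁) := by
    rw [hF₂, hs₁]
    rw [show 0 + 2 + 2 * c₁.size = 2 * (1 + c₁.size) by ring] at r₅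
    exact ⟨r₅.1, r₅.2.1, r₅.2.2.1, r₅.2.2.2.1, trivial⟩
  have i₁ := q₁.isPairing
  have i₂ := q₂.isPairing
  have g₁ := q₁.ofParens_eq
  have g₂ := q₂.ofParens_eq
  rw [Nat.zero_add] at i₁ g₁
  rw [← e₂, ← Nat.mul_add] at i₂ g₂
  rw [← e₁] at i₁ g₁
  refine Term.loop_false (by simp) (by simp) (by simp [v₁, f₁]; omega) (hQ _ ?_)
  constructor
  all_goals try rw [← e₁]
  all_goals try rw [← e₂]
  all_goals try (simp [St.tick, *]; done)
  · simpa [St.tick] using i₁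
  · simpa [St.tick] using i₂
  · simpa [St.tick] using g₁
  · simpa [St.tick] using g₂
  · simp only [St.tick, r₂]
    omega
  · simp [St.tick]
    omega

end TreeEdit

/-! ### The states of the dynamic program -/

namespace OrdForest

/-- The part of the correctness of a state that is known when the state is written. -/
structure StateData.Local (p : ℕ → ℕ) (Z : StateData) (L S s : ℕ) : Prop where
  le : Z.lo s ≤ Z.hi s
  hi_le : Z.hi s ≤ L
  kind_le : Z.kind s ≤ 4
  empty : Z.kind s = 0 → Z.lo s = Z.hi s
  next_lt : Z.kind s ≠ 0 → s + 1 < S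
  skip : Z.kind s = 1 → Z.lo s < Z.hi s ∧
    ((¬(Z.lo s < p (Z.lo s) ∧ p (Z.lo s) < Z.hi s) ∧
      Z.lo (s + 1) = Z.lo s + 1 ∧ Z.hi (s + 1) = Z.hi s) ∨
    (¬(Z.lo s ≤ p (Z.hi s - 1) ∧ p (Z.hi s - 1) < Z.hi s - 1) ∧
      Z.lo (s + 1) = Z.lo s ∧ Z.hi (s + 1) = Z.hi s - 1))
  left : Z.kind s = 2 → Z.lo s < p (Z.lo s) ∧ p (Z.lo s) < Z.hi s ∧
    Z.lo (s + 1) = Z.lo s + 1 ∧ Z.hi (s + 1) = Z.hi s ∧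
    s + (p (Z.lo s) + 1 - Z.lo s) < S ∧
    Z.lo (s + (p (Z.lo s) + 1 - Z.lo s)) = p (Z.lo s) + 1 ∧
    Z.hi (s + (p (Z.lo s) + 1 - Z.lo s)) = Z.hi s
  right : Z.kind s = 3 → Z.lo s ≤ p (Z.hi s - 1) ∧ p (Z.hi s - 1) < Z.hi s - 1 ∧
    Z.lo (s + 1) = Z.lo s ∧ Z.hi (s + 1) = Z.hi s - 1 ∧
    s + (Z.hi s - p (Z.hi s - 1)) < S ∧
    Z.lo (s + (Z.hi s - p (Z.hi s - 1))) = Z.lo s ∧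
    Z.hi (s + (Z.hi s - p (Z.hi s - 1))) = p (Z.hi s - 1)
  single : Z.kind s = 4 → Z.lo s < Z.hi s - 1 ∧ p (Z.lo s) = Z.hi s - 1 ∧
    Z.lo (s + 1) = Z.lo s + 1 ∧ Z.hi (s + 1) = Z.hi s - 1

variable {p : ℕ → ℕ} {Z Z' : StateData} {top top' : ℕ → ℕ} {L S S' s v i j s₀ : ℕ}

/-- All references in `Local` stay below `S`, so appending states does not disturb it. References
through `below` are left out for this reason: they point to states yet to be written. -/
theorem StateData.Local.congr (h : Z.Local p L S s) (hs : s < S) (hS : S ≤ S')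
    (hlo : ∀ y, y < S → Z'.lo y = Z.lo y) (hhi : ∀ y, y < S → Z'.hi y = Z.hi y)
    (hk : Z'.kind s = Z.kind s) : Z'.Local p L S' s := by
  have e₁ := hlo s hs
  have e₂ := hhi s hs
  refine ⟨?_, ?_, ?_, ?_, ?_, ?_, ?_, ?_, ?_⟩
  · rw [e₁, e₂]; exact h.le
  · rw [e₂]; exact h.hi_le
  · rw [hk]; exact h.kind_le
  · rw [e₁, e₂, hk]; exact h.empty
  · rw [hk]; exact fun hc => (h.next_lt hc).trans_le hS
  · rw [e₁, e₂, hk]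
    intro hc
    have hn := h.next_lt (by omega)
    rw [hlo _ hn, hhi _ hn]
    exact h.skip hc
  · rw [e₁, e₂, hk]
    intro hc
    have hn := h.next_lt (by omega)
    have h' := h.left hc
    rw [hlo _ hn, hhi _ hn, hlo _ h'.2.2.2.2.1, hhi _ h'.2.2.2.2.1]
    exact ⟨h'.1, h'.2.1, h'.2.2.1, h'.2.2.2.1, h'.2.2.2.2.1.trans_le hS, h'.2.2.2.2.2⟩
  · rw [e₁, e₂, hk]
    intro hc
    have hn := h.next_lt (by omega)
    have h' := h.right hc
    rw [hlo _ hn, hhi _ hn, hlo _ h'.2.2.2.2.1, hhi _ h'.2.2.2.2.1]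
    exact ⟨h'.1, h'.2.1, h'.2.2.1, h'.2.2.2.1, h'.2.2.2.2.1.trans_le hS, h'.2.2.2.2.2⟩
  · rw [e₁, e₂, hk]
    intro hc
    have hn := h.next_lt (by omega)
    rw [hlo _ hn, hhi _ hn]
    exact h.single hc

/-- State `s` refers to the state that consists of the nodes below the node at `x`. -/
def StateData.Needs (p : ℕ → ℕ) (Z : StateData) (s x : ℕ) : Prop :=
  Z.kind s = 2 ∧ x = Z.lo s ∨ Z.kind s = 3 ∧ x = p (Z.hi s - 1)

/-- The state below the node at `x` has a number larger than `s`, or it will be written while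
treating one of the marked nodes from `v` on. -/
def StateData.Covered (p : ℕ → ℕ) (Z : StateData) (top : ℕ → ℕ) (v s x : ℕ) : Prop :=
  s < Z.below x ∨ ∃ r, v ≤ r ∧ top r = 1 ∧ r ≤ x ∧ x < p r

/-- The number of states that remain to be written for the marked nodes from `v` on. -/
def pending (p top : ℕ → ℕ) (L v : ℕ) : ℕ :=
  ∑ r ∈ Finset.Ico v L, if top r = 1 then stateBound (p r + 1 - r) else 0

/-- The invariant before treating position `v`; there are `s` states. -/
structure Planned (p : ℕ → ℕ) (Z : StateData) (top : ℕ → ℕ) (L v s : ℕ) : Prop where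
  loc : ∀ s', s' < s → Z.Local p L s s'
  below : ∀ x, Z.below x ≠ 0 → Z.below x < s ∧ Z.lo (Z.below x) = x + 1 ∧ Z.hi (Z.below x) = p x
  needs : ∀ s', s' < s → ∀ x, Z.Needs p s' x → Z.Covered p top v s' x
  marked : ∀ r, v ≤ r → top r = 1 → r < L ∧ r < p r
  budget : s + pending p top L v ≤ stateBound L
  root : v = 0 ∧ s = 0 ∧ top 0 = 1 ∨ 0 < v ∧ 0 < s ∧ Z.lo 0 = 0 ∧ Z.hi 0 = L

/-- The invariant while treating the marked node `v`; state `s` is the current one, consisting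
of the positions from `i` to `j`, and `s₀` is the first one for `v`. -/
structure Planning (p : ℕ → ℕ) (Z : StateData) (top : ℕ → ℕ) (L v s₀ s i j : ℕ) : Prop where
  le : i ≤ j
  le_i : v ≤ i
  lt : v < p v
  p_lt : p v < L
  j_le : j ≤ p v + 1
  begin : i = v → j = p v + 1
  pairing : IsPairing p i j
  lo : Z.lo s = i
  hi : Z.hi s = j
  s_le : s₀ ≤ s
  loc : ∀ s', s' < s → Z.Local p L (s + 1) s'
  below : ∀ x, Z.below x ≠ 0 → Z.below x ≤ s ∧ Z.lo (Z.below x) = x + 1 ∧ Z.hi (Z.below x) = p x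
  needs : ∀ s', s' < s → ∀ x, Z.Needs p s' x → Z.Covered p top (v + 1) s' x ∨
    s' < s₀ ∧ v ≤ x ∧ x < p v
  cover : ∀ x, v ≤ x → x < p v → x < p x → Z.Covered p top (v + 1) s₀ x ∨ i ≤ x ∧ x < j
  marked : ∀ r, v < r → top r = 1 → r < L ∧ r < p r
  budget : s + stateBound (j - i) + pending p top L (v + 1) ≤ stateBound L
  root : Z.lo 0 = 0 ∧ Z.hi 0 = L

theorem StateData.Local.needs (h : Z.Local p L S s) (hp : IsPairing p 0 L) {x : ℕ}
    (hx : Z.Needs p s x) : x < p x ∧ x < L := by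
  have := h.hi_le
  rcases hx with ⟨h₁, rfl⟩ | ⟨h₁, rfl⟩
  · have := h.left h₁
    omega
  · have := h.right h₁
    rw [hp.invol _ (by omega) (by omega)]
    omega

theorem StateData.Covered.mono {s s' v v' x : ℕ} (h : Z.Covered p top v s x)
    (hs : s' ≤ s ∨ s' < Z'.below x) (hv : v' ≤ v)
    (hb : Z'.below x = Z.below x ∨ s' < Z'.below x)
    (ht : ∀ r, v ≤ r → top r = 1 → top' r = 1) : Z'.Covered p top' v' s' x := by
  rcases hb with hb | hb
  · rcases h with h | ⟨r, h₁, h₂, h₃⟩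
    · left; omega
    · exact .inr ⟨r, by omega, ht r h₁ h₂, h₃⟩
  · exact .inl hb

theorem pending_succ (h : v < L) : pending p top L v =
    (if top v = 1 then stateBound (p v + 1 - v) else 0) + pending p top L (v + 1) := by
  unfold pending
  rw [Finset.sum_eq_sum_Ico_succ_bot h]

/-- An inequality suffices and is all that holds, because the node may be marked already or lie
before `v`. -/
theorem pending_update (hi : i < L) : pending p (Function.update top i 1) L v ≤
    stateBound (p i + 1 - i) + pending p top L v := by
  unfold pending
  by_cases h : i ∈ Finset.Ico v L
  · rw [← Finset.add_sum_erase _ _ h, ← Finset.add_sum_erase _ _ h]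
    simp only [Function.update_self, if_true]
    have : ∑ r ∈ (Finset.Ico v L).erase i,
        (if Function.update top i 1 r = 1 then stateBound (p r + 1 - r) else 0) =
        ∑ r ∈ (Finset.Ico v L).erase i, (if top r = 1 then stateBound (p r + 1 - r) else 0) :=
      Finset.sum_congr rfl fun r hr => by
        rw [Function.update_of_ne (Finset.ne_of_mem_erase hr)]
    omega
  · rw [Finset.sum_congr rfl (g := fun r => if top r = 1 then stateBound (p r + 1 - r) else 0)
      fun r hr => by rw [Function.update_of_ne]; rintro rfl; exact h hr]
    omega

theorem Planned.skip (h : Planned p Z top L v s) (hv : v < L) (ht : top v ≠ 1) :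
    Planned p Z top L (v + 1) s := by
  refine ⟨h.loc, h.below, fun s' hs' x hx => ?_, fun r hr => h.marked r (by omega), ?_, ?_⟩
  · rcases h.needs s' hs' x hx with h' | ⟨r, h₁, h₂, h₃⟩
    · exact .inl h'
    · refine .inr ⟨r, ?_, h₂, h₃⟩
      rcases eq_or_lt_of_le h₁ with rfl | h₁
      · exact absurd h₂ ht
      · exact h₁
  · have := h.budget
    rw [pending_succ hv, if_neg ht] at this
    omega
  · rcases h.root with ⟨rfl, -, h₃⟩ | ⟨h₁, h₂⟩
    · exact absurd h₃ ht
    · exact .inr ⟨by omega, h₂⟩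

/-- The share of `v` in `pending` becomes the budget of its interval. Promises that relied on the
mark at `v` become the second alternative in `Planning.needs`, still to be kept during this
treatment. -/
theorem Planned.start (h : Planned p Z top L v s) (hp : IsPairing p 0 L) (hp₀ : p 0 + 1 = L)
    (ht : top v = 1)
    (hlo : ∀ y, y < s → Z'.lo y = Z.lo y) (hhi : ∀ y, y < s → Z'.hi y = Z.hi y)
    (hk : ∀ y, y < s → Z'.kind y = Z.kind y) (hb : Z'.below = Z.below)
    (hlo' : Z'.lo s = v) (hhi' : Z'.hi s = p v + 1) :
    Planning p Z' top L v s s v (p v + 1) := by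
  obtain ⟨h₁, h₂⟩ := h.marked v le_rfl ht
  have h₃ := hp.mem v (by omega) h₁
  refine ⟨by omega, le_rfl, h₂, h₃.2, le_rfl, fun _ => rfl, hp.tree (by omega) h₁ h₂, hlo', hhi',
    le_rfl, ?_, ?_, ?_, fun x hx hx' _ => .inr ⟨hx, by omega⟩, fun r hr => h.marked r hr.le, ?_, ?_⟩
  · exact fun s' hs' => (h.loc s' hs').congr hs' (by omega) hlo hhi (hk s' hs')
  · intro x hx
    rw [hb] at hx ⊢
    obtain ⟨h₄, h₅, h₆⟩ := h.below x hx
    exact ⟨h₄.le, by rw [hlo _ h₄, h₅], by rw [hhi _ h₄, h₆]⟩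
  · intro s' hs' x hx
    unfold StateData.Needs at hx
    rw [hlo _ hs', hhi _ hs', hk _ hs'] at hx
    rcases h.needs s' hs' x hx with h' | ⟨r, r₁, r₂, r₃⟩
    · exact .inl (.inl (hb ▸ h'))
    · rcases eq_or_lt_of_le r₁ with rfl | r₁
      · exact .inr ⟨hs', r₃⟩
      · exact .inl (.inr ⟨r, r₁, r₂, r₃⟩)
  · have := h.budget
    rw [pending_succ h₁, if_pos ht] at this
    omega
  · rcases h.root with ⟨rfl, rfl, -⟩ | ⟨-, r₂, r₃⟩
    · exact ⟨hlo', hhi'.trans hp₀⟩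
    · rwa [hlo _ r₂, hhi _ r₂]

/-- With the interval used up, `cover` says that every node of the tree of `v` has a state below it
with a number above `s₀`, or lies under a later mark. This keeps the promises made to states before
`s₀`. -/
theorem Planning.finish (h : Planning p Z top L v s₀ s i i) (hp : IsPairing p 0 L)
    (hlo : Z'.lo = Z.lo) (hhi : Z'.hi = Z.hi)
    (hk : ∀ y, y < s → Z'.kind y = Z.kind y) (hb : Z'.below = Z.below) (hk' : Z'.kind s = 0) :
    Planned p Z' top L (v + 1) (s + 1) := by
  have hlt := h.p_lt
  have hj := h.j_le
  refine ⟨?_, ?_, ?_, h.marked, ?_, ?_⟩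
  · intro s' hs'
    rcases Nat.lt_succ_iff_lt_or_eq.mp hs' with hs' | rfl
    · exact (h.loc s' hs').congr (by omega) le_rfl (fun y _ => by rw [hlo])
        (fun y _ => by rw [hhi]) (hk s' hs')
    · refine ⟨?_, ?_, by omega, ?_, ?_, ?_, ?_, ?_, ?_⟩
      · rw [hlo, hhi, h.lo, h.hi]
      · rw [hhi, h.hi]; omega
      · intro; rw [hlo, hhi, h.lo, h.hi]
      all_goals intro hc; omega
  · intro x hx
    rw [hb] at hx ⊢
    rw [hlo, hhi]
    obtain ⟨h₁, h₂⟩ := h.below x hx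
    exact ⟨by omega, h₂⟩
  · intro s' hs' x hx
    have hx' := hx
    unfold StateData.Needs at hx
    rw [hlo, hhi] at hx
    rcases Nat.lt_succ_iff_lt_or_eq.mp hs' with hs' | rfl
    · rw [hk _ hs'] at hx
      have hc : Z.Covered p top (v + 1) s' x := by
        rcases h.needs s' hs' x hx with h' | ⟨h₁, h₂, h₃⟩
        · exact h'
        · rcases h.cover x h₂ h₃ ((h.loc s' hs').needs hp hx).1 with (h' | h') | h'
          · exact .inl (by omega)
          · exact .inr h'
          · omega
      exact hc.mono (.inl le_rfl) le_rfl (.inl (by rw [hb])) fun _ _ h => h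
    · omega
  · have := h.budget
    rw [Nat.sub_self] at this
    simp only [stateBound] at this ⊢
    omega
  · exact .inr ⟨by omega, by omega, by rw [hlo, hhi]; exact h.root⟩

/-- The state following a single tree is exactly the forest below its root, and is recorded as such.
Replacing an older record is harmless, since the new number is larger than all the earlier ones. -/
theorem Planning.singleStep (h : Planning p Z top L v s₀ s i j) (hp : IsPairing p 0 L)
    (hij : i < j) (hpi : p i = j - 1)
    (hlo : ∀ y, y ≤ s → Z'.lo y = Z.lo y) (hhi : ∀ y, y ≤ s → Z'.hi y = Z.hi y)
    (hk : ∀ y, y < s → Z'.kind y = Z.kind y) (hk' : Z'.kind s = 4)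
    (hb : Z'.below = Function.update Z.below i (s + 1))
    (hlo' : Z'.lo (s + 1) = i + 1) (hhi' : Z'.hi (s + 1) = j - 1) :
    Planning p Z' top L v s₀ (s + 1) (i + 1) (j - 1) := by
  have hlt := h.p_lt
  have hj := h.j_le
  have hs := h.s_le
  have hi := h.le_i
  have hpi' := h.pairing.lt_apply hij
  have e₁ := h.lo
  have e₂ := h.hi
  refine ⟨by omega, by omega, h.lt, h.p_lt, by omega, by omega, ?_, hlo', hhi', by omega, ?_, ?_, ?_,
    ?_, h.marked, ?_, ?_⟩
  · rw [← hpi]; exact h.pairing.inner le_rfl hij hpi'.1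
  · intro s' hs'
    rcases Nat.lt_succ_iff_lt_or_eq.mp hs' with hs' | rfl
    · exact (h.loc s' hs').congr (by omega) (by omega) (fun y _ => hlo y (by omega))
        (fun y _ => hhi y (by omega)) (hk s' hs')
    · have e₃ := hlo s' le_rfl
      have e₄ := hhi s' le_rfl
      rw [e₁] at e₃
      rw [e₂] at e₄
      refine ⟨?_, ?_, by omega, ?_, ?_, ?_, ?_, ?_, ?_⟩
      · rw [e₃, e₄]; omega
      · rw [e₄]; omega
      any_goals intro hc; omega
      intro
      rw [e₃, e₄, hlo', hhi']
      omega
  · intro x hx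
    rw [hb] at hx ⊢
    by_cases hxi : x = i
    · subst hxi
      rw [Function.update_self]
      exact ⟨le_rfl, hlo', by omega⟩
    · rw [Function.update_of_ne hxi] at hx ⊢
      obtain ⟨h₁, h₂, h₃⟩ := h.below x hx
      exact ⟨by omega, by rw [hlo _ h₁, h₂], by rw [hhi _ h₁, h₃]⟩
  · intro s' hs' x hx
    unfold StateData.Needs at hx
    rw [hlo _ (by omega), hhi _ (by omega)] at hx
    rcases Nat.lt_succ_iff_lt_or_eq.mp hs' with hs' | rfl
    · rw [hk _ hs'] at hx
      refine (h.needs s' hs' x hx).imp_left fun h' => h'.mono (.inl le_rfl) le_rfl ?_ fun _ _ h => h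
      rw [hb]
      by_cases hxi : x = i
      · subst hxi
        rw [Function.update_self]
        right; omega
      · rw [Function.update_of_ne hxi]
        exact .inl rfl
    · omega
  · intro x hx hx' hx''
    by_cases hxi : x = i
    · subst hxi
      left; left
      rw [hb, Function.update_self]
      omega
    rcases h.cover x hx hx' hx'' with h' | h'
    · refine .inl (h'.mono (.inl le_rfl) le_rfl (.inl ?_) fun _ _ h => h)
      rw [hb, Function.update_of_ne hxi]
    · refine .inr ⟨by omega, ?_⟩
      by_contra hc
      have : x = p i := by omega
      subst this
      rw [hp.invol i (by omega) (by omega)] at hx''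
      omega
  · have := stateBound_succ (j - 1 - (i + 1))
    rw [show j - 1 - (i + 1) + 2 = j - i by omega] at this
    have := h.budget
    omega
  · rw [hlo 0 (by omega), hhi 0 (by omega)]
    exact h.root

/-- The states up to `s + u` are written, one end of the interval moves: the left end if `l` is
`1`, the right end if `l` is `0`. -/
structure Emitted (Z Z' : StateData) (s i j l u : ℕ) : Prop where
  lo : ∀ y, y ≤ s → Z'.lo y = Z.lo y
  hi : ∀ y, y ≤ s → Z'.hi y = Z.hi y
  kind : ∀ y, y < s → Z'.kind y = Z.kind y
  below : Z'.below = Z.below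
  lo' : ∀ y, y ≤ u → Z'.lo (s + y) = i + l * y
  hi' : ∀ y, y ≤ u → Z'.hi (s + y) = j - (1 - l) * y

/-- While the leftmost tree is removed, an opening parenthesis yields a state of kind `2`. What
remains after matching its node is a state of the same run, further on by the length of the subtree.
A closing parenthesis has already lost its partner and is skipped. -/
theorem Emitted.local (e : Emitted Z Z' s i j 1 (p i + 1 - i)) (hp : IsPairing p 0 L)
    (hij : p i + 1 < j) (hi : i < p i) (hj : j ≤ L) {y : ℕ} (hy : y < p i + 1 - i)
    (hk : Z'.kind (s + y) = if i + y < p (i + y) then 2 else 1) :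
    Z'.Local p L (s + (p i + 1 - i) + 1) (s + y) := by
  have l₁ := e.lo' y (by omega)
  have l₂ := e.lo' (y + 1) (by omega)
  have h₁ := e.hi' y (by omega)
  have h₂ := e.hi' (y + 1) (by omega)
  have h₃ := (hp.tree (Nat.zero_le i) (by omega) hi).mem (i + y) (by omega) (by omega)
  rw [← add_assoc] at l₂ h₂
  simp only [one_mul, Nat.sub_self, zero_mul, Nat.sub_zero] at l₁ l₂ h₁ h₂
  refine ⟨by omega, by omega, by split_ifs at hk <;> omega, fun hc => by split_ifs at hk <;> omega,
    fun _ => by omega, fun hc => ?_, fun hc => ?_, fun hc => by split_ifs at hk <;> omega,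
    fun hc => by split_ifs at hk <;> omega⟩
  · rw [l₁, h₁, l₂, h₂]
    split_ifs at hk
    · omega
    · exact ⟨by omega, .inl ⟨by omega, by omega, rfl⟩⟩
  · rw [l₁, h₁, l₂, h₂]
    split_ifs at hk with h₄
    · have l₃ := e.lo' (p (i + y) + 1 - i) (by omega)
      have h₅ := e.hi' (p (i + y) + 1 - i) (by omega)
      simp only [one_mul, Nat.sub_self, zero_mul, Nat.sub_zero] at l₃ h₅
      rw [show s + y + (p (i + y) + 1 - (i + y)) = s + (p (i + y) + 1 - i) by omega, l₃, h₅]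
      omega
    · omega

/-- The reflected run: closing parentheses come first and carry the nodes, and the opening ones are
skipped. -/
theorem Emitted.local_right (e : Emitted Z Z' s i j 0 (j - p (j - 1))) (hp : IsPairing p 0 L)
    (hij : i < p (j - 1)) (hi : p (j - 1) < j - 1) (hj : j ≤ L) {y : ℕ} (hy : y < j - p (j - 1))
    (hk : Z'.kind (s + y) = if p (j - y - 1) < j - y - 1 then 3 else 1) :
    Z'.Local p L (s + (j - p (j - 1)) + 1) (s + y) := by
  have l₁ := e.lo' y (by omega)
  have l₂ := e.lo' (y + 1) (by omega)
  have h₁ := e.hi' y (by omega)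
  have h₂ := e.hi' (y + 1) (by omega)
  have h₀ := hp.invol (j - 1) (by omega) (by omega)
  have h₃ := (hp.tree (Nat.zero_le (p (j - 1))) (by omega) (by omega)).mem (j - y - 1) (by omega)
    (by omega)
  have h₆ := hp.ne (j - y - 1) (by omega) (by omega)
  rw [← add_assoc] at l₂ h₂
  rw [h₀] at h₃
  simp only [zero_mul, Nat.sub_zero, one_mul, add_zero] at l₁ l₂ h₁ h₂
  refine ⟨by omega, by omega, by split_ifs at hk <;> omega, fun hc => by split_ifs at hk <;> omega,
    fun _ => by omega, fun hc => ?_, fun hc => by split_ifs at hk <;> omega, fun hc => ?_,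
    fun hc => by split_ifs at hk <;> omega⟩
  · rw [l₁, h₁, l₂, h₂]
    split_ifs at hk
    · omega
    · exact ⟨by omega, .inr ⟨by omega, by omega, by omega⟩⟩
  · rw [l₁, h₁, l₂, h₂]
    split_ifs at hk with h₄
    · have l₃ := e.lo' (j - p (j - y - 1)) (by omega)
      have h₅ := e.hi' (j - p (j - y - 1)) (by omega)
      simp only [zero_mul, Nat.sub_zero, one_mul, add_zero] at l₃ h₅
      rw [show s + y + (j - y - p (j - y - 1)) = s + (j - p (j - y - 1)) by omega, l₃, h₅]
      omega
    · omega

/-- The leftmost tree is the smaller end tree, so it is no longer than what remains of the interval,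
as `stateBound_split` requires. Marking its root promises the states below its nodes; they get
larger numbers because the root lies to the right of `v`. -/
theorem Planning.leftStep (h : Planning p Z top L v s₀ s i j) (hp : IsPairing p 0 L)
    (hij : i < j) (hpi : p i ≠ j - 1) (hle : p i - i ≤ j - 1 - p (j - 1))
    (e : Emitted Z Z' s i j 1 (p i + 1 - i))
    (hk : ∀ y, y < p i + 1 - i → Z'.kind (s + y) = if i + y < p (i + y) then 2 else 1) :
    Planning p Z' (Function.update top i 1) L v s₀ (s + (p i + 1 - i)) (p i + 1) j := by
  have hlt := h.p_lt
  have hj := h.j_le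
  have hs := h.s_le
  have hi := h.le_i
  -- At `i = v` the interval is the whole tree of `v`, which `hpi` rules out.
  have hiv : v < i := by
    rcases eq_or_lt_of_le h.le_i with rfl | h'
    · have := h.begin rfl
      omega
    · exact h'
  have hpi' := h.pairing.lt_apply hij
  have h₁ := h.pairing.right hij
  -- The forest has at least two trees, so the last one starts behind the first one.
  have h₂ : p i + 1 ≤ p (j - 1) ∧ p (j - 1) < j - 1 := by
    have := h₁.mem (j - 1) (by omega) (by omega)
    have := h₁.ne (j - 1) (by omega) (by omega)
    omega
  have hn : ∀ s', s' < s + (p i + 1 - i) → s ≤ s' → ∃ y, y < p i + 1 - i ∧ s' = s + y :=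
    fun s' h₁ h₂ => ⟨s' - s, by omega, by omega⟩
  refine ⟨by omega, by omega, h.lt, h.p_lt, by omega, by omega, h₁, ?_, ?_, by omega, ?_, ?_, ?_,
    ?_, ?_, ?_, ?_⟩
  · have := e.lo' _ le_rfl
    omega
  · have := e.hi' _ le_rfl
    omega
  · intro s' hs'
    rcases Nat.lt_or_ge s' s with hs'' | hs''
    · exact (h.loc s' hs'').congr (by omega) (by omega) (fun y _ => e.lo y (by omega))
        (fun y _ => e.hi y (by omega)) (e.kind s' hs'')
    · obtain ⟨y, hy, rfl⟩ := hn s' hs' hs''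
      exact e.local hp (by omega) hpi'.1 (by omega) hy (hk y hy)
  · intro x hx
    rw [e.below] at hx ⊢
    obtain ⟨b₁, b₂, b₃⟩ := h.below x hx
    exact ⟨by omega, by rw [e.lo _ b₁, b₂], by rw [e.hi _ b₁, b₃]⟩
  · intro s' hs' x hx
    rcases Nat.lt_or_ge s' s with hs'' | hs''
    · unfold StateData.Needs at hx
      rw [e.lo _ hs''.le, e.hi _ hs''.le, e.kind _ hs''] at hx
      refine (h.needs s' hs'' x hx).imp_left fun h' =>
        h'.mono (.inl le_rfl) le_rfl (.inl (by rw [e.below])) fun r hr ht => ?_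
      by_cases hri : r = i
      · rw [hri, Function.update_self]
      · rwa [Function.update_of_ne hri]
    · obtain ⟨y, hy, rfl⟩ := hn s' hs' hs''
      have hk' := hk y hy
      have hl := e.lo' y (by omega)
      refine .inl (.inr ⟨i, by omega, by rw [Function.update_self], ?_⟩)
      rcases hx with ⟨c₁, c₂⟩ | ⟨c₁, c₂⟩
      · split_ifs at hk' with hc
        · have := (h.pairing.tree le_rfl hij hpi'.1).mem (i + y) (by omega) (by omega)
          omega
        · omega
      · split_ifs at hk' <;> omega
  · intro x hx hx' hx''
    rcases h.cover x hx hx' hx'' with h' | h'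
    · refine .inl (h'.mono (.inl le_rfl) le_rfl (.inl (by rw [e.below])) fun r hr ht => ?_)
      by_cases hri : r = i
      · rw [hri, Function.update_self]
      · rwa [Function.update_of_ne hri]
    · by_cases hxp : x < p i
      · exact .inl (.inr ⟨i, by omega, by rw [Function.update_self], by omega, hxp⟩)
      · refine .inr ⟨?_, by omega⟩
        by_contra hc
        have : x = p i := by omega
        subst this
        rw [hp.invol i (by omega) (by omega)] at hx''
        omega
  · intro r hr ht
    by_cases hri : r = i
    · subst hri
      omega
    · rw [Function.update_of_ne hri] at ht
      exact h.marked r hr ht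
  · have b₁ := stateBound_split (a := p i + 1 - i) (b := j - (p i + 1)) (n := j - i) (by omega)
      (by omega) (by omega)
    have b₂ := pending_update (p := p) (top := top) (v := v + 1) (i := i) (L := L) (by omega)
    have b₃ := h.budget
    omega
  · rw [e.lo 0 (by omega), e.hi 0 (by omega)]
    exact h.root

/-- The reflected step. The mark goes to the opening parenthesis `p (j - 1)`, which again lies to
the right of `v`. -/
theorem Planning.rightStep (h : Planning p Z top L v s₀ s i j) (hp : IsPairing p 0 L)
    (hij : i < j) (hpi : p i ≠ j - 1) (hle : j - 1 - p (j - 1) ≤ p i - i)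
    (e : Emitted Z Z' s i j 0 (j - p (j - 1)))
    (hk : ∀ y, y < j - p (j - 1) →
      Z'.kind (s + y) = if p (j - y - 1) < j - y - 1 then 3 else 1) :
    Planning p Z' (Function.update top (p (j - 1)) 1) L v s₀ (s + (j - p (j - 1))) i
      (p (j - 1)) := by
  have hlt := h.p_lt
  have hj := h.j_le
  have hs := h.s_le
  have hi := h.le_i
  have hiv : v < i := by
    rcases eq_or_lt_of_le h.le_i with rfl | h'
    · have := h.begin rfl
      omega
    · exact h'
  have hpi' := h.pairing.lt_apply hij
  have h₁ := h.pairing.right hij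
  have h₂ : p i + 1 ≤ p (j - 1) ∧ p (j - 1) < j - 1 := by
    have := h₁.mem (j - 1) (by omega) (by omega)
    have := h₁.ne (j - 1) (by omega) (by omega)
    omega
  have h₃ : IsPairing p i (j - 1 + 1) := by
    rw [show j - 1 + 1 = j by omega]; exact h.pairing
  have h₀ := hp.invol (j - 1) (by omega) (by omega)
  have hn : ∀ s', s' < s + (j - p (j - 1)) → s ≤ s' → ∃ y, y < j - p (j - 1) ∧ s' = s + y :=
    fun s' h₁ h₂ => ⟨s' - s, by omega, by omega⟩
  refine ⟨by omega, by omega, h.lt, h.p_lt, by omega, by omega, h₃.left (by omega), ?_, ?_,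
    by omega, ?_, ?_, ?_, ?_, ?_, ?_, ?_⟩
  · have := e.lo' _ le_rfl
    omega
  · have := e.hi' _ le_rfl
    omega
  · intro s' hs'
    rcases Nat.lt_or_ge s' s with hs'' | hs''
    · exact (h.loc s' hs'').congr (by omega) (by omega) (fun y _ => e.lo y (by omega))
        (fun y _ => e.hi y (by omega)) (e.kind s' hs'')
    · obtain ⟨y, hy, rfl⟩ := hn s' hs' hs''
      exact e.local_right hp (by omega) h₂.2 (by omega) hy (hk y hy)
  · intro x hx
    rw [e.below] at hx ⊢
    obtain ⟨b₁, b₂, b₃⟩ := h.below x hx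
    exact ⟨by omega, by rw [e.lo _ b₁, b₂], by rw [e.hi _ b₁, b₃]⟩
  · intro s' hs' x hx
    rcases Nat.lt_or_ge s' s with hs'' | hs''
    · unfold StateData.Needs at hx
      rw [e.lo _ hs''.le, e.hi _ hs''.le, e.kind _ hs''] at hx
      refine (h.needs s' hs'' x hx).imp_left fun h' =>
        h'.mono (.inl le_rfl) le_rfl (.inl (by rw [e.below])) fun r hr ht => ?_
      by_cases hri : r = p (j - 1)
      · rw [hri, Function.update_self]
      · rwa [Function.update_of_ne hri]
    · obtain ⟨y, hy, rfl⟩ := hn s' hs' hs''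
      have hk' := hk y hy
      have hl := e.hi' y (by omega)
      refine .inl (.inr ⟨p (j - 1), by omega, by rw [Function.update_self], ?_⟩)
      simp only [Nat.sub_zero, one_mul] at hl
      rw [h₀]
      rcases hx with ⟨c₁, c₂⟩ | ⟨c₁, c₂⟩
      · split_ifs at hk' <;> omega
      · rw [hl] at c₂
        split_ifs at hk' with hc
        · have := (hp.tree (Nat.zero_le (p (j - 1))) (by omega) (by omega)).mem (j - y - 1)
            (by omega) (by omega)
          omega
        · omega
  · intro x hx hx' hx''
    rcases h.cover x hx hx' hx'' with h' | h'
    · refine .inl (h'.mono (.inl le_rfl) le_rfl (.inl (by rw [e.below])) fun r hr ht => ?_)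
      by_cases hri : r = p (j - 1)
      · rw [hri, Function.update_self]
      · rwa [Function.update_of_ne hri]
    · by_cases hxp : x < p (j - 1)
      · exact .inr ⟨by omega, by omega⟩
      · refine .inl (.inr ⟨p (j - 1), by omega, by rw [Function.update_self], by omega, ?_⟩)
        by_contra hc
        have : x = j - 1 := by omega
        subst this
        omega
  · intro r hr ht
    by_cases hri : r = p (j - 1)
    · subst hri
      omega
    · rw [Function.update_of_ne hri] at ht
      exact h.marked r hr ht
  · have b₁ := stateBound_split (a := j - p (j - 1)) (b := p (j - 1) - i) (n := j - i) (by omega)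
      (by omega) (by omega)
    have b₂ := pending_update (p := p) (top := top) (v := v + 1) (i := p (j - 1)) (L := L)
      (by omega)
    rw [h₀, show j - 1 + 1 - p (j - 1) = j - p (j - 1) by omega] at b₂
    have b₃ := h.budget
    omega
  · rw [e.lo 0 (by omega), e.hi 0 (by omega)]
    exact h.root

/-- When all positions are treated no mark is left, so `Covered` can only mean that the required
state exists and has a larger number. -/
theorem Planned.ok (h : Planned p Z top L L s) (hp : IsPairing p 0 L) (hs' : S < s) :
    Z.Ok p L s S := by
  have hl := h.loc S hs'
  have key : ∀ x, Z.Needs p S x → S < Z.below x ∧ Z.below x < s ∧ Z.lo (Z.below x) = x + 1 ∧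
      Z.hi (Z.below x) = p x := by
    intro x hx
    have h' : S < Z.below x := by
      rcases h.needs S hs' x hx with h' | ⟨r, r₁, r₂, r₃⟩
      · exact h'
      · have := (h.marked r r₁ r₂).1
        omega
    exact ⟨h', h.below x (by omega)⟩
  refine ⟨hl.le, hl.hi_le, hl.kind_le, hl.empty, hl.next_lt, hl.skip, fun hk => ?_, fun hk => ?_,
    hl.single⟩
  · obtain ⟨h₁, h₂, h₃, h₄, h₅, h₆, h₇⟩ := hl.left hk
    exact ⟨h₁, h₂, h₃, h₄, h₅, h₆, h₇, key _ (.inl ⟨hk, rfl⟩)⟩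
  · obtain ⟨h₁, h₂, h₃, h₄, h₅, h₆, h₇⟩ := hl.right hk
    have := key _ (.inr ⟨hk, rfl⟩)
    have := hl.hi_le
    rw [hp.invol (Z.hi S - 1) (by omega) (by omega)] at *
    exact ⟨h₁, h₂, h₃, h₄, h₅, h₆, h₇, by assumption⟩

end OrdForest

/-! ### The program that writes the states -/

namespace TreeEdit

open Imp Exp Cmd OrdForest

/-- Writes the bounds of state `s`. -/
def writeCmds : List (Cmd Var Arr) := [store .SI (var .s) (var .i), store .SJ (var .s) (var .j)]

/-- Writes the states in which the leftmost tree is removed. -/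
def emitLeftCmd : Cmd Var Arr :=
  loop .lt (var .i) (var .m) (block (
    store .SM (var .s) (ite .lt (var .i) (arr .P (var .i)) (const 2) (const 1)) ::
    set .i (add (var .i) (const 1)) ::
    set .s (add (var .s) (const 1)) :: writeCmds))

/-- Writes the states in which the rightmost tree is removed. -/
def emitRightCmd : Cmd Var Arr :=
  loop .lt (var .m) (var .j) (block (
    store .SM (var .s) (ite .lt (arr .P (sub (var .j) (const 1))) (sub (var .j) (const 1))
      (const 3) (const 1)) ::
    set .j (sub (var .j) (const 1)) ::
    set .s (add (var .s) (const 1)) :: writeCmds))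

/-- The states of the dynamic program in memory. -/
def states (σ : St Var Arr) : StateData := ⟨σ.a .SI, σ.a .SJ, σ.a .SM, σ.a .ID⟩

/-- The states up to `s + u` have been written after the state `σ₀` of the program. -/
structure EmitInv (σ₀ : St Var Arr) (s i j l u : ℕ) (κ : ℕ → ℕ) (σ : St Var Arr) : Prop where
  vi : σ.v .i = i + l * u
  vj : σ.v .j = j - (1 - l) * u
  vs : σ.v .s = s + u
  var : ∀ x, x ≠ .i → x ≠ .j → x ≠ .s → σ.v x = σ₀.v x
  arr : ∀ x, x ≠ .SI → x ≠ .SJ → x ≠ .SM → σ.a x = σ₀.a x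
  emitted : Emitted (states σ₀) (states σ) s i j l u
  kind : ∀ y, y < u → σ.a .SM (s + y) = κ y
  clk : σ.clk ≤ σ₀.clk + 100 * u

theorem EmitInv.init {σ : St Var Arr} {s i j l : ℕ} {κ : ℕ → ℕ} (hi : σ.v .i = i)
    (hj : σ.v .j = j) (hs : σ.v .s = s) (hi' : σ.a .SI s = i) (hj' : σ.a .SJ s = j) :
    EmitInv σ s i j l 0 κ σ := by
  refine ⟨by simpa using hi, by simpa using hj, by simpa using hs, fun _ _ _ _ => rfl,
    fun _ _ _ _ => rfl, ⟨fun _ _ => rfl, fun _ _ => rfl, fun _ _ => rfl, rfl, ?_, ?_⟩, ?_, by simp⟩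
  · intro y hy
    obtain rfl : y = 0 := by omega
    simpa [states] using hi'
  · intro y hy
    obtain rfl : y = 0 := by omega
    simpa [states] using hj'
  · intro y hy
    omega

theorem EmitInv.step {σ₀ σ σ' : St Var Arr} {s i j l u : ℕ} {κ : ℕ → ℕ}
    (h : EmitInv σ₀ s i j l u κ σ)
    (vi : σ'.v .i = i + l * (u + 1)) (vj : σ'.v .j = j - (1 - l) * (u + 1))
    (vs : σ'.v .s = s + u + 1)
    (var : ∀ x, x ≠ .i → x ≠ .j → x ≠ .s → σ'.v x = σ.v x)
    (arr : ∀ x, x ≠ .SI → x ≠ .SJ → x ≠ .SM → σ'.a x = σ.a x)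
    (aSM : σ'.a .SM = Function.update (σ.a .SM) (s + u) (κ u))
    (aSI : σ'.a .SI = Function.update (σ.a .SI) (s + u + 1) (i + l * (u + 1)))
    (aSJ : σ'.a .SJ = Function.update (σ.a .SJ) (s + u + 1) (j - (1 - l) * (u + 1)))
    (clk : σ'.clk ≤ σ.clk + 100) : EmitInv σ₀ s i j l (u + 1) κ σ' := by
  have e := h.emitted
  have hc := h.clk
  have key : ∀ y, y ≤ u + 1 → y ≤ u ∨ y = u + 1 := fun y hy => by omega
  refine ⟨vi, vj, by omega, fun x a b c => (var x a b c).trans (h.var x a b c),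
    fun x a b c => (arr x a b c).trans (h.arr x a b c), ⟨?_, ?_, ?_, ?_, ?_, ?_⟩, ?_, by omega⟩
  · intro y hy
    rw [← e.lo y hy]
    simp only [states, aSI]
    rw [Function.update_of_ne (by omega)]
  · intro y hy
    rw [← e.hi y hy]
    simp only [states, aSJ]
    rw [Function.update_of_ne (by omega)]
  · intro y hy
    rw [← e.kind y hy]
    simp only [states, aSM]
    rw [Function.update_of_ne (by omega)]
  · rw [← e.below]
    exact arr .ID (by simp) (by simp) (by simp)
  · intro y hy
    simp only [states, aSI]
    rcases key y hy with hy | rfl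
    · rw [Function.update_of_ne (by omega)]
      exact e.lo' y hy
    · rw [← add_assoc, Function.update_self]
  · intro y hy
    simp only [states, aSJ]
    rcases key y hy with hy | rfl
    · rw [Function.update_of_ne (by omega)]
      exact e.hi' y hy
    · rw [← add_assoc, Function.update_self]
  · intro y hy
    rw [aSM]
    rcases Nat.lt_succ_iff_lt_or_eq.mp hy with hy | rfl
    · rw [Function.update_of_ne (by omega)]
      exact h.kind y hy
    · rw [Function.update_self]

/-- The bounds of state `s` are in memory before the loop. Each round fixes the kind of the current
state and writes the bounds of the next one, so the last state is left without a kind for the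
following step to decide. -/
theorem emit_left {E : Env} {σ₀ : St Var Arr} {s i j m : ℕ} {Q : St Var Arr → Prop}
    (hc : E.cap < E.lim) (hi : σ₀.v .i = i) (hj : σ₀.v .j = j) (hs : σ₀.v .s = s)
    (hm : σ₀.v .m = m) (hi' : σ₀.a .SI s = i) (hj' : σ₀.a .SJ s = j) (him : i ≤ m)
    (hmc : m < E.cap) (hsc : s + (m - i) < E.cap)
    (hQ : ∀ σ, EmitInv σ₀ s i j 1 (m - i)
      (fun y => if i + y < σ₀.a .P (i + y) then 2 else 1) σ → Q (σ.tick 6)) :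
    Term E emitLeftCmd σ₀ Q := by
  refine Term.loop (fun σ => ∃ u, u ≤ m - i ∧ EmitInv σ₀ s i j 1 u
      (fun y => if i + y < σ₀.a .P (i + y) then 2 else 1) σ) (fun σ => m - σ.v .i)
    ⟨0, by omega, .init hi hj hs hi' hj'⟩ (fun σ _ => by simp) ?_ ?_
  · rintro σ ⟨u, hu, h⟩ ho
    have vi := h.vi
    have vj := h.vj
    have vs := h.vs
    have vm := h.var .m (by simp) (by simp) (by simp)
    have aP := h.arr .P (by simp) (by simp) (by simp)
    rw [hm] at vm
    simp only [one_mul, Nat.sub_self, zero_mul, Nat.sub_zero] at vi vj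
    simp [vi, vm] at ho
    refine Term.block_cons (Term.store ?_ ?_ ?_ ?_)
    · simp
    · simp [St.tick, vi]; omega
    · simp [St.tick, vs]; omega
    refine Term.block_cons (Term.set ?_ ?_)
    · simp [St.tick, St.setArr, vi]; omega
    refine Term.block_cons (Term.set ?_ ?_)
    · simp [St.tick, St.setArr, St.setVar, vs]; omega
    refine Term.block_cons (Term.store ?_ ?_ ?_ ?_)
    · simp
    · simp
    · simp [St.tick, St.setArr, St.setVar, vs]; omega
    refine Term.block_single (Term.store ?_ ?_ ?_ ?_)
    · simp
    · simp
    · simp [St.tick, St.setArr, St.setVar, vs]; omega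
    simp only [St.tick, St.setArr, St.setVar, eval, cost, ne_eq, reduceCtorEq, not_false_eq_true,
      Function.update_of_ne, Function.update_self, vi, vj, vs, aP, Cmp.holds_lt]
    refine ⟨⟨u + 1, by omega, h.step ?_ ?_ ?_ ?_ ?_ ?_ ?_ ?_ ?_⟩, by omega⟩
    · simp; omega
    · simp [vj]
    · simp
    · intro x hx hx' hx''; simp [*]
    · intro x hx hx' hx''; simp [*]
    · simp
    · simp [add_assoc]
    · simp
    · simp
  · rintro σ ⟨u, hu, h⟩ ho
    have vi := h.vi
    have vm := h.var .m (by simp) (by simp) (by simp)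
    simp [vi, vm, hm] at ho
    obtain rfl : u = m - i := by omega
    exact hQ σ h

theorem emit_right {E : Env} {σ₀ : St Var Arr} {s i j m : ℕ} {Q : St Var Arr → Prop}
    (hc : E.cap < E.lim) (hi : σ₀.v .i = i) (hj : σ₀.v .j = j) (hs : σ₀.v .s = s)
    (hm : σ₀.v .m = m) (hi' : σ₀.a .SI s = i) (hj' : σ₀.a .SJ s = j) (him : m ≤ j)
    (hmc : j < E.cap) (hsc : s + (j - m) < E.cap) (hE : 4 ≤ E.cap)
    (hQ : ∀ σ, EmitInv σ₀ s i j 0 (j - m)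
      (fun y => if σ₀.a .P (j - y - 1) < j - y - 1 then 3 else 1) σ → Q (σ.tick 6)) :
    Term E emitRightCmd σ₀ Q := by
  refine Term.loop (fun σ => ∃ u, u ≤ j - m ∧ EmitInv σ₀ s i j 0 u
      (fun y => if σ₀.a .P (j - y - 1) < j - y - 1 then 3 else 1) σ) (fun σ => σ.v .j - m)
    ⟨0, by omega, .init hi hj hs hi' hj'⟩ (fun σ _ => by simp) ?_ ?_
  · rintro σ ⟨u, hu, h⟩ ho
    have vi := h.vi
    have vj := h.vj
    have vs := h.vs
    have vm := h.var .m (by simp) (by simp) (by simp)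
    have aP := h.arr .P (by simp) (by simp) (by simp)
    rw [hm] at vm
    simp only [one_mul, Nat.sub_zero, zero_mul, add_zero] at vi vj
    simp [vj, vm] at ho
    refine Term.block_cons (Term.store ?_ ?_ ?_ ?_)
    · simp
    · simp [St.tick, vj]; omega
    · simp [St.tick, vs]; omega
    refine Term.block_cons (Term.set ?_ ?_)
    · simp; omega
    refine Term.block_cons (Term.set ?_ ?_)
    · simp [St.tick, St.setArr, St.setVar, vs]; omega
    refine Term.block_cons (Term.store ?_ ?_ ?_ ?_)
    · simp
    · simp
    · simp [St.tick, St.setArr, St.setVar, vs]; omega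
    refine Term.block_single (Term.store ?_ ?_ ?_ ?_)
    · simp
    · simp
    · simp [St.tick, St.setArr, St.setVar, vs]; omega
    simp only [St.tick, St.setArr, St.setVar, eval, cost, ne_eq, reduceCtorEq, not_false_eq_true,
      Function.update_of_ne, Function.update_self, vi, vj, vs, aP, Cmp.holds_lt]
    refine ⟨⟨u + 1, by omega, h.step ?_ ?_ ?_ ?_ ?_ ?_ ?_ ?_ ?_⟩, by omega⟩
    · simp [vi]
    · simp; omega
    · simp
    · intro x hx hx' hx''; simp [*]
    · intro x hx hx' hx''; simp [*]
    · simp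
    · simp
    · simp [Nat.sub_sub]
    · simp
  · rintro σ ⟨u, hu, h⟩ ho
    have vj := h.vj
    have vm := h.var .m (by simp) (by simp) (by simp)
    simp only [Nat.sub_zero, one_mul] at vj
    simp [vj, vm, hm] at ho
    obtain rfl : u = j - m := by omega
    exact hQ σ h

/-- Treats one tree at an end of the current interval. -/
def planStepCmd : Cmd Var Arr :=
  cond .eq (arr .P (var .i)) (sub (var .j) (const 1))
    (block (
      store .ID (var .i) (add (var .s) (const 1)) ::
      store .SM (var .s) (const 4) ::
      set .i (add (var .i) (const 1)) ::
      set .j (sub (var .j) (const 1)) ::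
      set .s (add (var .s) (const 1)) :: writeCmds))
    (cond .lt (sub (sub (var .j) (const 1)) (arr .P (sub (var .j) (const 1))))
        (sub (arr .P (var .i)) (var .i))
      (block [
        set .m (arr .P (sub (var .j) (const 1))),
        store .TOP (var .m) (const 1),
        emitRightCmd])
      (block [
        set .m (add (arr .P (var .i)) (const 1)),
        store .TOP (var .i) (const 1),
        emitLeftCmd]))

/-- The invariant of the program while treating a marked node. -/
structure PlanInv (σ₀ : St Var Arr) (L v s₀ s i j : ℕ) (σ : St Var Arr) : Prop where
  plan : Planning (σ₀.a .P) (states σ) (σ.a .TOP) L v s₀ s i j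
  vi : σ.v .i = i
  vj : σ.v .j = j
  vs : σ.v .s = s
  vv : σ.v .v = v
  var : ∀ x, x ≠ .i → x ≠ .j → x ≠ .s → x ≠ .m → x ≠ .v → σ.v x = σ₀.v x
  aP : σ.a .P = σ₀.a .P
  aLB : σ.a .LB = σ₀.a .LB
  clk : σ.clk ≤ σ₀.clk + 300 * s + 300 * v + 200

theorem lt_stateBound (n : ℕ) : 2 * n < stateBound n := by
  unfold stateBound
  have : 2 * n * 1 ≤ 2 * n * (1 + Nat.log 2 n) := Nat.mul_le_mul_left _ (by omega)
  omega

/-- Bookkeeping common to the two directions. As `0 < u`, the allowance of `300` per state absorbs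
the fixed cost before and after the loop. -/
theorem PlanInv.emit {σ₀ σ σ₁ σ' : St Var Arr} {L v s₀ s i j l u i' j' m x : ℕ} {κ : ℕ → ℕ}
    (h : PlanInv σ₀ L v s₀ s i j σ) (h₁ : EmitInv σ₁ s i j l u κ σ')
    (hplan : Emitted (states σ) (states σ') s i j l u →
      (∀ y, y < u → σ'.a .SM (s + y) = κ y) →
      Planning (σ₀.a .P) (states σ') (Function.update (σ.a .TOP) x 1) L v s₀ (s + u) i' j')
    (hi : i + l * u = i') (hj : j - (1 - l) * u = j') (hu : 0 < u)
    (hv : σ₁.v = Function.update σ.v .m m)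
    (ha : σ₁.a = Function.update σ.a .TOP (Function.update (σ.a .TOP) x 1))
    (hclk : σ₁.clk ≤ σ.clk + 150) :
    PlanInv σ₀ L v s₀ (s + u) i' j' (σ'.tick 6) := by
  have hs : states σ₁ = states σ := by simp [states, ha]
  have e := h₁.emitted
  rw [hs] at e
  have c₁ := h.clk
  have c₂ := h₁.clk
  refine ⟨?_, h₁.vi.trans hi, h₁.vj.trans hj, h₁.vs, ?_, ?_, ?_, ?_, ?_⟩
  · have := hplan e h₁.kind
    rw [show (σ'.tick 6).a .TOP = _ from h₁.arr .TOP (by simp) (by simp) (by simp), ha,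
      Function.update_self]
    exact this
  · rw [show (σ'.tick 6).v .v = _ from h₁.var .v (by simp) (by simp) (by simp), hv,
      Function.update_of_ne (by simp), h.vv]
  · intro x hx₁ hx₂ hx₃ hx₄ hx₅
    rw [show (σ'.tick 6).v x = _ from h₁.var x hx₁ hx₂ hx₃, hv, Function.update_of_ne hx₄,
      h.var x hx₁ hx₂ hx₃ hx₄ hx₅]
  · rw [show (σ'.tick 6).a .P = _ from h₁.arr .P (by simp) (by simp) (by simp), ha,
      Function.update_of_ne (by simp), h.aP]
  · rw [show (σ'.tick 6).a .LB = _ from h₁.arr .LB (by simp) (by simp) (by simp), ha,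
      Function.update_of_ne (by simp), h.aLB]
  · simp only [St.tick]
    omega

/-- The inner comparison picks the smaller end tree, on which the count of the states rests; every
branch shortens the interval. -/
theorem planStep {E : Env} {σ₀ σ : St Var Arr} {L v s₀ s i j : ℕ}
    (hc : E.cap < E.lim) (hL : stateBound L + 4 ≤ E.cap) (hp : IsPairing (σ₀.a .P) 0 L)
    (h : PlanInv σ₀ L v s₀ s i j σ) (hij : i < j) :
    Term E planStepCmd (σ.tick 6) fun σ' =>
      ∃ s' i' j', j' - i' < j - i ∧ PlanInv σ₀ L v s₀ s' i' j' σ' := by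
  have plan := h.plan
  have vi := h.vi
  have vj := h.vj
  have vs := h.vs
  have aP := h.aP
  have clk := h.clk
  have b₁ := plan.budget
  have b₂ := lt_stateBound (j - i)
  have b₃ := plan.j_le
  have b₄ := plan.p_lt
  have b₅ := lt_stateBound L
  have hlo := plan.lo
  have hhi := plan.hi
  simp only [states] at hlo hhi
  have hpi := plan.pairing.lt_apply hij
  refine Term.cond ?_ ?_ (fun ho => ?_) fun ho => ?_
  · simp [St.tick, vi]; omega
  · simp; omega
  · simp [St.tick, vi, vj, aP] at ho
    refine Term.block_cons (Term.store ?_ ?_ ?_ ?_)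
    · simp
    · simp [St.tick, vs]; omega
    · simp [St.tick, vi]; omega
    refine Term.block_cons (Term.store ?_ ?_ ?_ ?_)
    · simp
    · simp; omega
    · simp [St.tick, St.setArr, vs]; omega
    refine Term.block_cons (Term.set ?_ ?_)
    · simp [St.tick, St.setArr, vi]; omega
    refine Term.block_cons (Term.set ?_ ?_)
    · simp; omega
    refine Term.block_cons (Term.set ?_ ?_)
    · simp [St.tick, St.setArr, St.setVar, vs]; omega
    refine Term.block_cons (Term.store ?_ ?_ ?_ ?_)
    · simp
    · simp
    · simp [St.tick, St.setArr, St.setVar, vs]; omega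
    refine Term.block_single (Term.store ?_ ?_ ?_ ?_)
    · simp
    · simp
    · simp [St.tick, St.setArr, St.setVar, vs]; omega
    simp only [St.tick, St.setArr, St.setVar, eval, cost, ne_eq, reduceCtorEq, not_false_eq_true,
      Function.update_of_ne, Function.update_self, vi, vj, vs]
    refine ⟨s + 1, i + 1, j - 1, by omega, ⟨?_, by simp, by simp, by simp, ?_, ?_, ?_, ?_, ?_⟩⟩
    · simp only [ne_eq, reduceCtorEq, not_false_eq_true, Function.update_of_ne]
      refine plan.singleStep hp hij ho ?_ ?_ ?_ ?_ ?_ ?_ ?_ <;>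
        simp only [states, ne_eq, reduceCtorEq, not_false_eq_true, Function.update_of_ne,
          Function.update_self]
      · intro y hy
        rw [Function.update_of_ne (by omega)]
      · intro y hy
        rw [Function.update_of_ne (by omega)]
      · intro y hy
        rw [Function.update_of_ne (by omega)]
    · simp [h.vv]
    · intro x hx₁ hx₂ hx₃ hx₄ hx₅
      simp [*, h.var x hx₁ hx₂ hx₃ hx₄ hx₅]
    · simp [h.aP]
    · simp [h.aLB]
    · simp only
      omega
  · simp [St.tick, vi, vj, aP] at ho
    have h₁ := plan.pairing.right hij
    have h₂ : σ₀.a .P i + 1 ≤ σ₀.a .P (j - 1) ∧ σ₀.a .P (j - 1) < j - 1 := by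
      have := h₁.mem (j - 1) (by omega) (by omega)
      have := h₁.ne (j - 1) (by omega) (by omega)
      omega
    refine Term.cond ?_ ?_ (fun ho' => ?_) fun ho' => ?_
    · simp [St.tick, vj]; omega
    · simp [St.tick, vi]; omega
    · simp [St.tick, vi, vj, aP] at ho'
      refine Term.block_cons (Term.set ?_ ?_)
      · simp [St.tick, vj]; omega
      refine Term.block_cons (Term.store ?_ ?_ ?_ ?_)
      · simp
      · simp; omega
      · simp [St.tick, St.setVar, vj, aP]; omega
      refine Term.block_single ?_
      simp only [St.tick, St.setArr, St.setVar, eval, cost,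
        Function.update_self, vj, aP]
      refine emit_right (i := i) (j := j) (s := s) (m := σ₀.a .P (j - 1)) hc ?_ ?_ ?_ ?_ ?_ ?_ ?_
        ?_ ?_ ?_ fun σ' he => ⟨_, _, _, ?_, h.emit (m := σ₀.a .P (j - 1)) (x := σ₀.a .P (j - 1))
          (i' := i) (j' := σ₀.a .P (j - 1)) he (fun e hk => ?_) ?_ ?_ ?_ ?_ ?_ ?_⟩
      · simp [vi]
      · simp [vj]
      · simp [vs]
      · simp
      · simpa using hlo
      · simpa using hhi
      · omega
      · omega
      · omega
      · omega
      rotate_left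
      · refine plan.rightStep hp hij ho (by omega) e fun y hy => ?_
        simp only [states, hk y hy, ne_eq, reduceCtorEq, not_false_eq_true, Function.update_of_ne,
          aP]
      · rw [zero_mul, add_zero]
      · omega
      · omega
      · rfl
      · rfl
      · simp only
        omega
      · omega
    · simp [St.tick, vi, vj, aP] at ho'
      refine Term.block_cons (Term.set ?_ ?_)
      · simp [St.tick, vi, aP]; omega
      refine Term.block_cons (Term.store ?_ ?_ ?_ ?_)
      · simp
      · simp; omega
      · simp [St.tick, St.setVar, vi]; omega
      refine Term.block_single ?_
      simp only [St.tick, St.setArr, St.setVar, eval, cost, ne_eq, reduceCtorEq, not_false_eq_true,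
        Function.update_of_ne, vi, aP]
      refine emit_left (i := i) (j := j) (s := s) (m := σ₀.a .P i + 1) hc ?_ ?_ ?_ ?_ ?_ ?_ ?_
        ?_ ?_ fun σ' he => ⟨_, _, _, ?_, h.emit (m := σ₀.a .P i + 1) (x := i)
          (i' := σ₀.a .P i + 1) (j' := j) he (fun e hk => ?_) ?_ ?_ ?_ ?_ ?_ ?_⟩
      · simp [vi]
      · simp [vj]
      · simp [vs]
      · simp
      · simpa using hlo
      · simpa using hhi
      · omega
      · omega
      · omega
      rotate_left
      · refine plan.leftStep hp hij ho (by omega) e fun y hy => ?_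
        simp only [states, hk y hy, ne_eq, reduceCtorEq, not_false_eq_true, Function.update_of_ne,
          aP]
      · omega
      · omega
      · omega
      · rfl
      · rfl
      · simp only
        omega
      · omega

/-- Treats the marked node at position `v`. -/
def planNodeCmd : Cmd Var Arr := block (
  set .i (var .v) ::
  set .j (add (arr .P (var .v)) (const 1)) ::
  store .SI (var .s) (var .i) ::
  store .SJ (var .s) (var .j) ::
  loop .lt (var .i) (var .j) planStepCmd ::
  store .SM (var .s) (const 0) ::
  [set .s (add (var .s) (const 1))])

/-- Writes the states of the dynamic program. -/
def planCmd : Cmd Var Arr := block [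
  store .TOP (const 0) (const 1),
  loop .lt (var .v) (var .L) (block [
    cond .eq (arr .TOP (var .v)) (const 1) planNodeCmd skip,
    set .v (add (var .v) (const 1))])]

/-- The invariant of the program before treating position `v`. -/
structure PlannedInv (σ₀ : St Var Arr) (L v s : ℕ) (σ : St Var Arr) : Prop where
  plan : Planned (σ₀.a .P) (states σ) (σ.a .TOP) L v s
  vs : σ.v .s = s
  vv : σ.v .v = v
  var : ∀ x, x ≠ .i → x ≠ .j → x ≠ .s → x ≠ .m → x ≠ .v → σ.v x = σ₀.v x
  aP : σ.a .P = σ₀.a .P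
  aLB : σ.a .LB = σ₀.a .LB
  clk : σ.clk ≤ σ₀.clk + 300 * s + 300 * v + 50

theorem planNode {E : Env} {σ₀ σ : St Var Arr} {L v s : ℕ}
    (hc : E.cap < E.lim) (hL : stateBound L + 4 ≤ E.cap) (hp : IsPairing (σ₀.a .P) 0 L)
    (hp₀ : σ₀.a .P 0 + 1 = L) (h : PlannedInv σ₀ L v s σ) (ht : σ.a .TOP v = 1) :
    Term E planNodeCmd (σ.tick 17) fun σ' =>
      ∃ s', Planned (σ₀.a .P) (states σ') (σ'.a .TOP) L (v + 1) s' ∧ σ'.v .s = s' ∧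
        σ'.v .v = v ∧
        (∀ x, x ≠ .i → x ≠ .j → x ≠ .s → x ≠ .m → x ≠ .v → σ'.v x = σ₀.v x) ∧
        σ'.a .P = σ₀.a .P ∧ σ'.a .LB = σ₀.a .LB ∧
        σ'.clk ≤ σ₀.clk + 300 * s' + 300 * v + 300 := by
  have b₁ := h.plan.budget
  have b₂ := lt_stateBound L
  have b₃ := h.plan.marked v le_rfl ht
  have b₄ := hp.mem v (by omega) b₃.1
  have vs := h.vs
  have vv := h.vv
  have aP := h.aP
  have clk := h.clk
  refine Term.block_cons (Term.set ?_ ?_)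
  · simp
  refine Term.block_cons (Term.set ?_ ?_)
  · simp [St.tick, St.setVar, vv, aP]; omega
  refine Term.block_cons (Term.store ?_ ?_ ?_ ?_)
  · simp
  · simp
  · simp [St.tick, St.setVar, vs]; omega
  refine Term.block_cons (Term.store ?_ ?_ ?_ ?_)
  · simp
  · simp
  · simp [St.tick, St.setVar, St.setArr, vs]; omega
  refine Term.block_cons ?_
  simp only [St.tick, St.setArr, St.setVar, eval, cost, ne_eq, reduceCtorEq, not_false_eq_true,
    Function.update_of_ne, Function.update_self, vs, vv, aP]
  refine Term.loop (fun σ' => ∃ s' i' j', PlanInv σ₀ L v s s' i' j' σ')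
    (fun σ' => σ'.v .j - σ'.v .i) ?_ (fun σ _ => by simp) ?_ ?_
  · refine ⟨s, v, σ₀.a .P v + 1, ⟨?_, by simp, by simp, by simp [vs], by simp [vv], ?_, ?_, ?_, ?_⟩⟩
    · simp only [ne_eq, reduceCtorEq, not_false_eq_true, Function.update_of_ne]
      refine h.plan.start hp hp₀ ht ?_ ?_ ?_ ?_ ?_ ?_ <;>
        simp only [states, ne_eq, reduceCtorEq, not_false_eq_true, Function.update_of_ne,
          Function.update_self, implies_true]
      · intro y hy
        rw [Function.update_of_ne (by omega)]
      · intro y hy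
        rw [Function.update_of_ne (by omega)]
    · intro x hx₁ hx₂ hx₃ hx₄ hx₅
      simp [*, h.var x hx₁ hx₂ hx₃ hx₄ hx₅]
    · simp [aP]
    · simp [h.aLB]
    · simp only
      omega
  · rintro σ' ⟨s', i', j', h'⟩ ho
    simp [h'.vi, h'.vj] at ho
    refine (planStep hc hL hp h' ho).mono ?_
    rintro σ'' ⟨s'', i'', j'', h₁, h₂⟩
    exact ⟨⟨_, _, _, h₂⟩, by rw [h'.vi, h'.vj, h₂.vi, h₂.vj]; exact h₁⟩
  · rintro σ' ⟨s', i', j', h'⟩ ho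
    simp [h'.vi, h'.vj] at ho
    have c₁ := h'.plan.le
    obtain rfl : i' = j' := by omega
    have c₂ := h'.plan.budget
    have c₃ := lt_stateBound (i' - i')
    have c₄ := h'.clk
    refine Term.block_cons (Term.store ?_ ?_ ?_ ?_)
    · simp
    · simp; omega
    · simp [St.tick, h'.vs]; omega
    refine Term.block_single (Term.set ?_ ?_)
    · simp [St.tick, St.setArr, h'.vs]; omega
    simp only [St.tick, St.setArr, St.setVar, eval, cost, ne_eq, reduceCtorEq, not_false_eq_true,
      Function.update_of_ne, Function.update_self, h'.vs]
    refine ⟨s' + 1, h'.plan.finish hp ?_ ?_ ?_ ?_ ?_, rfl, h'.vv, ?_, h'.aP, h'.aLB, by omega⟩ <;>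
      try simp only [states, ne_eq, reduceCtorEq, not_false_eq_true, Function.update_of_ne,
          Function.update_self]
    · intro y hy
      rw [Function.update_of_ne (by omega)]
    · intro x hx₁ hx₂ hx₃ hx₄ hx₅
      rw [Function.update_of_ne hx₃]
      exact h'.var x hx₁ hx₂ hx₃ hx₄ hx₅

/-- The effect of writing the states of the dynamic program. -/
structure Scheduled (σ₀ : St Var Arr) (L S : ℕ) (σ : St Var Arr) : Prop where
  ok : ∀ s, s < S → (states σ).Ok (σ₀.a .P) L S s
  pos : 0 < S
  le : S ≤ stateBound L
  lo : σ.a .SI 0 = 0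
  hi : σ.a .SJ 0 = L
  vs : σ.v .s = S
  var : ∀ x, x ≠ .i → x ≠ .j → x ≠ .s → x ≠ .m → x ≠ .v → σ.v x = σ₀.v x
  aP : σ.a .P = σ₀.a .P
  aLB : σ.a .LB = σ₀.a .LB
  clk : σ.clk ≤ σ₀.clk + 300 * S + 300 * L + 100

/-- At the outset only the root of the first tree is marked. Every other mark is set to the right of
the node being treated, so one sweep over the positions meets them all. -/
theorem plan_schedule {E : Env} {σ₀ : St Var Arr} {L : ℕ} {Q : St Var Arr → Prop}
    (hc : E.cap < E.lim) (hL : stateBound L + 4 ≤ E.cap) (hp : IsPairing (σ₀.a .P) 0 L)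
    (hp₀ : σ₀.a .P 0 + 1 = L) (hvL : σ₀.v .L = L) (hv : σ₀.v .v = 0) (hs : σ₀.v .s = 0)
    (hid : ∀ x, σ₀.a .ID x = 0) (htop : ∀ x, σ₀.a .TOP x = 0)
    (hQ : ∀ S σ, Scheduled σ₀ L S σ → Q σ) : Term E planCmd σ₀ Q := by
  have b₂ := lt_stateBound L
  have hp₁ := hp.lt_apply (by omega)
  refine Term.block_cons (Term.store ?_ ?_ ?_ ?_)
  · simp; omega
  · simp; omega
  · simp; omega
  refine Term.block_single ?_
  simp only [St.tick, St.setArr, eval, cost]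
  refine Term.loop (fun σ => ∃ v s, v ≤ L ∧ PlannedInv σ₀ L v s σ) (fun σ => L - σ.v .v)
    ?_ (fun σ _ => by simp) ?_ ?_
  · refine ⟨0, 0, by omega, ⟨⟨?_, ?_, ?_, ?_, ?_, ?_⟩, hs, hv, fun _ _ _ _ _ _ => rfl, by simp,
      by simp, by simp⟩⟩
    · intro s' hs'; omega
    · intro x hx
      simp [states, hid] at hx
    · intro s' hs'; omega
    · intro r hr hr'
      by_cases h : r = 0
      · subst h; omega
      · simp [Function.update_of_ne h, htop] at hr'
    · simp only [Function.update_self]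
      -- The tree of the only marked node has length `L`, so the initial budget is exactly the total
      -- one.
      have h₁ := pending_update (p := σ₀.a .P) (top := σ₀.a .TOP) (v := 0) (i := 0) (L := L)
        (by omega)
      have h₂ : pending (σ₀.a .P) (σ₀.a .TOP) L 0 = 0 :=
        Finset.sum_eq_zero fun r _ => by rw [if_neg (by rw [htop]; omega)]
      rw [h₂, hp₀, Nat.sub_zero] at h₁
      omega
    · left; simp
  · rintro σ ⟨v, s, hvL', h⟩ ho
    have vL := h.var .L (by simp) (by simp) (by simp) (by simp) (by simp)
    simp [h.vv, vL, hvL] at ho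
    have clk := h.clk
    refine Term.block_cons (Term.cond ?_ ?_ (fun ht => ?_) fun ht => Term.skip ?_)
    · simp [St.tick, h.vv]; omega
    · simp; omega
    · simp [St.tick, h.vv] at ht
      refine (planNode hc hL hp hp₀ h ht).mono ?_
      rintro σ' ⟨s', h₁, h₂, h₃, h₄, h₅, h₆, h₇⟩
      refine Term.block_single (Term.set ?_ ?_)
      · simp [h₃]; omega
      simp only [St.tick, St.setVar, eval, cost, Function.update_self, h₃, h.vv]
      refine ⟨⟨v + 1, s', by omega, h₁, by simpa using h₂, by simp, fun x a b c d e => ?_, h₅, h₆,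
        by simp only; omega⟩, by omega⟩
      exact (Function.update_of_ne e _ _).trans (h₄ x a b c d e)
    · simp [St.tick, h.vv] at ht
      refine Term.block_single (Term.set ?_ ?_)
      · simp [St.tick, h.vv]; omega
      simp only [St.tick, St.setVar, eval, cost, Function.update_self, h.vv]
      refine ⟨⟨v + 1, s, by omega, h.plan.skip ho ht, by simpa using h.vs, by simp,
        fun x a b c d e => ?_, h.aP, h.aLB, by simp only; omega⟩, by omega⟩
      exact (Function.update_of_ne e _ _).trans (h.var x a b c d e)
  · rintro σ ⟨v, s, hvL', h⟩ ho
    have vL := h.var .L (by simp) (by simp) (by simp) (by simp) (by simp)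
    simp [h.vv, vL, hvL] at ho
    obtain rfl : v = L := by omega
    have clk := h.clk
    have budget := h.plan.budget
    have root : 0 < s ∧ (states σ).lo 0 = 0 ∧ (states σ).hi 0 = v := by
      rcases h.plan.root with ⟨r, -⟩ | ⟨-, r⟩
      · omega
      · exact r
    exact hQ s _ ⟨fun s' hs' => h.plan.ok hp hs', root.1, by omega, root.2.1, root.2.2, h.vs, h.var,
      h.aP, h.aLB, by simp only [St.tick, cost]; omega⟩

end TreeEdit

/-! ### The banded table -/

namespace OrdForest

/-- The table entry for state `s` and the interval `[q, r)`, where entries outside of the band are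
replaced by `N`. -/
def lookup (Z : StateData) (tab : ℕ → ℕ) (L B W N s q r : ℕ) : ℕ :=
  if Z.lo s + L + B < q then N else if q + B < Z.lo s + L then N
  else if Z.hi s + L + B < r then N else if r + B < Z.hi s + L then N
  else tab ((s * W + (Z.lo s + L + B - q)) * W + (r + B - (Z.hi s + L)))

/-- The entry of the table for state `s` and the offsets `a` and `b` is correct. -/
def CellOk (p lab : ℕ → ℕ) (Z : StateData) (tab : ℕ → ℕ) (L B N s a b : ℕ) : Prop :=
  ∀ q r, q + a = Z.lo s + L + B → r + B = Z.hi s + L + b → L ≤ q → q ≤ r → r ≤ 2 * N →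
    Z.Good p lab L B s q r (tab ((s * (2 * B + 1) + a) * (2 * B + 1) + b)) ∧
      tab ((s * (2 * B + 1) + a) * (2 * B + 1) + b) ≤ N

variable {p lab : ℕ → ℕ} {Z : StateData} {tab : ℕ → ℕ} {L B N S s q r : ℕ}

/-- Outside the band one displacement alone exceeds `B`, hence so does the potential, and the upper
bound claims nothing. The lower bound holds for `N` because no distance exceeds it. -/
theorem lookup_good (hZ : Z.hi s ≤ L) (hq : L ≤ q) (hqr : q ≤ r) (hr : r ≤ 2 * N)
    (h : ∀ a b, a < 2 * B + 1 → b < 2 * B + 1 → q + a = Z.lo s + L + B → r + B = Z.hi s + L + b →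
      CellOk p lab Z tab L B N s a b) :
    Z.Good p lab L B s q r (lookup Z tab L B (2 * B + 1) N s q r) ∧
      lookup Z tab L B (2 * B + 1) N s q r ≤ N := by
  have hd : parenDist p lab (Z.lo s) (Z.hi s) q r ≤ N := parenDist_le hZ hq hqr hr
  have out : B < shift L (Z.lo s) q + shift L (Z.hi s) r →
      Z.Good p lab L B s q r N ∧ N ≤ N := fun hc =>
    ⟨⟨hd, fun h' => absurd h' (by unfold potential; omega)⟩, le_rfl⟩
  unfold lookup
  split_ifs with h₁ h₂ h₃ h₄
  · exact out (by unfold shift; omega)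
  · exact out (by unfold shift; omega)
  · exact out (by unfold shift; omega)
  · exact out (by unfold shift; omega)
  · exact h _ _ (by omega) (by omega) (by omega) (by omega) q r (by omega) (by omega) hq hqr hr

theorem CellOk.congr {tab' : ℕ → ℕ} {a b : ℕ} (h : CellOk p lab Z tab L B N s a b)
    (ht : tab' ((s * (2 * B + 1) + a) * (2 * B + 1) + b) =
      tab ((s * (2 * B + 1) + a) * (2 * B + 1) + b)) : CellOk p lab Z tab' L B N s a b := by
  unfold CellOk
  rw [ht]
  exact h

/-- The three indices are digits in base `W`, so writing one cell leaves all the other ones intact.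
-/
theorem cell_index_inj {W s a b s' a' b' : ℕ} (ha : a < W) (hb : b < W) (ha' : a' < W)
    (hb' : b' < W) (h : (s * W + a) * W + b = (s' * W + a') * W + b') :
    s = s' ∧ a = a' ∧ b = b' := by
  have key : ∀ {x y x' y' : ℕ}, y < W → y' < W → x * W + y = x' * W + y' → x = x' ∧ y = y' := by
    intro x y x' y' hy hy' e
    have e₁ := congrArg (· / W) e
    have e₂ := congrArg (· % W) e
    simp only [Nat.mul_add_mod', Nat.mod_eq_of_lt hy, Nat.mod_eq_of_lt hy'] at e₂
    subst e₂
    refine ⟨Nat.eq_of_mul_eq_mul_right (show 0 < W by omega) (by omega), rfl⟩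
  obtain ⟨h₁, h₂⟩ := key hb hb' h
  obtain ⟨h₃, h₄⟩ := key ha ha' h₁
  exact ⟨h₃, h₄, h₂⟩

theorem cell_index_lt {W S s a b : ℕ} (hs : s < S) (ha : a < W) (hb : b < W) :
    s * W + a < S * W ∧ (s * W + a) * W + b < S * W * W := by
  have h₁ : s * W + a < S * W := by
    have := Nat.mul_le_mul_right W (show s + 1 ≤ S from hs)
    rw [Nat.add_mul] at this
    omega
  have h₂ := Nat.mul_le_mul_right W (show s * W + a + 1 ≤ S * W from h₁)
  rw [Nat.add_mul _ 1] at h₂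
  exact ⟨h₁, by omega⟩

end OrdForest

/-! ### The recurrence as expressions of the program, free of overflow -/

namespace TreeEdit

open Imp Exp Cmd OrdForest

/-- The table entry for a state and an interval. -/
def getExp (s q r : Exp Var Arr) : Exp Var Arr :=
  ite .lt (add (add (arr .SI s) (var .L)) (var .B)) q (var .N)
    (ite .lt (add q (var .B)) (add (arr .SI s) (var .L)) (var .N)
      (ite .lt (add (add (arr .SJ s) (var .L)) (var .B)) r (var .N)
        (ite .lt (add r (var .B)) (add (arr .SJ s) (var .L)) (var .N)
          (arr .TAB (add (mul (add (mul s (var .W))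
            (sub (add (add (arr .SI s) (var .L)) (var .B)) q)) (var .W))
            (sub (add r (var .B)) (add (arr .SJ s) (var .L))))))))

/-- The table entries in memory. -/
def look (σ : St Var Arr) (s q r : ℕ) : ℕ :=
  lookup (states σ) (σ.a .TAB) (σ.v .L) (σ.v .B) (σ.v .W) (σ.v .N) s q r

@[simp] theorem eval_getExp (E : Env) (σ : St Var Arr) (s q r : Exp Var Arr) :
    (getExp s q r).eval E σ = look σ (s.eval E σ) (q.eval E σ) (r.eval E σ) := by
  rfl

/-- The predecessor of a number. -/
abbrev pred (e : Exp Var Arr) : Exp Var Arr := sub e (const 1)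

/-- The option to remove an end of the interval of the first tree. -/
def nextExp : Exp Var Arr :=
  ite .eq (arr .SM (var .s)) (const 0) (ite .eq (var .q) (var .r) (const 0) (var .N))
    (add (ite .eq (arr .SM (var .s)) (const 1) (const 0) (const 1))
      (getExp (add (var .s) (const 1)) (var .q) (var .r)))

/-- The option to remove the left end of the interval of the second tree. -/
def leftExp : Exp Var Arr :=
  ite .lt (var .q) (var .r)
    (add (ite .lt (var .q) (arr .P (var .q))
        (ite .lt (arr .P (var .q)) (var .r) (const 1) (const 0)) (const 0))
      (getExp (var .s) (add (var .q) (const 1)) (var .r))) (var .N)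

/-- The option to remove the right end of the interval of the second tree. -/
def rightExp : Exp Var Arr :=
  ite .lt (var .q) (var .r)
    (add (ite .lt (arr .P (pred (var .r))) (var .q) (const 0)
        (ite .lt (arr .P (pred (var .r))) (pred (var .r)) (const 1) (const 0)))
      (getExp (var .s) (var .q) (pred (var .r)))) (var .N)

/-- The option to match the leftmost roots. -/
def matchLeftExp : Exp Var Arr :=
  ite .eq (arr .SM (var .s)) (const 2) (ite .lt (var .q) (var .r)
    (ite .lt (var .q) (arr .P (var .q)) (ite .lt (arr .P (var .q)) (var .r)
      (add (add (ite .eq (arr .LB (arr .SI (var .s))) (arr .LB (var .q)) (const 0) (const 1))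
        (getExp (arr .ID (arr .SI (var .s))) (add (var .q) (const 1)) (arr .P (var .q))))
        (getExp (add (var .s)
            (sub (add (arr .P (arr .SI (var .s))) (const 1)) (arr .SI (var .s))))
          (add (arr .P (var .q)) (const 1)) (var .r)))
      (var .N)) (var .N)) (var .N)) (var .N)

/-- The option to match the rightmost roots. -/
def matchRightExp : Exp Var Arr :=
  ite .eq (arr .SM (var .s)) (const 3) (ite .lt (var .q) (var .r)
    (ite .lt (arr .P (pred (var .r))) (var .q) (var .N)
      (ite .lt (arr .P (pred (var .r))) (pred (var .r))
        (add (add (ite .eq (arr .LB (arr .P (pred (arr .SJ (var .s)))))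
            (arr .LB (arr .P (pred (var .r)))) (const 0) (const 1))
          (getExp (arr .ID (arr .P (pred (arr .SJ (var .s)))))
            (add (arr .P (pred (var .r))) (const 1)) (pred (var .r))))
          (getExp (add (var .s) (sub (arr .SJ (var .s)) (arr .P (pred (arr .SJ (var .s))))))
            (var .q) (arr .P (pred (var .r)))))
        (var .N))) (var .N)) (var .N)

/-- The option to match the roots of two trees. -/
def matchSingleExp : Exp Var Arr :=
  ite .eq (arr .SM (var .s)) (const 4) (ite .lt (var .q) (var .r)
    (ite .lt (var .q) (arr .P (var .q)) (ite .eq (arr .P (var .q)) (pred (var .r))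
      (add (ite .eq (arr .LB (arr .SI (var .s))) (arr .LB (var .q)) (const 0) (const 1))
        (getExp (add (var .s) (const 1)) (add (var .q) (const 1)) (pred (var .r))))
      (var .N)) (var .N)) (var .N)) (var .N)

section Eval

variable (E : Env) (σ : St Var Arr)

/-- The options were shaped after these expressions, so evaluation agrees with them definitionally.
-/
theorem eval_nextExp : nextExp.eval E σ =
    optNext (states σ) (σ.v .N) (look σ) (σ.v .s) (σ.v .q) (σ.v .r) := by
  rfl

theorem eval_leftExp : leftExp.eval E σ =
    optLeft (σ.a .P) (σ.v .N) (look σ) (σ.v .s) (σ.v .q) (σ.v .r) := by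
  rfl

theorem eval_rightExp : rightExp.eval E σ =
    optRight (σ.a .P) (σ.v .N) (look σ) (σ.v .s) (σ.v .q) (σ.v .r) := by
  rfl

theorem eval_matchLeftExp : matchLeftExp.eval E σ =
    optMatchLeft (σ.a .P) (σ.a .LB) (states σ) (σ.v .N) (look σ) (σ.v .s) (σ.v .q) (σ.v .r) := by
  rfl

theorem eval_matchRightExp : matchRightExp.eval E σ =
    optMatchRight (σ.a .P) (σ.a .LB) (states σ) (σ.v .N) (look σ) (σ.v .s) (σ.v .q) (σ.v .r) := by
  rfl

theorem eval_matchSingleExp : matchSingleExp.eval E σ =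
    optMatchSingle (σ.a .P) (σ.a .LB) (states σ) (σ.v .N) (look σ) (σ.v .s) (σ.v .q)
      (σ.v .r) := by
  rfl

end Eval

/-- The variables and arrays that do not change while the table is computed, and the bounds that
are needed for the computation. -/
structure TableCtx (E : Env) (S L B N : ℕ) (σ : St Var Arr) : Prop where
  vN : σ.v .N = N
  vL : σ.v .L = L
  vT : σ.v .T = 2 * N
  vB : σ.v .B = B
  vW : σ.v .W = 2 * B + 1
  L_pos : 0 < L
  L_le : L ≤ 2 * N
  B_le : B ≤ 4 * N
  pairing₁ : IsPairing (σ.a .P) 0 L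
  pairing₂ : IsPairing (σ.a .P) L (2 * N)
  ok : ∀ s, s < S → (states σ).Ok (σ.a .P) L S s
  cap_lt : E.cap < E.lim
  le_cap : 20 * (N + 1) ≤ E.cap
  table_le : S * (2 * B + 1) * (2 * B + 1) ≤ E.cap

/-- The situation in which the entry for state `s` and the interval `[q, r)` is computed. -/
structure CellCtx (E : Env) (S L B N s q r : ℕ) (σ : St Var Arr) : Prop
    extends TableCtx E S L B N σ where
  vs : σ.v .s = s
  vq : σ.v .q = q
  vr : σ.v .r = r
  s_lt : s < S
  le_q : L ≤ q
  q_le : q ≤ r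
  r_le : r ≤ 2 * N
  look_le : ∀ s' q' r', s < s' → s' < S → L ≤ q' → q' ≤ r' → r' ≤ 2 * N → look σ s' q' r' ≤ N
  look_left : q < r → look σ s (q + 1) r ≤ N
  look_right : q < r → look σ s q (r - 1) ≤ N

variable {E : Env} {S L B N s q r : ℕ} {σ : St Var Arr}

/-- The four tests come before the access, so both offsets are below `2 * B + 1` when the address is
computed, and `table_le` bounds it. -/
theorem TableCtx.safe_getExp (h : TableCtx E S L B N σ) {e f g : Exp Var Arr}
    (he : e.Safe E σ) (hf : f.Safe E σ) (hg : g.Safe E σ) (he' : e.eval E σ < S)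
    (hf' : f.eval E σ ≤ 2 * N) (hg' : g.eval E σ ≤ 2 * N) : (getExp e f g).Safe E σ := by
  have hok := h.ok _ he'
  have h₁ := hok.le
  have h₂ := hok.hi_le
  simp only [states] at h₁ h₂
  have b₁ := h.L_le
  have b₂ := h.B_le
  have b₃ := h.cap_lt
  have b₄ := h.le_cap
  have b₅ := h.table_le
  have hS : S ≤ S * (2 * B + 1) := Nat.le_mul_of_pos_right _ (by omega)
  have hS' : S * (2 * B + 1) ≤ S * (2 * B + 1) * (2 * B + 1) :=
    Nat.le_mul_of_pos_right _ (by omega)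
  simp only [getExp, Safe, eval, h.vL, h.vB, h.vW, Cmp.holds_lt, he, hf, hg, true_and,
    and_true, implies_true]
  generalize e.eval E σ = s at *
  generalize f.eval E σ = q at *
  generalize g.eval E σ = r at *
  refine ⟨by omega, fun c₁ => ⟨by omega, by omega, fun c₂ => ⟨by omega, fun c₃ =>
    ⟨by omega, by omega, fun c₄ => ?_⟩⟩⟩⟩
  have b₆ := cell_index_lt (W := 2 * B + 1) (a := σ.a .SI s + L + B - q)
    (b := r + B - (σ.a .SJ s + L)) he' (by omega) (by omega)
  generalize (s * (2 * B + 1) + (σ.a .SI s + L + B - q)) * (2 * B + 1) = y at *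
  generalize s * (2 * B + 1) = x at *
  omega

/-- Here and for the other options, sums stay small because all entries consulted are at most `N`;
`look_le`, `look_left` and `look_right` supply this. -/
theorem CellCtx.safe_nextExp (h : CellCtx E S L B N s q r σ) : nextExp.Safe E σ := by
  have hok := h.ok s h.s_lt
  have b₁ := h.L_le
  have b₃ := h.cap_lt
  have b₄ := h.le_cap
  have b₅ := h.table_le
  have b₆ := h.s_lt
  have b₇ := h.q_le
  have b₈ := h.r_le
  have b₉ := cell_index_lt (W := 2 * B + 1) (a := 0) (b := 0) b₆ (by omega) (by omega)
  have c₁ : s < E.cap := by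
    have : s ≤ s * (2 * B + 1) := Nat.le_mul_of_pos_right _ (by omega)
    have : s * (2 * B + 1) ≤ s * (2 * B + 1) * (2 * B + 1) := Nat.le_mul_of_pos_right _ (by omega)
    simp only [add_zero] at b₉
    omega
  simp only [nextExp, Safe, eval, eval_getExp, Cmp.holds_eq, h.vs, h.vq, h.vr, true_and]
  refine ⟨c₁, by omega, fun _ => ⟨fun _ => by omega, fun _ => trivial⟩, fun hk => ?_⟩
  have hn := hok.next_lt hk
  have hg := h.look_le (s + 1) q r (by omega) hn h.le_q h.q_le h.r_le
  refine ⟨⟨c₁, by omega, fun _ => by omega, fun _ => by omega⟩,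
    h.safe_getExp ⟨trivial, by simp; omega, by simp [h.vs]; omega⟩ trivial trivial
      (by simp [h.vs]; omega) (by simp [h.vq]; omega) (by simp [h.vr]; omega), ?_⟩
  split_ifs <;> omega

theorem CellCtx.s_lt_cap (h : CellCtx E S L B N s q r σ) : S ≤ E.cap := by
  have b₅ := h.table_le
  have : S ≤ S * (2 * B + 1) := Nat.le_mul_of_pos_right _ (by omega)
  have : S * (2 * B + 1) ≤ S * (2 * B + 1) * (2 * B + 1) := Nat.le_mul_of_pos_right _ (by omega)
  omega

theorem CellCtx.safe_leftExp (h : CellCtx E S L B N s q r σ) : leftExp.Safe E σ := by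
  have b₁ := h.L_le
  have b₃ := h.cap_lt
  have b₄ := h.le_cap
  have b₇ := h.q_le
  have b₈ := h.r_le
  have hg := h.look_left
  simp only [leftExp, Safe, eval, eval_getExp, Cmp.holds_lt, h.vs, h.vq, h.vr, true_and,
    and_true, implies_true]
  refine fun hqr => ⟨⟨by omega, fun _ => ⟨by omega, fun _ => by omega, fun _ => by omega⟩,
    fun _ => by omega⟩, h.safe_getExp trivial ⟨trivial, by simp; omega, by simp [h.vq]; omega⟩
      trivial (by simpa [h.vs] using h.s_lt) (by simp [h.vq]; omega) (by simp [h.vr]; omega), ?_⟩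
  have := hg hqr
  split_ifs <;> omega

theorem CellCtx.safe_rightExp (h : CellCtx E S L B N s q r σ) : rightExp.Safe E σ := by
  have b₁ := h.L_le
  have b₃ := h.cap_lt
  have b₄ := h.le_cap
  have b₇ := h.q_le
  have b₈ := h.r_le
  have hg := h.look_right
  simp only [rightExp, Safe, eval, eval_getExp, Cmp.holds_lt, h.vs, h.vq, h.vr, true_and,
    and_true, implies_true]
  refine fun hqr => ⟨⟨⟨by omega, by omega⟩, fun _ => by omega, fun _ => ⟨⟨by omega, by omega⟩,
    by omega, fun _ => by omega, fun _ => by omega⟩⟩, h.safe_getExp trivial trivial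
      ⟨trivial, by simp; omega⟩ (by simpa [h.vs] using h.s_lt) (by simp [h.vq]; omega)
      (by simp [h.vr]; omega), ?_⟩
  have := hg hqr
  split_ifs <;> omega

theorem CellCtx.safe_matchLeftExp (h : CellCtx E S L B N s q r σ) : matchLeftExp.Safe E σ := by
  have hok := h.ok s h.s_lt
  have b₁ := h.L_le
  have b₂ := h.s_lt
  have b₃ := h.cap_lt
  have b₄ := h.le_cap
  have b₅ := h.le_q
  have b₇ := h.q_le
  have b₈ := h.r_le
  have b₉ := h.s_lt_cap
  have hl := hok.left
  have hi := hok.hi_le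
  simp only [states] at hl hi
  simp only [matchLeftExp, Safe, eval, eval_getExp, Cmp.holds_lt, Cmp.holds_eq, h.vs, h.vq, h.vr,
    true_and, and_true, implies_true]
  refine ⟨by omega, by omega, fun hk hqr => ⟨by omega, fun hq => ⟨by omega, fun hq' => ?_⟩⟩⟩
  obtain ⟨l₁, l₂, l₃, l₄, l₅, l₆, l₇, l₈, l₉, l₁₀, l₁₁⟩ := hl hk
  have g₁ := h.look_le (σ.a .ID (σ.a .SI s)) (q + 1) (σ.a .P q) l₈ l₉ (by omega) (by omega)
    (by omega)
  have g₂ := h.look_le (s + (σ.a .P (σ.a .SI s) + 1 - σ.a .SI s)) (σ.a .P q + 1) r (by omega) l₅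
    (by omega) (by omega) (by omega)
  refine ⟨⟨⟨⟨by omega, by omega⟩, by omega, fun _ => by omega, fun _ => by omega⟩,
    h.safe_getExp ?_ ?_ ?_ ?_ ?_ ?_, ?_⟩, h.safe_getExp ?_ ?_ ?_ ?_ ?_ ?_, ?_⟩
  · simp [h.vs]; omega
  · simp [h.vq]; omega
  · simp [h.vq]; omega
  · simpa [h.vs] using l₉
  · simp [h.vq]; omega
  · simp [h.vq]; omega
  · split_ifs <;> omega
  · simp [h.vs]; omega
  · simp [h.vq]; omega
  · simp
  · simpa [h.vs] using l₅
  · simp [h.vq]; omega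
  · simp [h.vr]; omega
  · split_ifs <;> omega

theorem CellCtx.safe_matchRightExp (h : CellCtx E S L B N s q r σ) :
    matchRightExp.Safe E σ := by
  have hok := h.ok s h.s_lt
  have b₁ := h.L_le
  have b₂ := h.s_lt
  have b₃ := h.cap_lt
  have b₄ := h.le_cap
  have b₅ := h.le_q
  have b₇ := h.q_le
  have b₈ := h.r_le
  have b₉ := h.s_lt_cap
  have hl := hok.right
  have hi := hok.hi_le
  simp only [states] at hl hi
  simp only [matchRightExp, Safe, eval, eval_getExp, Cmp.holds_lt, Cmp.holds_eq, h.vs, h.vq, h.vr,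
    true_and, and_true, implies_true]
  refine ⟨by omega, by omega, fun hk hqr => ⟨⟨by omega, by omega⟩, fun hq =>
    ⟨⟨by omega, by omega⟩, by omega, fun hq' => ?_⟩⟩⟩
  obtain ⟨l₁, l₂, l₃, l₄, l₅, l₆, l₇, l₈, l₉, l₁₀, l₁₁⟩ := hl hk
  have g₁ := h.look_le (σ.a .ID (σ.a .P (σ.a .SJ s - 1))) (σ.a .P (r - 1) + 1) (r - 1) l₈ l₉
    (by omega) (by omega) (by omega)
  have g₂ := h.look_le (s + (σ.a .SJ s - σ.a .P (σ.a .SJ s - 1))) q (σ.a .P (r - 1)) (by omega) l₅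
    (by omega) (by omega) (by omega)
  refine ⟨⟨⟨⟨⟨⟨by omega, by omega⟩, by omega⟩, by omega⟩, ⟨⟨by omega, by omega⟩, by omega⟩,
    fun _ => by omega, fun _ => by omega⟩, h.safe_getExp ?_ ?_ ?_ ?_ ?_ ?_, ?_⟩,
    h.safe_getExp ?_ ?_ ?_ ?_ ?_ ?_, ?_⟩
  · simp [h.vs]; omega
  · simp [h.vr]; omega
  · simp; omega
  · simpa [h.vs] using l₉
  · simp [h.vr]; omega
  · simp [h.vr]; omega
  · split_ifs <;> omega
  · simp [h.vs]; omega
  · simp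
  · simp [h.vr]; omega
  · simpa [h.vs] using l₅
  · simp [h.vq]; omega
  · simp [h.vr]; omega
  · split_ifs <;> omega

theorem CellCtx.safe_matchSingleExp (h : CellCtx E S L B N s q r σ) :
    matchSingleExp.Safe E σ := by
  have hok := h.ok s h.s_lt
  have b₁ := h.L_le
  have b₂ := h.s_lt
  have b₃ := h.cap_lt
  have b₄ := h.le_cap
  have b₅ := h.le_q
  have b₇ := h.q_le
  have b₈ := h.r_le
  have b₉ := h.s_lt_cap
  have hl := hok.single
  have hi := hok.hi_le
  have hn := hok.next_lt
  simp only [states] at hl hi hn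
  simp only [matchSingleExp, Safe, eval, eval_getExp, Cmp.holds_lt, Cmp.holds_eq, h.vs, h.vq, h.vr,
    true_and, and_true, implies_true]
  refine ⟨by omega, by omega, fun hk hqr => ⟨by omega, fun hq => ⟨by omega, by omega,
    fun hq' => ?_⟩⟩⟩
  have l₁ := hl hk
  have l₂ := hn (by omega)
  have g₁ := h.look_le (s + 1) (q + 1) (r - 1) (by omega) (by omega)
    (by omega) (by omega) (by omega)
  refine ⟨⟨⟨by omega, by omega⟩, by omega, fun _ => by omega, fun _ => by omega⟩,
    h.safe_getExp ?_ ?_ ?_ ?_ ?_ ?_, ?_⟩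
  · simp [h.vs]; omega
  · simp [h.vq]; omega
  · simp; omega
  · simp [h.vs]; omega
  · simp [h.vq]; omega
  · simp [h.vr]; omega
  · split_ifs <;> omega

/-- Two states agree except for the variables `val` and `tmp`. -/
def ValFrame (σ σ' : St Var Arr) : Prop :=
  (∀ x, x ≠ .val → x ≠ .tmp → σ'.v x = σ.v x) ∧ σ'.a = σ.a

theorem TableCtx.congr {σ' : St Var Arr} (h : TableCtx E S L B N σ)
    (hv : ∀ x, x = .N ∨ x = .L ∨ x = .T ∨ x = .B ∨ x = .W → σ'.v x = σ.v x)
    (ha : ∀ x, x ≠ .TAB → σ'.a x = σ.a x) : TableCtx E S L B N σ' := by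
  have hs : states σ' = states σ := by simp [states, ha]
  have hP := ha .P (by simp)
  refine ⟨?_, ?_, ?_, ?_, ?_, h.L_pos, h.L_le, h.B_le, hP ▸ h.pairing₁, hP ▸ h.pairing₂, ?_,
    h.cap_lt, h.le_cap, h.table_le⟩
  · rw [hv _ (by simp), h.vN]
  · rw [hv _ (by simp), h.vL]
  · rw [hv _ (by simp), h.vT]
  · rw [hv _ (by simp), h.vB]
  · rw [hv _ (by simp), h.vW]
  · rw [hs, hP]
    exact h.ok

theorem ValFrame.look {σ' : St Var Arr} (h : ValFrame σ σ') : look σ' = look σ := by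
  funext s q r
  simp only [TreeEdit.look, states, h.2]
  rw [h.1 .L (by simp) (by simp), h.1 .B (by simp) (by simp), h.1 .W (by simp) (by simp),
    h.1 .N (by simp) (by simp)]

theorem ValFrame.cellCtx {σ' : St Var Arr} (hf : ValFrame σ σ') (h : CellCtx E S L B N s q r σ) :
    CellCtx E S L B N s q r σ' := by
  refine ⟨h.toTableCtx.congr (fun x hx => ?_) (fun x _ => by rw [hf.2]), ?_, ?_, ?_, h.s_lt, h.le_q,
    h.q_le, h.r_le, ?_, ?_, ?_⟩
  · rcases hx with rfl | rfl | rfl | rfl | rfl <;> exact hf.1 _ (by simp) (by simp)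
  · rw [hf.1 _ (by simp) (by simp), h.vs]
  · rw [hf.1 _ (by simp) (by simp), h.vq]
  · rw [hf.1 _ (by simp) (by simp), h.vr]
  · rw [hf.look]; exact h.look_le
  · rw [hf.look]; exact h.look_left
  · rw [hf.look]; exact h.look_right

/-- Replaces `val` by the minimum of `val` and the value of an expression. -/
def relaxCmd (e : Exp Var Arr) : Cmd Var Arr :=
  seq (set .tmp e) (set .val (minExp (var .tmp) (var .val)))

theorem relax {e : Exp Var Arr} {x : ℕ} {σ₀ : St Var Arr} {Q : St Var Arr → Prop}
    (h₀ : ValFrame σ₀ σ) (he : e.Safe E σ) (hx : e.eval E σ = x)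
    (hQ : ∀ σ', ValFrame σ₀ σ' → σ'.v .val = min (σ.v .val) x →
      σ'.clk ≤ σ.clk + (e.cost + 20) → Q σ') : Term E (relaxCmd e) σ Q := by
  refine Term.seq (Term.set he (Term.set (by simp) (hQ _ ⟨fun y hy hy' => ?_, h₀.2⟩ ?_ ?_)))
  · simp only [St.tick, St.setVar]
    rw [Function.update_of_ne hy, Function.update_of_ne hy', h₀.1 y hy hy']
  · simp only [St.tick, St.setVar, eval, Cmp.holds_lt, ne_eq, reduceCtorEq, not_false_eq_true,
      Function.update_of_ne, Function.update_self, hx]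
    split_ifs <;> omega
  · simp only [St.tick, St.setVar, cost]
    omega

/-- Computes one entry of the table. -/
def entryCmd : Cmd Var Arr := block [
  set .val (var .N),
  relaxCmd nextExp,
  relaxCmd leftExp,
  relaxCmd rightExp,
  relaxCmd matchLeftExp,
  relaxCmd matchRightExp,
  relaxCmd matchSingleExp]

/-- The time to compute one entry of the table. -/
def entryTime : ℕ := nextExp.cost + leftExp.cost + rightExp.cost + matchLeftExp.cost +
  matchRightExp.cost + matchSingleExp.cost + 124

/-- Starting from `N`, the six relaxations build the nested minimum of `entry` in the same order.
Only `val` and `tmp` change, so every option sees the same table. -/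
theorem entry_correct {Q : St Var Arr → Prop} (h : CellCtx E S L B N s q r σ)
    (hQ : ∀ σ', ValFrame σ σ' →
      σ'.v .val = entry (σ.a .P) (σ.a .LB) (states σ) N (look σ) s q r →
      σ'.clk ≤ σ.clk + entryTime → Q σ') : Term E entryCmd σ Q := by
  have hst : ∀ {σ'}, ValFrame σ σ' → states σ' = states σ := fun hf => by simp [states, hf.2]
  refine Term.block_cons (Term.set trivial ?_)
  have f₀ : ValFrame σ ((σ.setVar .val ((var .N : Exp Var Arr).eval E σ)).tick
      ((var .N : Exp Var Arr).cost + 2)) :=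
    ⟨fun x hx _ => by simp [St.tick, St.setVar, hx], rfl⟩
  refine Term.block_cons (relax f₀ (f₀.cellCtx h).safe_nextExp (eval_nextExp _ _)
    fun σ₁ f₁ v₁ c₁ => ?_)
  refine Term.block_cons (relax f₁ (f₁.cellCtx h).safe_leftExp (eval_leftExp _ _)
    fun σ₂ f₂ v₂ c₂ => ?_)
  refine Term.block_cons (relax f₂ (f₂.cellCtx h).safe_rightExp (eval_rightExp _ _)
    fun σ₃ f₃ v₃ c₃ => ?_)
  refine Term.block_cons (relax f₃ (f₃.cellCtx h).safe_matchLeftExp (eval_matchLeftExp _ _)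
    fun σ₄ f₄ v₄ c₄ => ?_)
  refine Term.block_cons (relax f₄ (f₄.cellCtx h).safe_matchRightExp (eval_matchRightExp _ _)
    fun σ₅ f₅ v₅ c₅ => ?_)
  refine Term.block_single (relax f₅ (f₅.cellCtx h).safe_matchSingleExp (eval_matchSingleExp _ _)
    fun σ₆ f₆ v₆ c₆ => hQ σ₆ f₆ ?_ ?_)
  · have e₀ : ((σ.setVar .val ((var .N : Exp Var Arr).eval E σ)).tick
      ((var .N : Exp Var Arr).cost + 2)).v .val = N := by simp [St.tick, St.setVar, h.vN]
    rw [v₆, v₅, v₄, v₃, v₂, v₁, e₀, (f₀.cellCtx h).vN, (f₁.cellCtx h).vN, (f₂.cellCtx h).vN,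
      (f₃.cellCtx h).vN, (f₄.cellCtx h).vN, (f₅.cellCtx h).vN, (f₀.cellCtx h).vs,
      (f₁.cellCtx h).vs, (f₂.cellCtx h).vs, (f₃.cellCtx h).vs, (f₄.cellCtx h).vs,
      (f₅.cellCtx h).vs, (f₀.cellCtx h).vq, (f₁.cellCtx h).vq, (f₂.cellCtx h).vq,
      (f₃.cellCtx h).vq, (f₄.cellCtx h).vq, (f₅.cellCtx h).vq, (f₀.cellCtx h).vr,
      (f₁.cellCtx h).vr, (f₂.cellCtx h).vr, (f₃.cellCtx h).vr, (f₄.cellCtx h).vr,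
      (f₅.cellCtx h).vr, f₀.look, f₁.look, f₂.look, f₃.look, f₄.look, f₅.look,
      hst f₀, hst f₃, hst f₄, hst f₅, f₁.2, f₂.2, f₃.2, f₄.2, f₅.2]
    rfl
  · simp only [St.tick, St.setVar, cost] at c₁
    unfold entryTime
    omega

end TreeEdit

/-! ### Filling the table -/

namespace TreeEdit

open Imp Exp Cmd OrdForest

/-- Computes the entry of the table for the state `s` and the offsets `a` and `b`. -/
def cellCmd : Cmd Var Arr := block [
  set .q (sub (add (add (arr .SI (var .s)) (var .L)) (var .B)) (var .a)),
  set .r (sub (add (add (arr .SJ (var .s)) (var .L)) (var .b)) (var .B)),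
  cond .lt (var .q) (var .L) skip (cond .lt (var .r) (var .q) skip
    (cond .lt (var .T) (var .r) skip (seq entryCmd
      (store .TAB (add (mul (add (mul (var .s) (var .W)) (var .a)) (var .W)) (var .b))
        (var .val)))))]

/-- Computes the table. -/
def tableCmd : Cmd Var Arr :=
  loop .lt (const 0) (var .s) (block [
    set .s (sub (var .s) (const 1)),
    set .a (const 0),
    loop .lt (var .a) (var .W) (block [
      set .b (const 0),
      loop .lt (var .b) (var .W) (block [cellCmd, set .b (add (var .b) (const 1))]),
      set .a (add (var .a) (const 1))])])

/-- The entries of the table before the one for `s`, `a`, `b` are correct. -/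
def TableDone (S L B N s a b : ℕ) (σ : St Var Arr) : Prop :=
  ∀ s' a' b', s' < S → a' < 2 * B + 1 → b' < 2 * B + 1 →
    s < s' ∨ s' = s ∧ (a' < a ∨ a' = a ∧ b' < b) →
    CellOk (σ.a .P) (σ.a .LB) (states σ) (σ.a .TAB) L B N s' a' b'

/-- The invariant of the computation of the table. -/
structure TableInv (E : Env) (σ₀ : St Var Arr) (S L B N s a b : ℕ) (σ : St Var Arr) : Prop where
  ctx : TableCtx E S L B N σ
  arr : ∀ x, x ≠ .TAB → σ.a x = σ₀.a x
  done : TableDone S L B N s a b σ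

variable {E : Env} {σ₀ σ : St Var Arr} {S L B N s a b : ℕ}

theorem TableInv.congr {σ' : St Var Arr} {s' a' b' : ℕ} (h : TableInv E σ₀ S L B N s a b σ)
    (hv : ∀ x, x = .N ∨ x = .L ∨ x = .T ∨ x = .B ∨ x = .W → σ'.v x = σ.v x) (ha : σ'.a = σ.a)
    (hd : ∀ s'' a'' b'', s'' < S → a'' < 2 * B + 1 → b'' < 2 * B + 1 →
      s' < s'' ∨ s'' = s' ∧ (a'' < a' ∨ a'' = a' ∧ b'' < b') →
      s < s'' ∨ s'' = s ∧ (a'' < a ∨ a'' = a ∧ b'' < b)) :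
    TableInv E σ₀ S L B N s' a' b' σ' := by
  refine ⟨h.ctx.congr hv fun x _ => by rw [ha], fun x hx => by rw [ha, h.arr x hx], ?_⟩
  intro s'' a'' b'' h₁ h₂ h₃ h₄
  have := h.done s'' a'' b'' h₁ h₂ h₃ (hd s'' a'' b'' h₁ h₂ h₃ h₄)
  simpa only [ha, states] using this

theorem entry_le_bound {p lab : ℕ → ℕ} {Z : StateData} {g : ℕ → ℕ → ℕ → ℕ} {q r : ℕ} :
    entry p lab Z N g s q r ≤ N := by
  unfold entry
  simp

/-- The order of the loops respects the recurrence: other states consulted have larger numbers, the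
interval `[q + 1, r)` has offset `a - 1`, and `[q, r - 1)` has offset `b - 1`. -/
theorem cell {Q : St Var Arr → Prop} (h : TableInv E σ₀ S L B N s a b σ) (hs : s < S)
    (ha : a < 2 * B + 1) (hb : b < 2 * B + 1) (vs : σ.v .s = s) (va : σ.v .a = a)
    (vb : σ.v .b = b)
    (hQ : ∀ σ', TableInv E σ₀ S L B N s a (b + 1) σ' → σ'.v .s = s → σ'.v .a = a → σ'.v .b = b →
      σ'.clk ≤ σ.clk + (entryTime + 100) → Q σ') : Term E cellCmd σ Q := by
  have ctx := h.ctx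
  have b₁ := ctx.L_le
  have b₂ := ctx.B_le
  have b₃ := ctx.cap_lt
  have b₄ := ctx.le_cap
  have b₅ := ctx.table_le
  have b₆ := ctx.L_pos
  have b₇ := cell_index_lt (W := 2 * B + 1) hs ha hb
  have hle : ∀ s', s' < S → (states σ).lo s' ≤ L ∧ (states σ).hi s' ≤ L := fun s' hs' =>
    ⟨(ctx.ok s' hs').le.trans (ctx.ok s' hs').hi_le, (ctx.ok s' hs').hi_le⟩
  have hlo : σ.a .SI s ≤ L := (hle s hs).1
  have hhi : σ.a .SJ s ≤ L := (hle s hs).2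
  have hcap : s * (2 * B + 1) ≤ s * (2 * B + 1) * (2 * B + 1) :=
    Nat.le_mul_of_pos_right _ (by omega)
  have hcap' : s ≤ s * (2 * B + 1) := Nat.le_mul_of_pos_right _ (by omega)
  have hcap'' : s * (2 * B + 1) + a ≤ (s * (2 * B + 1) + a) * (2 * B + 1) :=
    Nat.le_mul_of_pos_right _ (by omega)
  -- If one of the subtractions is truncated, the value is `0`; since `0 < L`, one of the tests then
  -- skips the cell.
  obtain ⟨q, hq⟩ : ∃ q, q = σ.a .SI s + L + B - a := ⟨_, rfl⟩
  obtain ⟨r, hr⟩ : ∃ r, r = σ.a .SJ s + L + b - B := ⟨_, rfl⟩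
  refine Term.block_cons (Term.set ?_ ?_)
  · simp [vs, ctx.vL, ctx.vB]; omega
  refine Term.block_cons (Term.set ?_ ?_)
  · simp [St.tick, St.setVar, vs, ctx.vL, ctx.vB, vb]; omega
  refine Term.block_single ?_
  simp only [St.tick, St.setVar, eval, cost, ne_eq, reduceCtorEq, not_false_eq_true,
    Function.update_of_ne, vs, va, vb, ctx.vL, ctx.vB, ← hq, ← hr]
  obtain ⟨σ₁, hσ₁⟩ : ∃ σ₁ : St Var Arr, σ₁ = ⟨Function.update (Function.update σ.v .q q) .r r, σ.a,
    σ.clk + (2 + 6 + 2 + 1 + 2 + 1 + 2 + 3 + 2) + (2 + 6 + 2 + 1 + 2 + 1 + 2 + 3 + 2)⟩ := ⟨_, rfl⟩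
  rw [← hσ₁]
  have u₁ : ∀ x, x ≠ .q → x ≠ .r → σ₁.v x = σ.v x := fun x hx hx' => by simp [hσ₁, hx, hx']
  have u₂ : σ₁.v .q = q := by simp [hσ₁]
  have u₃ : σ₁.v .r = r := by simp [hσ₁]
  have u₄ : σ₁.a = σ.a := by simp [hσ₁]
  have u₅ : σ₁.clk = σ.clk + 42 := by simp [hσ₁]
  have u₆ : states σ₁ = states σ := by simp [states, u₄]
  clear hσ₁
  have u₇ : ∀ x, x = .N ∨ x = .L ∨ x = .T ∨ x = .B ∨ x = .W → σ₁.v x = σ.v x := by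
    rintro x (rfl | rfl | rfl | rfl | rfl) <;> exact u₁ _ (by simp) (by simp)
  have ctx₁ : TableCtx E S L B N σ₁ := ctx.congr u₇ fun x _ => by rw [u₄]
  -- For offsets without a valid interval `CellOk` is vacuous, so nothing needs to be written. The
  -- three tests take `6` steps each.
  have skip : ∀ n, n ≤ 18 → ¬(L ≤ q ∧ q ≤ r ∧ r ≤ 2 * N) → Q (σ₁.tick n) := by
    intro n hn hc
    refine hQ _ ⟨ctx₁.congr (fun x _ => rfl) fun x _ => rfl, fun x hx => ?_, ?_⟩ ?_ ?_ ?_ ?_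
    · simp only [St.tick, u₄, h.arr x hx]
    · intro s' a' b' h₁ h₂ h₃ h₄
      simp only [St.tick, states, u₄]
      by_cases h₅ : s' = s ∧ a' = a ∧ b' = b
      · obtain ⟨rfl, rfl, rfl⟩ := h₅
        intro q' r' e₁ e₂ e₃ e₄ e₅
        simp only at e₁ e₂
        omega
      · exact h.done s' a' b' h₁ h₂ h₃ (by omega)
    · simp only [St.tick, u₁ _ (show Var.s ≠ .q by simp) (by simp), vs]
    · simp only [St.tick, u₁ _ (show Var.a ≠ .q by simp) (by simp), va]
    · simp only [St.tick, u₁ _ (show Var.b ≠ .q by simp) (by simp), vb]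
    · simp only [St.tick, u₅]
      omega
  refine Term.cond trivial trivial (fun c₁ => Term.skip (skip 6 (by omega) ?_)) fun c₁ => ?_
  · simp only [eval, u₂, ctx₁.vL, Cmp.holds_lt] at c₁
    omega
  refine Term.cond trivial trivial (fun c₂ => Term.skip (skip 12 (by omega) ?_)) fun c₂ => ?_
  · simp only [eval, St.tick, u₂, u₃, Cmp.holds_lt] at c₂
    omega
  refine Term.cond trivial trivial (fun c₃ => Term.skip (skip 18 (by omega) ?_)) fun c₃ => ?_
  · simp only [eval, St.tick, u₃, ctx₁.vT, Cmp.holds_lt] at c₃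
    omega
  simp only [eval, St.tick, u₂, u₃, ctx₁.vL, ctx₁.vT, Cmp.holds_lt] at c₁ c₂ c₃
  simp only [St.tick, cost]
  have ctx₂ : TableCtx E S L B N ⟨σ₁.v, σ₁.a, σ₁.clk + (2 + 2 + 2) + (2 + 2 + 2) + (2 + 2 + 2)⟩ :=
    ctx₁.congr (fun x _ => rfl) fun x _ => rfl
  have look_eq : look ⟨σ₁.v, σ₁.a, σ₁.clk + (2 + 2 + 2) + (2 + 2 + 2) + (2 + 2 + 2)⟩ =
      lookup (states σ) (σ.a .TAB) L B (2 * B + 1) N := by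
    funext s q r
    simp only [look, ctx₁.vL, ctx₁.vB, ctx₁.vW, ctx₁.vN, u₄, states]
  have good : ∀ s' q' r', s' < S → L ≤ q' → q' ≤ r' → r' ≤ 2 * N →
      (∀ a' b', a' < 2 * B + 1 → b' < 2 * B + 1 → q' + a' = (states σ).lo s' + L + B →
        r' + B = (states σ).hi s' + L + b' → s < s' ∨ s' = s ∧ (a' < a ∨ a' = a ∧ b' < b)) →
      (states σ).Good (σ.a .P) (σ.a .LB) L B s' q' r'
          (lookup (states σ) (σ.a .TAB) L B (2 * B + 1) N s' q' r') ∧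
        lookup (states σ) (σ.a .TAB) L B (2 * B + 1) N s' q' r' ≤ N := by
    intro s' q' r' h₁ h₂ h₃ h₄ h₅
    exact lookup_good (hle s' h₁).2 h₂ h₃ h₄ fun a' b' h₆ h₇ h₈ h₉ =>
      h.done s' a' b' h₁ h₆ h₇ (h₅ a' b' h₆ h₇ h₈ h₉)
  have g₁ := fun s' q' r' (h₀ : s < s') h₁ h₂ h₃ h₄ => good s' q' r' h₁ h₂ h₃ h₄
    fun _ _ _ _ _ _ => .inl h₀
  have g₂ := fun (hqr : q < r) => good s (q + 1) r hs (by omega) hqr (by omega)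
    fun a' b' _ _ h₈ h₉ => by simp only [states] at h₈ h₉; omega
  have g₃ := fun (hqr : q < r) => good s q (r - 1) hs (by omega) (by omega) (by omega)
    fun a' b' _ _ h₈ h₉ => by simp only [states] at h₈ h₉; omega
  refine Term.seq (entry_correct (s := s) (q := q) (r := r) ⟨ctx₂, ?_, u₂, u₃, hs, by omega,
    by omega, by omega, ?_, ?_, ?_⟩ fun σ₂ hf hv hc => ?_)
  · simp only [u₁ _ (show Var.s ≠ .q by simp) (by simp), vs]
  · rw [look_eq]
    exact fun s' q' r' h₀ h₁ h₂ h₃ h₄ => (g₁ s' q' r' h₀ h₁ h₂ h₃ h₄).2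
  · rw [look_eq]
    exact fun hqr => (g₂ hqr).2
  · rw [look_eq]
    exact fun hqr => (g₃ hqr).2
  have hZ : states ⟨σ₁.v, σ₁.a, σ₁.clk + (2 + 2 + 2) + (2 + 2 + 2) + (2 + 2 + 2)⟩ = states σ := u₆
  rw [look_eq, hZ] at hv
  simp only [u₄] at hv
  have hf' : σ₂.a = σ.a := hf.2.trans u₄
  have fv : ∀ x, x ≠ .val → x ≠ .tmp → x ≠ .q → x ≠ .r → σ₂.v x = σ.v x := fun x a b c d =>
    (hf.1 x a b).trans (u₁ x c d)
  have w₁ := fv .s (by simp) (by simp) (by simp) (by simp)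
  have w₂ := fv .a (by simp) (by simp) (by simp) (by simp)
  have w₃ := fv .b (by simp) (by simp) (by simp) (by simp)
  have w₄ := fv .W (by simp) (by simp) (by simp) (by simp)
  rw [vs] at w₁
  rw [va] at w₂
  rw [vb] at w₃
  rw [ctx.vW] at w₄
  refine Term.store ?_ trivial ?_ ?_
  · simp only [Safe, eval, w₁, w₂, w₃, w₄, true_and]
    omega
  · simp only [eval, w₁, w₂, w₃, w₄]
    omega
  simp only [St.tick, St.setArr, eval, cost, w₁, w₂, w₃, w₄]
  have hst : ∀ v t c, states ⟨v, Function.update σ₂.a .TAB t, c⟩ = states σ := fun v t c => by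
    simp [states, hf']
  refine hQ _ ⟨ctx.congr (fun x hx => ?_) fun x hx => ?_, fun x hx => ?_, ?_⟩ w₁ w₂ w₃ ?_
  · refine fv x ?_ ?_ ?_ ?_ <;> rcases hx with rfl | rfl | rfl | rfl | rfl <;> simp
  · simp [hx, hf']
  · simp [hx, hf', h.arr x hx]
  · intro s' a' b' h₁ h₂ h₃ h₄
    rw [hst]
    simp only [hf', ne_eq, reduceCtorEq, not_false_eq_true, Function.update_of_ne,
      Function.update_self]
    by_cases h₅ : s' = s ∧ a' = a ∧ b' = b
    · obtain ⟨rfl, rfl, rfl⟩ := h₅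
      intro q' r' e₁ e₂ e₃ e₄ e₅
      have e₆ : q' = q := by simp only [states] at e₁; omega
      have e₇ : r' = r := by simp only [states] at e₂; omega
      subst e₆ e₇
      rw [Function.update_self, hv]
      exact ⟨entry_good ctx.pairing₁ ctx.pairing₂ (ctx.ok _ h₁) e₃ e₄ e₅
        (fun s'' q'' r'' f₀ f₁ f₂ f₃ f₄ => (g₁ s'' q'' r'' f₀ f₁ f₂ f₃ f₄).1)
        (fun hqr => (g₂ hqr).1) (fun hqr => (g₃ hqr).1), entry_le_bound⟩
    · refine (h.done s' a' b' h₁ h₂ h₃ (by omega)).congr (Function.update_of_ne ?_ _ _)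
      exact fun e => h₅ (cell_index_inj h₂ h₃ ha hb e)
  · simp only at hc ⊢
    omega

theorem table_row {Q : St Var Arr → Prop} (h : TableInv E σ₀ S L B N s a 0 σ) (hs : s < S)
    (ha : a < 2 * B + 1) (vs : σ.v .s = s) (va : σ.v .a = a) (vb : σ.v .b = 0)
    (hQ : ∀ σ', TableInv E σ₀ S L B N s (a + 1) 0 σ' → σ'.v .s = s → σ'.v .a = a →
      σ'.clk ≤ σ.clk + (entryTime + 120) * (2 * B + 1) + 6 → Q σ') :
    Term E (loop .lt (var .b) (var .W) (block [cellCmd, set .b (add (var .b) (const 1))]))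
      σ Q := by
  refine Term.loop (fun σ' => ∃ b, b ≤ 2 * B + 1 ∧ TableInv E σ₀ S L B N s a b σ' ∧
    σ'.v .s = s ∧ σ'.v .a = a ∧ σ'.v .b = b ∧ σ'.clk ≤ σ.clk + (entryTime + 120) * b)
    (fun σ => 2 * B + 1 - σ.v .b) ⟨0, by omega, h, vs, va, vb, by omega⟩
    (fun _ _ => ⟨trivial, trivial⟩) ?_ ?_
  · rintro σ₁ ⟨b, hb, h₁, vs, va, vb, hc⟩ ho
    simp only [eval, Cmp.holds_lt, h₁.ctx.vW, vb] at ho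
    have b₁ := h₁.ctx.cap_lt
    have b₂ := h₁.ctx.le_cap
    have b₃ := h₁.ctx.B_le
    refine Term.block_cons (cell (σ := σ₁.tick 6) (h₁.congr (fun _ _ => rfl) rfl
      fun _ _ _ _ _ _ h => h) hs ha ho vs va vb fun σ₂ h₂ vs va vb hc₂ => ?_)
    refine Term.block_single (Term.set ?_ ?_)
    · simp [vb]; omega
    simp only [St.tick, St.setVar, eval, cost, vb] at hc₂ ⊢
    refine ⟨⟨b + 1, ho, h₂.congr ?_ rfl fun _ _ _ _ _ _ h => h, by simpa using vs,
      by simpa using va, by simp, ?_⟩, by simp; omega⟩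
    · rintro x (rfl | rfl | rfl | rfl | rfl) <;> simp
    · rw [Nat.mul_succ]
      omega
  · rintro σ₁ ⟨b, hb, h₁, vs, va, vb, hc⟩ ho
    simp only [eval, Cmp.holds_lt, h₁.ctx.vW, vb] at ho
    obtain rfl : b = 2 * B + 1 := by omega
    refine hQ _ (h₁.congr (fun _ _ => rfl) rfl fun _ _ _ _ _ _ _ => by omega) vs va ?_
    simp only [St.tick, cost]
    omega

theorem table_state {Q : St Var Arr → Prop} (h : TableInv E σ₀ S L B N s 0 0 σ) (hs : s < S)
    (vs : σ.v .s = s) (va : σ.v .a = 0)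
    (hQ : ∀ σ', TableInv E σ₀ S L B N s (2 * B + 1) 0 σ' → σ'.v .s = s →
      σ'.clk ≤ σ.clk + ((entryTime + 120) * (2 * B + 1) + 40) * (2 * B + 1) + 6 → Q σ') :
    Term E (loop .lt (var .a) (var .W) (block [
      set .b (const 0),
      loop .lt (var .b) (var .W) (block [cellCmd, set .b (add (var .b) (const 1))]),
      set .a (add (var .a) (const 1))])) σ Q := by
  refine Term.loop (fun σ' => ∃ a, a ≤ 2 * B + 1 ∧ TableInv E σ₀ S L B N s a 0 σ' ∧
    σ'.v .s = s ∧ σ'.v .a = a ∧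
    σ'.clk ≤ σ.clk + ((entryTime + 120) * (2 * B + 1) + 40) * a)
    (fun σ => 2 * B + 1 - σ.v .a) ⟨0, by omega, h, vs, va, by omega⟩
    (fun _ _ => ⟨trivial, trivial⟩) ?_ ?_
  · rintro σ₁ ⟨a, ha, h₁, vs, va, hc⟩ ho
    simp only [eval, Cmp.holds_lt, h₁.ctx.vW, va] at ho
    have b₁ := h₁.ctx.cap_lt
    have b₂ := h₁.ctx.le_cap
    have b₃ := h₁.ctx.B_le
    refine Term.block_cons (Term.set ?_ ?_)
    · simp; omega
    simp only [St.tick, St.setVar, eval, cost]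
    refine Term.block_cons (table_row (h₁.congr ?_ rfl fun _ _ _ _ _ _ h => h) hs ho
      (by simpa using vs) (by simpa using va) (by simp) fun σ₂ h₂ vs va hc₂ => ?_)
    · rintro x (rfl | rfl | rfl | rfl | rfl) <;> simp
    refine Term.block_single (Term.set ?_ ?_)
    · simp [va]; omega
    simp only [St.tick, St.setVar, eval, cost, va] at hc₂ ⊢
    refine ⟨⟨a + 1, ho, h₂.congr ?_ rfl fun _ _ _ _ _ _ h => h, by simpa using vs, by simp, ?_⟩,
      by simp; omega⟩
    · rintro x (rfl | rfl | rfl | rfl | rfl) <;> simp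
    · rw [Nat.mul_succ]
      omega
  · rintro σ₁ ⟨a, ha, h₁, vs, va, hc⟩ ho
    simp only [eval, Cmp.holds_lt, h₁.ctx.vW, va] at ho
    obtain rfl : a = 2 * B + 1 := by omega
    refine hQ _ (h₁.congr (fun _ _ => rfl) rfl fun _ _ _ _ _ _ h => h) vs ?_
    simp only [St.tick, cost]
    omega

/-- The states are treated from the last one down, as references go upwards. A finished state is
expressed by the offsets `2 * B + 1` and `0`, which at `s = S` makes the invariant hold trivially.
-/
theorem table {Q : St Var Arr → Prop} (h : TableCtx E S L B N σ) (vs : σ.v .s = S)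
    (hQ : ∀ σ', TableInv E σ S L B N 0 (2 * B + 1) 0 σ' →
      σ'.clk ≤ σ.clk + (((entryTime + 120) * (2 * B + 1) + 40) * (2 * B + 1) + 40) * S + 6 →
      Q σ') : Term E tableCmd σ Q := by
  have b₁ := h.cap_lt
  have b₂ := h.le_cap
  refine Term.loop (fun σ' => ∃ s, s ≤ S ∧ TableInv E σ S L B N s (2 * B + 1) 0 σ' ∧
    σ'.v .s = s ∧
    σ'.clk ≤ σ.clk + (((entryTime + 120) * (2 * B + 1) + 40) * (2 * B + 1) + 40) * (S - s))
    (fun σ => σ.v .s)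
    ⟨S, le_rfl, ⟨h, fun _ _ => rfl, fun _ _ _ h₁ _ _ h₂ => by omega⟩, vs, by omega⟩
    (fun _ _ => ⟨by simp; omega, trivial⟩) ?_ ?_
  · rintro σ₁ ⟨s, hs, h₁, vs, hc⟩ ho
    simp only [eval, Cmp.holds_lt, vs] at ho
    refine Term.block_cons (Term.set ?_ ?_)
    · simp; omega
    refine Term.block_cons (Term.set ?_ ?_)
    · simp; omega
    simp only [St.tick, St.setVar, eval, cost, vs]
    refine Term.block_single (table_state (s := s - 1) (h₁.congr ?_ rfl
      fun _ _ _ _ _ _ h => by omega) (by omega)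
      (by simp) (by simp) fun σ₂ h₂ vs' hc₂ => ?_)
    · rintro x (rfl | rfl | rfl | rfl | rfl) <;> simp
    refine ⟨⟨s - 1, by omega, h₂, vs', ?_⟩, by omega⟩
    rw [show S - (s - 1) = S - s + 1 by omega, Nat.mul_succ]
    simp only at hc₂
    omega
  · rintro σ₁ ⟨s, hs, h₁, vs, hc⟩ ho
    simp only [eval, Cmp.holds_lt, vs] at ho
    obtain rfl : s = 0 := by omega
    refine hQ _ (h₁.congr (fun _ _ => rfl) rfl fun _ _ _ _ _ _ h => h) ?_
    rw [Nat.sub_zero] at hc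
    simp only [St.tick, cost]
    omega

/-! ### Correctness and running time of the whole program -/

/-- Reads off the result. -/
def resultCmd : Cmd Var Arr := set .res (getExp (const 0) (var .L) (var .T))

/-- The whole program. -/
def mainCmd : Cmd Var Arr :=
  seq (seq initCmd parseCmd) (seq planCmd (seq tableCmd resultCmd))

/-- The time for the main program, where `S` bounds the number of states. -/
def mainTime (S N B : ℕ) : ℕ :=
  (((entryTime + 120) * (2 * B + 1) + 40) * (2 * B + 1) + 40) * S + 300 * S + 900 * N +
    ((getExp (const 0) (var .L) (var .T)).cost + 400)

/-- Justifies cutting `k` off at the total size, which keeps the table within memory however large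
`k` is. -/
theorem editDist_le_bound {F₁ F₂ : OrdForest ℕ} {k : ℕ} (h : F₁.editDist F₂ ≤ k) :
    F₁.editDist F₂ ≤ min k (F₁.size + F₂.size) :=
  le_min h (OrdForest.editDist_le_size _ _)

theorem main_correct {E : Env} {k a₁ a₂ : ℕ} {c₁ c₂ F₁ F₂ : OrdForest ℕ}
    (hF₁ : F₁ = .cons a₁ c₁ .nil) (hF₂ : F₂ = .cons a₂ c₂ .nil)
    (hE : Bounds E (F₁.size + F₂.size))
    (hcap : stateBound (2 * F₁.size) * (2 * (4 * min k (F₁.size + F₂.size)) + 1) *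
      (2 * (4 * min k (F₁.size + F₂.size)) + 1) + 4 ≤ E.cap) (h₀ : E.inp 0 = k)
    (h₁ : E.inp 1 = F₁.size) (h₂ : E.inp 2 = F₂.size)
    (hin : InputAt E 3 (F₁.encode id ++ F₂.encode id))
    (hw : ∀ x ∈ F₁.encode id ++ F₂.encode id, x < E.lim) (hk : F₁.editDist F₂ ≤ k) :
    Term E mainCmd ⟨fun _ => 0, fun _ _ => 0, 0⟩ fun σ => σ.v .res = F₁.editDist F₂ ∧
      σ.clk ≤ mainTime (stateBound (2 * F₁.size)) (F₁.size + F₂.size)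
        (4 * min k (F₁.size + F₂.size)) := by
  refine Term.seq (prologue hF₁ hF₂ hE h₀ h₁ h₂ hin hw fun σ₁ r₁ => ?_)
  have hs₁ : 0 < F₁.size := by rw [hF₁, OrdForest.size]; omega
  have hmin := min_le_right k (F₁.size + F₂.size)
  have hed := editDist_le_bound hk
  have hsz := OrdForest.size_le_add_editDist F₁ F₂
  have hsz' := OrdForest.size_le_add_editDist' F₁ F₂
  generalize hm : min k (F₁.size + F₂.size) = m at *
  obtain ⟨B, hB⟩ : ∃ B, B = 4 * m := ⟨_, rfl⟩
  rw [← hB] at hcap ⊢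
  have hcap' : stateBound (2 * F₁.size) + 4 ≤ E.cap := by
    have := Nat.le_mul_of_pos_right (stateBound (2 * F₁.size)) (show 0 < 2 * B + 1 by omega)
    have := Nat.le_mul_of_pos_right (stateBound (2 * F₁.size) * (2 * B + 1))
      (show 0 < 2 * B + 1 by omega)
    omega
  refine Term.seq (plan_schedule hE.cap_lt hcap' r₁.pairing₁ r₁.root r₁.L r₁.v r₁.s r₁.id r₁.top
    fun S σ₂ r₂ => ?_)
  have var : ∀ x, x = .N ∨ x = .L ∨ x = .T ∨ x = .B ∨ x = .W → σ₂.v x = σ₁.v x := by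
    rintro x (rfl | rfl | rfl | rfl | rfl) <;>
      exact r₂.var _ (by simp) (by simp) (by simp) (by simp) (by simp)
  have ctx : TableCtx E S (2 * F₁.size) B (F₁.size + F₂.size) σ₂ := by
    refine ⟨?_, ?_, ?_, ?_, ?_, by omega, by omega, by omega, ?_, ?_, ?_, hE.cap_lt, hE.le_cap, ?_⟩
    · rw [var _ (by simp), r₁.N]
    · rw [var _ (by simp), r₁.L]
    · rw [var _ (by simp), r₁.T]
    · rw [var _ (by simp), r₁.B, hm, hB]
    · rw [var _ (by simp), r₁.W, hm, hB]
    · rw [r₂.aP]; exact r₁.pairing₁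
    · rw [r₂.aP]; exact r₁.pairing₂
    · rw [r₂.aP]; exact r₂.ok
    · have := Nat.mul_le_mul_right (2 * B + 1) (Nat.mul_le_mul_right (2 * B + 1) r₂.le)
      omega
  refine Term.seq (table ctx r₂.vs fun σ₃ r₃ hc₃ => Term.set ?_ ?_)
  · refine r₃.ctx.safe_getExp ?_ trivial trivial r₂.pos ?_ ?_
    · have := hE.cap_lt
      simp only [Safe]
      omega
    · simp only [eval, r₃.ctx.vL]; omega
    · simp only [eval, r₃.ctx.vT]; omega
  · have hst : (states σ₃).lo 0 = 0 ∧ (states σ₃).hi 0 = 2 * F₁.size := by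
      simp only [states, r₃.arr .SI (by simp), r₃.arr .SJ (by simp)]
      exact ⟨r₂.lo, r₂.hi⟩
    have hgood := (lookup_good (p := σ₃.a .P) (lab := σ₃.a .LB) (Z := states σ₃)
      (tab := σ₃.a .TAB) (L := 2 * F₁.size) (B := B) (N := F₁.size + F₂.size) (s := 0)
      (q := 2 * F₁.size) (r := 2 * (F₁.size + F₂.size)) (by omega) le_rfl (by omega) le_rfl
      fun a b ha hb _ _ => r₃.done 0 a b r₂.pos ha hb (by omega)).1
    have hP : σ₃.a .P = σ₁.a .P := (r₃.arr .P (by simp)).trans r₂.aP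
    have hLB : σ₃.a .LB = σ₁.a .LB := (r₃.arr .LB (by simp)).trans r₂.aLB
    have hD : parenDist (σ₃.a .P) (σ₃.a .LB) 0 (2 * F₁.size) (2 * F₁.size)
        (2 * (F₁.size + F₂.size)) = F₁.editDist F₂ := by
      unfold parenDist
      rw [hP, hLB, r₁.forest₁, r₁.forest₂]
    unfold StateData.Good at hgood
    rw [hst.1, hst.2, hD] at hgood
    -- The origin of the factor `4` in `B`: the left ends are not displaced, the right ends by twice
    -- the difference of the sizes, nothing is unmatched, and twice the distance is added.
    -- Altogether this is at most four times the distance.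
    have hpot : potential (σ₃.a .P) (σ₃.a .LB) (2 * F₁.size) 0 (2 * F₁.size) (2 * F₁.size)
        (2 * (F₁.size + F₂.size)) ≤ B := by
      unfold potential
      rw [hD]
      unfold shift unmatched
      rw [hP, hLB, r₁.forest₁, r₁.forest₂]
      omega
    have hup := hgood.2 hpot
    rw [hD] at hup
    refine ⟨?_, ?_⟩
    · simp only [St.tick, St.setVar, Function.update_self, eval_getExp, eval, r₃.ctx.vL, r₃.ctx.vT]
      unfold look
      rw [r₃.ctx.vL, r₃.ctx.vB, r₃.ctx.vW, r₃.ctx.vN]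
      exact le_antisymm hup hgood.1
    · have hc₁ := r₁.clk
      have hc₂ := r₂.clk
      have hle := Nat.mul_le_mul_left
        (((entryTime + 120) * (2 * B + 1) + 40) * (2 * B + 1) + 40) r₂.le
      have hS := r₂.le
      simp only [St.tick, St.setVar]
      unfold mainTime
      generalize (((entryTime + 120) * (2 * B + 1) + 40) * (2 * B + 1) + 40) *
        stateBound (2 * F₁.size) = X at *
      generalize (((entryTime + 120) * (2 * B + 1) + 40) * (2 * B + 1) + 40) * S = Y at *
      omega

end TreeEdit

/-! ### Transfer to the word RAM, word size and constants -/

namespace TreeEdit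

open Imp Exp Cmd OrdForest WordRAM

/-- Stores the length of the input in register `1`. -/
def preludeCode : List Instr := [.const 3 1, .load 3 3, .const 5 2, .load 5 5, .add 3 3 5,
  .const 5 2, .mul 3 3 5, .const 5 3, .add 1 3 5]

/-- The program for the word RAM. -/
def program : Program := preludeCode ++ (mainCmd.code layout 9 ++ [.halt])

theorem codeAt_self (l l' : List Instr) : CodeAt (l ++ l') l.length l' := by
  intro i _
  rw [List.getElem?_append_right (by omega)]
  simp

/-- The base address of the arrays is the length of the input, namely three parameters and two words
for each node. Only odd registers are used, so all the variables still hold `0`. -/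
theorem prelude_runs {w x₀ n₁ n₂ : ℕ} {l : List ℕ} (hw : 2 * (n₁ + n₂) + 3 < 2 ^ w) :
    ∃ c, Runs w program 9 (start (x₀ :: n₁ :: n₂ :: l)) c ∧ c.pc = 9 ∧
      c.reg 1 = 2 * (n₁ + n₂) + 3 ∧ (∀ r, c.reg (2 * r) = 0) ∧
      c.mem = (start (x₀ :: n₁ :: n₂ :: l)).mem := by
  have m₁ : 1 % 2 ^ w = 1 := Nat.mod_eq_of_lt (by omega)
  have m₂ : 2 % 2 ^ w = 2 := Nat.mod_eq_of_lt (by omega)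
  have m₃ : 3 % 2 ^ w = 3 := Nat.mod_eq_of_lt (by omega)
  have m₄ : (n₁ + n₂) % 2 ^ w = n₁ + n₂ := Nat.mod_eq_of_lt (by omega)
  have m₅ : ((n₁ + n₂) * 2) % 2 ^ w = (n₁ + n₂) * 2 := Nat.mod_eq_of_lt (by omega)
  have m₆ : ((n₁ + n₂) * 2 + 3) % 2 ^ w = (n₁ + n₂) * 2 + 3 := Nat.mod_eq_of_lt (by omega)
  refine ⟨_, .head (i := .const 3 1) rfl <| .head (i := .load 3 3) rfl <|
    .head (i := .const 5 2) rfl <| .head (i := .load 5 5) rfl <| .head (i := .add 3 3 5) rfl <|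
    .head (i := .const 5 2) rfl <| .head (i := .mul 3 3 5) rfl <|
    .head (i := .const 5 3) rfl <| .head (i := .add 1 3 5) rfl <| .refl 0, rfl, ?_, ?_, rfl⟩
  · simp [exec, Config.setReg, start, m₁, m₂, m₃, m₄, m₅, m₆]
    ring
  · intro r
    simp only [exec, Config.setReg]
    repeat rw [Function.update_of_ne (by omega)]
    rfl

/-- The environment for the main program. -/
def env (x : List ℕ) (N cap w : ℕ) : Env := ⟨fun i => x.getD i 0, 2 * N + 3, cap, w⟩

theorem program_correct {k a₁ a₂ w cap : ℕ} {c₁ c₂ F₁ F₂ : OrdForest ℕ}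
    (hF₁ : F₁ = .cons a₁ c₁ .nil) (hF₂ : F₂ = .cons a₂ c₂ .nil)
    (hcap₁ : 20 * (F₁.size + F₂.size + 1) ≤ cap)
    (hcap₂ : stateBound (2 * F₁.size) * (2 * (4 * min k (F₁.size + F₂.size)) + 1) *
      (2 * (4 * min k (F₁.size + F₂.size)) + 1) + 4 ≤ cap)
    (hcap₃ : 2 * (F₁.size + F₂.size) + 3 + cap * 10 ≤ 2 ^ w)
    (hw : ∀ x ∈ k :: F₁.size :: F₂.size :: (F₁.encode id ++ F₂.encode id), x < 2 ^ w)
    (hk : F₁.editDist F₂ ≤ k) :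
    ∃ t, t ≤ 9 + mainTime (stateBound (2 * F₁.size)) (F₁.size + F₂.size)
        (4 * min k (F₁.size + F₂.size)) ∧
      OutputsIn w program (k :: F₁.size :: F₂.size :: (F₁.encode id ++ F₂.encode id)) t
        (F₁.editDist F₂) := by
  obtain ⟨x, hx⟩ : ∃ x, x = k :: F₁.size :: F₂.size :: (F₁.encode id ++ F₂.encode id) :=
    ⟨_, rfl⟩
  have hlen : x.length = 2 * (F₁.size + F₂.size) + 3 := by
    simp only [hx, List.length_cons, List.length_append, length_encode]
    omega
  have hg : ∀ i, x.getD i 0 < 2 ^ w := by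
    intro i
    by_cases hi : i < x.length
    · rw [List.getD_eq_getElem _ _ hi]
      exact hw _ (hx ▸ List.getElem_mem hi)
    · rw [List.getD_eq_default _ _ (by omega)]
      positivity
  obtain ⟨c, hr, hpc, hbase, hreg, hmem⟩ := prelude_runs (w := w) (x₀ := k) (n₁ := F₁.size)
    (n₂ := F₂.size) (l := F₁.encode id ++ F₂.encode id) (by omega)
  rw [← hx] at hr hmem ⊢
  have hmem' : ∀ i, c.mem i = x.getD i 0 := fun i => by rw [hmem]; rfl
  obtain ⟨σ, hσ, hres, hclk⟩ := main_correct (E := env x (F₁.size + F₂.size) cap w) (k := k)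
    hF₁ hF₂ ⟨rfl, by simp only [env, Env.lim]; omega, by simp only [env, Env.lim]; omega, hcap₁⟩
    hcap₂ (by simp [env, hx]) (by simp [env, hx]) (by simp [env, hx])
    (by
      intro i _
      simp only [env, hx]
      rw [show 3 + i = i + 1 + 1 + 1 by ring]
      simp)
    (fun y hy => hw y (by simp only [List.mem_cons]; exact .inr (.inr (.inr hy)))) hk
  have hcode : CodeAt program 9 (mainCmd.code layout 9 ++ [.halt]) := codeAt_self preludeCode _
  obtain ⟨h₁, h₂⟩ := hcode.append
  obtain ⟨h₃, -⟩ := h₂.cons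
  obtain ⟨-, c', hr', hrel, hpc'⟩ := hσ.runs (Y := layout) (c := c)
    ⟨by simp only [env, layout]; omega, by simp only [env, layout]; omega⟩ h₁ hpc
    -- Memory behind the input is zero, and so the arrays are zero initially, as the main program
    -- assumes.
    ⟨Words.runs ⟨fun _ => by simp [start], hg⟩ hr, fun y => hreg _, hbase,
      fun i _ => hmem' i, fun a i _ => by
        rw [hmem', List.getD_eq_default]
        simp only [env]
        omega⟩
  obtain ⟨t, ht, rfl⟩ := hr.trans hr'
  simp only [Nat.sub_zero] at ht
  refine ⟨t, by omega, ?_, ?_⟩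
  · unfold Halted
    rw [hpc']
    exact h₃
  · rw [← hres]
    exact hrel.var .res

/-- At most `16 * n ^ 2` states and offsets below `32 * n` give a table of at most `2 ^ 14 * n ^ 4`
cells. As `2 ≤ n`, constants are absorbed by powers of `n`; the capacity `n ^ 19` and the exponent
`25` for ten interleaved arrays and the input are generous. -/
theorem cap_bound {n n₁ n₂ k : ℕ} (hn : 2 ≤ n) (h₁ : n₁ ≤ n) (h₂ : n₂ ≤ n) :
    20 * (n₁ + n₂ + 1) ≤ n ^ 19 ∧
    stateBound (2 * n₁) * (2 * (4 * min k (n₁ + n₂)) + 1) *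
      (2 * (4 * min k (n₁ + n₂)) + 1) + 4 ≤ n ^ 19 ∧
    2 * (n₁ + n₂) + 3 + n ^ 19 * 10 ≤ n ^ 25 := by
  have hm : min k (n₁ + n₂) ≤ 2 * n := (min_le_right _ _).trans (by omega)
  have hW : 2 * (4 * min k (n₁ + n₂)) + 1 ≤ 32 * n := by omega
  have hS : stateBound (2 * n₁) ≤ 16 * n ^ 2 := by
    refine (stateBound_mono (show 2 * n₁ ≤ 2 * n by omega)).trans ?_
    unfold stateBound
    have : Nat.log 2 (2 * n) ≤ 2 * n := Nat.log_le_self _ _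
    nlinarith [Nat.mul_le_mul_left (2 * (2 * n)) this]
  have pw : ∀ a, 2 ^ a ≤ n ^ a := fun a => Nat.pow_le_pow_left hn a
  have p₁ := pw 9
  have p₂ := pw 15
  have p₃ := pw 6
  have e₁ : n ^ 19 = n ^ 15 * n ^ 4 := by ring
  have e₂ : n ^ 25 = n ^ 6 * n ^ 19 := by ring
  have e₃ : n ^ 19 = n ^ 9 * n ^ 10 := by ring
  have e₄ : n ≤ n ^ 10 := Nat.le_self_pow (by norm_num) n
  have e₅ : n ≤ n ^ 19 := Nat.le_self_pow (by norm_num) n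
  have e₆ : n ≤ n ^ 4 := Nat.le_self_pow (by norm_num) n
  refine ⟨?_, ?_, ?_⟩
  · have := Nat.mul_le_mul p₁ e₄
    rw [← e₃] at this
    omega
  · have h₃ : stateBound (2 * n₁) * (2 * (4 * min k (n₁ + n₂)) + 1) *
        (2 * (4 * min k (n₁ + n₂)) + 1) ≤ 16 * n ^ 2 * (32 * n) * (32 * n) :=
      Nat.mul_le_mul (Nat.mul_le_mul hS hW) hW
    have h₄ := Nat.mul_le_mul_right (n ^ 4) p₂
    rw [← e₁] at h₄
    have h₅ : 16 * n ^ 2 * (32 * n) * (32 * n) = 2 ^ 14 * n ^ 4 := by ring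
    omega
  · have := Nat.mul_le_mul_right (n ^ 19) p₃
    rw [← e₂] at this
    omega

/-- The constant in the bound for the running time. -/
def timeConst : ℕ := (entryTime + 500) * (81 * 26) + 3600 +
  2 * ((getExp (const 0) (var .L) (var .T)).cost + 409)

/-- The width is `8 * min k N + 1`, hence at most `9 * k`, whose square is the source of `81`. Since
`1 ≤ W`, all terms proportional to the number of states fit under `(K + 500) * W ^ 2`. -/
theorem time_le_nat (K M R : ℕ) {n n₁ n₂ k W S S' : ℕ} (h₁ : n₁ ≤ n) (h₂ : n₂ ≤ n)
    (hW₁ : 1 ≤ W) (hW : W ≤ 9 * k) (hS : S ≤ S') (hM : M = (K + 500) * (81 * k ^ 2)) :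
    9 + ((((K + 120) * W + 40) * W + 40) * S + 300 * S + 900 * (n₁ + n₂) + (R + 400)) ≤
      M * S' + 1800 * n + (R + 409) := by
  have q₁ : (((K + 120) * W + 40) * W + 40) + 300 ≤ (K + 500) * W ^ 2 := by
    nlinarith
  have q₂ : (K + 500) * W ^ 2 ≤ M := by
    refine hM ▸ Nat.mul_le_mul_left _ ((Nat.pow_le_pow_left hW 2).trans_eq ?_)
    ring
  have q₃ := Nat.mul_le_mul (q₁.trans q₂) hS
  rw [add_mul] at q₃
  clear q₁ q₂ hM
  generalize M * S' = x at *
  generalize (((K + 120) * W + 40) * W + 40) * S = y at *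
  omega

/-- Terms without a logarithm are absorbed by means of this, because `Real.log 2` exceeds one half.
-/
theorem one_le_two_mul_log {n : ℕ} (hn : 2 ≤ n) : (1 : ℝ) ≤ 2 * Real.log n := by
  have h₃ := Real.log_two_gt_d9
  have h₄ : Real.log 2 ≤ Real.log n := Real.log_le_log (by norm_num) (by exact_mod_cast hn)
  linarith

/-- The binary logarithm is at most twice the natural one, since `Real.log 2` exceeds one half; the
lower-order terms make up the rest of the constant. -/
theorem stateBound_le_log {n : ℕ} (hn : 2 ≤ n) :
    (stateBound (2 * n) : ℝ) ≤ 26 * (n * Real.log n) := by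
  have hl := one_le_two_mul_log hn
  have hlog : (Nat.log 2 n : ℝ) ≤ 2 * Real.log n := by
    have h₃ : (2 : ℝ) ^ Nat.log 2 n ≤ n := by
      exact_mod_cast Nat.pow_log_le_self 2 (by omega)
    have h₄ := Real.log_le_log (by positivity) h₃
    rw [Real.log_pow] at h₄
    have h₅ := Real.log_two_gt_d9
    have h₆ : (0 : ℝ) ≤ Nat.log 2 n := Nat.cast_nonneg _
    nlinarith
  have hn' : (2 : ℝ) ≤ n := by exact_mod_cast hn
  have e : Nat.log 2 (2 * n) = Nat.log 2 n + 1 := by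
    rw [mul_comm, Nat.log_mul_base (by norm_num) (by omega)]
  unfold stateBound
  rw [e]
  push_cast
  nlinarith

theorem time_le (K R : ℕ) {n n₁ n₂ k W : ℕ} (hn : 2 ≤ n) (hk : 1 ≤ k) (h₁ : n₁ ≤ n) (h₂ : n₂ ≤ n)
    (hW₁ : 1 ≤ W) (hW : W ≤ 9 * k) :
    ((9 + ((((K + 120) * W + 40) * W + 40) * stateBound (2 * n₁) + 300 * stateBound (2 * n₁) +
      900 * (n₁ + n₂) + (R + 400)) : ℕ) : ℝ) ≤
      ((K + 500) * (81 * 26) + 3600 + 2 * (R + 409) : ℕ) *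
        ((n : ℝ) * (k : ℝ) ^ 2 * Real.log n) := by
  refine (Nat.cast_le.mpr (time_le_nat K _ R h₁ h₂ hW₁ hW
    (stateBound_mono (show 2 * n₁ ≤ 2 * n by omega)) rfl)).trans ?_
  have hS := stateBound_le_log hn
  have hl := one_le_two_mul_log hn
  have hn' : (2 : ℝ) ≤ n := by exact_mod_cast hn
  have hk₂ : (1 : ℝ) ≤ (k : ℝ) ^ 2 := one_le_pow₀ (by exact_mod_cast hk)
  have hnl : (n : ℝ) ≤ 2 * (n * Real.log n) := by nlinarith
  rw [show (n : ℝ) * (k : ℝ) ^ 2 * Real.log n = n * Real.log n * (k : ℝ) ^ 2 by ring]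
  push_cast
  generalize (n : ℝ) * Real.log n = y at *
  have hyk : y ≤ y * (k : ℝ) ^ 2 := le_mul_of_one_le_right (by linarith) hk₂
  have t₁ : ((K : ℝ) + 500) * (81 * (k : ℝ) ^ 2) * stateBound (2 * n) ≤
      ((K : ℝ) + 500) * (81 * (k : ℝ) ^ 2) * (26 * y) := by gcongr
  have t₂ : ((R : ℝ) + 409) * 1 ≤ (R + 409) * (2 * (y * (k : ℝ) ^ 2)) := by
    gcongr
    linarith
  calc _ ≤ ((K : ℝ) + 500) * (81 * (k : ℝ) ^ 2) * (26 * y) + 3600 * (y * (k : ℝ) ^ 2) +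
        (R + 409) * (2 * (y * (k : ℝ) ^ 2)) := by linarith
    _ = _ := by ring

theorem mainTime_le {n n₁ n₂ k : ℕ} (hn : 2 ≤ n) (hk : 1 ≤ k) (h₁ : n₁ ≤ n) (h₂ : n₂ ≤ n) :
    ((9 + mainTime (stateBound (2 * n₁)) (n₁ + n₂) (4 * min k (n₁ + n₂)) : ℕ) : ℝ) ≤
      timeConst * ((n : ℝ) * (k : ℝ) ^ 2 * Real.log n) :=
  time_le _ _ hn hk h₁ h₂ (by omega) (by have := min_le_left k (n₁ + n₂); omega)

end TreeEdit

/-- There is one word RAM program which, given `k` and two ordered rooted trees with node labels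
from any alphabet (a label being stored as one word), each of at most `n` nodes and with unweighted
tree edit distance at most `k`, computes that distance in `O(n k ^ 2 log n)` steps, on every machine
whose word size is at least a suitable constant times `log n`. -/
theorem theorem1 :
    ∃ (P : WordRAM.Program) (C : ℝ) (c : ℕ),
      ∀ (A : Type*) (code : A → ℕ), Function.Injective code →
        ∀ (n k w : ℕ) (T₁ T₂ : OrdTree A),
          2 ≤ n → 1 ≤ k →
          T₁.size ≤ n → T₂.size ≤ n →
          OrdTree.editDist T₁ T₂ ≤ k →
          n ^ c ≤ 2 ^ w →
          WordRAM.Fits w (OrdTree.input code k T₁ T₂) →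
          ∃ t : ℕ, (t : ℝ) ≤ C * ((n : ℝ) * (k : ℝ) ^ 2 * Real.log (n : ℝ)) ∧
            WordRAM.OutputsIn w P (OrdTree.input code k T₁ T₂) t (OrdTree.editDist T₁ T₂) := by
  refine ⟨TreeEdit.program, TreeEdit.timeConst, 25, ?_⟩
  intro A code hcode n k w T₁ T₂ hn hk h₁ h₂ hed hw hfit
  -- The program sees only the codes of the labels; injectivity of the code leaves the distance
  -- unchanged.
  have hd : OrdTree.editDist T₁ T₂ =
      (T₁.toForest.map code).editDist (T₂.toForest.map code) :=
    (OrdForest.editDist_map hcode _ _).symm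
  have hs₁ : (T₁.toForest.map code).size = T₁.size := OrdForest.size_map _ _
  have hs₂ : (T₂.toForest.map code).size = T₂.size := OrdForest.size_map _ _
  have hin : OrdTree.input code k T₁ T₂ = k :: (T₁.toForest.map code).size ::
      (T₂.toForest.map code).size :: ((T₁.toForest.map code).encode id ++
        (T₂.toForest.map code).encode id) := by
    rw [OrdForest.encode_map, OrdForest.encode_map, hs₁, hs₂]
    rfl
  rw [← hs₁] at h₁
  rw [← hs₂] at h₂
  rw [hd] at hed ⊢
  rw [hin] at hfit ⊢
  obtain ⟨b₁, b₂, b₃⟩ := TreeEdit.cap_bound (k := k) hn h₁ h₂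
  obtain ⟨t, ht, ht'⟩ := TreeEdit.program_correct (w := w) rfl rfl b₁ b₂ (b₃.trans hw) hfit.2 hed
  exact ⟨t, (Nat.cast_le.mpr ht).trans (TreeEdit.mainTime_le hn hk h₁ h₂), ht'⟩
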